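/- **Setting.** Manifolds are smooth (Hausdorff, second countable) manifolds with corners modelled on $[0,\infty)^d$; $G$ is a finite group; a $G$-manifold carries a smooth $G$-action that is trivial on corners (the stabilizer of $x$ preserves each local boundary component at $x$). Let $M$ be a compact $m$-dimensional $G$-manifold and $W$ an equivariant $h$-cobordism on $M$: a compact $(m+1)$-dimensional $G$-manifold with disjoint faces $M$ (bottom) and $N$ (top) whose inclusions are equivariant homotopy equivalences, and with a lower collar $c$, an equivariant diffeomorphism from an open neighborhood of $M\times\{-1\}\cup\partial M\times[-1,0]$ in $M\times[-1,0]$ onto an open neighborhood of the bottom and the sides of $W$, taking $M\times\{-1\}$ to the bottom and $\partial M\times[-1,0]$ to the sides. Let $\bar W=W\cup_N W$ have a mirror structure: a smooth structure that restricts to that of $W$ on each half, with $G$ and the reflection acting smoothly. Let $\rho=(r,h)\colon W\to M\times[-1,0]$ be an encasing function: $\rho$ is smooth and equivariant, $\rho\circ c=\mathrm{id}$ near the bottom and the sides, $h^{-1}(0)=N$, $dh\ne0$ along $N$, and the extension $\bar W\to M\times[-1,1]$, $\rho=(r,h)$, that commutes with the reflections is smooth. Let $p\colon D(\nu)\to M$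 be a $G$-equivariant round bundle: a smooth bundle of closed unit discs $D(V)$, $V=\mathbb R^k$, $k\ge0$, with structure group the diffeomorphisms of $D(V)$ preserving the distance to the centre, on which $G$ acts by round bundle isomorphisms; $|e|$ denotes the distance to the centre. For $u=(e,t)\in D(\nu)\times[-1,1]$ put $|u|=\sqrt{|e|^2+t^2}$, and let $D(\nu\times\mathbb R)$, $S(\nu\times\mathbb R)$, $C(\nu\times\mathbb R)$ be the sets where $|u|\le1$, $|u|=1$, $|u|\ge1$. The stabilized double $\mathrm{St}^\nu(\bar W)$ is the space obtained by gluing $C(\nu\times\mathbb R)$ and $$W\times_{M\times[0,1]}D(\nu\times\mathbb R)=\{(w,u): r(w)=p(u),\ -h(w)=|u|\}$$ along $S(\nu\times\mathbb R)$, where $u\in S(\nu\times\mathbb R)$ is identified with $(p(u),u)$, $p(u)\in M\subset W$. The group $G$ and the reflection $t\mapsto -t$ act on it. Its cone locus is $\{(n,u):n\in N,\ |u|=0\}\cong N$. Away from the cone locus the smooth structure is prescribed: on $C(\nu\times\mathbb R)$ together with the points $(w,u)$, $w\notin N$, with $w$ in the part of the lower collar corresponding to the interior of the set where $\rho\circ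 c=\mathrm{id}$, it is that of an open subset of $D(\nu)\times[-1,1]$ via $(w,u)\mapsto u$; on the points $(w,u)$ with $w\notin M\cup N$ it is that of the fiber product as a subset of $W\times D(\nu)\times\mathbb R$. At $n\in N$ a *choice* consists of an open neighborhood $U$ of $n$ in $N$, a number $\epsilon>0$, a smooth bicollar $b\colon U\times(-\epsilon,\epsilon)\to\bar W$ (a diffeomorphism onto an open subset, $b(\cdot,0)$ the inclusion, commuting with the reflections, $h\circ b$ the projection to $(-\epsilon,\epsilon)$) and a smooth trivialization of $\nu$ as a round bundle over an open set of $M$ containing $r(b(U\times(-\epsilon,\epsilon)))$. The corresponding chart is defined on the points $(w,u)$ of the fiber product with $w\in b(U\times(-\epsilon,0])$; it sends $(w,(e,t))$ with $w=b(n',s)$ to $(n',(v,t))\in U\times(V\times\mathbb R)$, where $v\in D(V)$ is the coordinate of $e$ in the trivialization. **Proposition.** 1. The smooth structure given by the charts at the cone locus is independent of the choices: for any two choices (at the same or at different points of $N$, equivariant or not) the transition map between the two charts is a diffeomorphism between open subsets of $N\times(V\times\mathbb R)$. 2. Choices exist at every $n\in N$; they can be taken so that $U$ is invariant and $b$ equivariant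 under the isotropy group $G_n$, and so that the trivialization of $\nu$ is over a $G_{r(n)}$-invariant open set (so that $G_{r(n)}$ acts there by families of round diffeomorphisms of $D(V)$). 3. The charts therefore give a well-defined smooth structure on $\mathrm{St}^\nu(\bar W)$: there is a smooth structure (maximal smooth atlas modelled on $[0,\infty)^{m+k+1}$) that has the prescribed form away from the cone locus and for which, for every $n\in N$ and every choice at $n$, the chart is a diffeomorphism from an open set onto $\{(n',(v,t)): n'\in U,\ |v|^2+t^2<\epsilon^2\}$. It is the only smooth structure of the prescribed form away from the cone locus for which, for each $n\in N$, at least one such chart at $n$ is smooth in this sense. The group $G$ and the reflection act smoothly with respect to it. -/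

import Mathlib

open Set Filter Topology
open scoped Manifold ContDiff

noncomputable section

namespace PolarStab

universe uG uM uN uW uE

/-! ### Manifolds with corners and smooth structures -/

/-- The model `[0,∞)^d` of `d`-dimensional manifolds with corners. -/
abbrev corners (d : ℕ) : ModelWithCorners ℝ (EuclideanSpace ℝ (Fin d)) (EuclideanQuadrant d) :=
  modelWithCornersEuclideanQuadrant d

/-- A smooth structure with corners of dimension `d` on a topological space: a maximal smooth atlas
of charts with values in `[0,∞)^d`. -/
structure SmoothStructure (d : ℕ) (X : Type*) [TopologicalSpace X] where
  atlas : Set (OpenPartialHomeomorph X (EuclideanQuadrant d))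
  cover : ∀ x, ∃ e ∈ atlas, x ∈ e.source
  compatible : ∀ e ∈ atlas, ∀ e' ∈ atlas, e.symm ≫ₕ e' ∈ contDiffGroupoid ∞ (corners d)
  maximal : ∀ e : OpenPartialHomeomorph X (EuclideanQuadrant d),
    (∀ e' ∈ atlas, e.symm ≫ₕ e' ∈ contDiffGroupoid ∞ (corners d) ∧
      e'.symm ≫ₕ e ∈ contDiffGroupoid ∞ (corners d)) → e ∈ atlas

/-- The charted space underlying a smooth structure. -/
@[reducible] def SmoothStructure.chartedSpace {d : ℕ} {X : Type*} [TopologicalSpace X]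
    (S : SmoothStructure d X) : ChartedSpace (EuclideanQuadrant d) X where
  atlas := S.atlas
  chartAt x := (S.cover x).choose
  mem_chart_source x := (S.cover x).choose_spec.2
  chart_mem_atlas x := (S.cover x).choose_spec.1

/-- `f` restricts to a diffeomorphism from the subset `A` of `X` onto the subset `B` of `Y`, where
a map on a subset of a manifold is smooth in the usual sense for maps on subsets. -/
def IsDiffeoOnto {F H F' H' X Y : Type*}
    [NormedAddCommGroup F] [NormedSpace ℝ F] [TopologicalSpace H]
    [NormedAddCommGroup F'] [NormedSpace ℝ F'] [TopologicalSpace H']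
    [TopologicalSpace X] [ChartedSpace H X] [TopologicalSpace Y] [ChartedSpace H' Y]
    (I : ModelWithCorners ℝ F H) (I' : ModelWithCorners ℝ F' H')
    (f : X → Y) (A : Set X) (B : Set Y) : Prop :=
  ContMDiffOn I I' ∞ f A ∧ MapsTo f A B ∧
    ∃ f' : Y → X, ContMDiffOn I' I ∞ f' B ∧ MapsTo f' B A ∧ InvOn f' f A B

/-- `F` is (the image of) a face: a closed subset that coincides, near each of its points, with
exactly one of the local boundary components at that point. -/
def IsFace (d : ℕ) {X : Type*} [TopologicalSpace X] [ChartedSpace (EuclideanQuadrant d) X]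
    (F : Set X) : Prop :=
  IsClosed F ∧ ∀ x ∈ F, ∃ i : Fin d, (chartAt (EuclideanQuadrant d) x x).1 i = 0 ∧
    ∀ᶠ y in 𝓝 x, y ∈ F ↔ (chartAt (EuclideanQuadrant d) x y).1 i = 0

/-- A smooth action on a manifold with corners which is trivial on corners: the stabilizer of each
point `x` maps each local boundary component at `x` to itself. -/
structure IsGManifold (G : Type*) [Group G] (d : ℕ) (X : Type*) [TopologicalSpace X]
    [ChartedSpace (EuclideanQuadrant d) X] [MulAction G X] : Prop where
  smooth_smul : ∀ g : G, ContMDiff (corners d) (corners d) ∞ (fun x : X ↦ g • x)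
  trivial_on_corners : ∀ (x : X) (g : G), g • x = x →
    ∀ i : Fin d, (chartAt (EuclideanQuadrant d) x x).1 i = 0 →
      ∀ᶠ y in 𝓝 x, (chartAt (EuclideanQuadrant d) x y).1 i = 0 →
        (chartAt (EuclideanQuadrant d) x (g • y)).1 i = 0

/-- Equivariant homotopy equivalences. -/
def IsEquivariantHomotopyEquiv (G : Type*) [Group G] {X Y : Type*}
    [TopologicalSpace X] [TopologicalSpace Y] [MulAction G X] [MulAction G Y] (f : X → Y) : Prop :=
  ∃ f₀ : C(X, Y), ⇑f₀ = f ∧ (∀ (g : G) x, f₀ (g • x) = g • f₀ x) ∧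
    ∃ f₁ : C(Y, X), (∀ (g : G) y, f₁ (g • y) = g • f₁ y) ∧
      (∃ K : (f₁.comp f₀).Homotopy (ContinuousMap.id X),
        ∀ (g : G) t x, K (t, g • x) = g • K (t, x)) ∧
      (∃ K : (f₀.comp f₁).Homotopy (ContinuousMap.id Y),
        ∀ (g : G) t y, K (t, g • y) = g • K (t, y))

/-! ### Doubles -/

/-- The relation gluing two copies of `W` along the subset `T`. -/
def doubleSetoid {W : Type*} (T : Set W) : Setoid (W × Bool) where
  r a b := a.1 = b.1 ∧ (a.2 = b.2 ∨ a.1 ∈ T)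
  iseqv :=
    { refl := fun _ ↦ ⟨rfl, Or.inl rfl⟩
      symm := fun {_ _} h ↦ ⟨h.1.symm, h.2.imp Eq.symm fun h' ↦ h.1 ▸ h'⟩
      trans := fun {a b c} h h' ↦ ⟨h.1.trans h'.1, by
        rcases h.2 with h2 | h2
        · rcases h'.2 with h3 | h3
          · exact Or.inl (h2.trans h3)
          · exact Or.inr (h.1 ▸ h3)
        · exact Or.inr h2⟩ }

/-- The double of `W` along `T`: two copies of `W` glued along `T`. -/
def Double {W : Type*} (T : Set W) : Type _ := Quotient (doubleSetoid T)

instance {W : Type*} [TopologicalSpace W] (T : Set W) : TopologicalSpace (Double T) :=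
  inferInstanceAs (TopologicalSpace (Quotient (doubleSetoid T)))

/-- The inclusions of the lower (`false`) and of the upper (`true`) copy of `W`. -/
def Double.half {W : Type*} (T : Set W) (a : Bool) (w : W) : Double T :=
  Quotient.mk (doubleSetoid T) (w, a)

/-- The reflection of the double, interchanging the two copies. -/
def Double.flip {W : Type*} (T : Set W) : Double T → Double T :=
  Quotient.map (fun a : W × Bool ↦ (a.1, !a.2)) fun _ _ h ↦
    ⟨h.1, h.2.imp (fun h' ↦ congrArg Bool.not h') id⟩

/-- A self-map of `W` preserving `T`, applied to both copies. -/
def Double.map {W : Type*} (T : Set W) (f : W → W) (hf : ∀ w ∈ T, f w ∈ T) :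
    Double T → Double T :=
  Quotient.map (fun a : W × Bool ↦ (f a.1, a.2)) fun _ _ h ↦
    ⟨congrArg f h.1, h.2.imp id (hf _)⟩

/-- The function on the double given by a pair of functions on the two copies that agree on `T`. -/
def Double.lift {W Y : Type*} (T : Set W) (f : W → Bool → Y)
    (hf : ∀ w ∈ T, ∀ a b, f w a = f w b) : Double T → Y :=
  Quotient.lift (fun a : W × Bool ↦ f a.1 a.2) fun a b h ↦ by
    obtain ⟨w, i⟩ := a
    obtain ⟨w', j⟩ := b
    obtain ⟨h1, h2⟩ := h
    dsimp only at h1 h2 ⊢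
    subst h1
    exact h2.elim (fun h' ↦ by rw [h']) fun h' ↦ hf _ h' _ _

/-! ### `h`-cobordisms -/

instance : Fact ((-1 : ℝ) < 0) := ⟨by norm_num⟩

section HCob

variable (G : Type uG) [Group G] (m : ℕ)
  (M : Type uM) [TopologicalSpace M] [ChartedSpace (EuclideanQuadrant m) M] [MulAction G M]
  (N : Type uN) [TopologicalSpace N] [ChartedSpace (EuclideanQuadrant m) N] [MulAction G N]
  (W : Type uW) [TopologicalSpace W] [ChartedSpace (EuclideanQuadrant (m + 1)) W] [MulAction G W]

/-- `W` as an equivariant `h`-cobordism on `M` with top `N`. -/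
structure HCobordism where
  /-- the identification of the bottom face with `M` -/
  bottom : M → W
  /-- the inclusion of the top face -/
  top : N → W
  bottom_diffeo : IsDiffeoOnto (corners m) (corners (m + 1)) bottom univ (range bottom)
  top_diffeo : IsDiffeoOnto (corners m) (corners (m + 1)) top univ (range top)
  bottom_face : IsFace (m + 1) (range bottom)
  top_face : IsFace (m + 1) (range top)
  disjoint : Disjoint (range bottom) (range top)
  bottom_smul : ∀ (g : G) x, bottom (g • x) = g • bottom x
  top_smul : ∀ (g : G) n, top (g • n) = g • top n
  /-- the lower collar -/
  collar : OpenPartialHomeomorph (M × Icc (-1 : ℝ) 0) W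
  collar_smooth : ContMDiffOn ((corners m).prod (𝓡∂ 1)) (corners (m + 1)) ∞ collar collar.source
  collar_symm_smooth :
    ContMDiffOn (corners (m + 1)) ((corners m).prod (𝓡∂ 1)) ∞ collar.symm collar.target
  /-- the domain of the collar contains the bottom and the sides of `M × [-1,0]` -/
  subset_collar_source :
    {q : M × Icc (-1 : ℝ) 0 | (q.2 : ℝ) = -1 ∨ q.1 ∈ (corners m).boundary M} ⊆ collar.source
  collar_source_smul : ∀ (g : G), ∀ q ∈ collar.source, (g • q.1, q.2) ∈ collar.source
  collar_smul : ∀ (g : G), ∀ q ∈ collar.source, collar (g • q.1, q.2) = g • collar q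
  collar_bottom : ∀ q : M × Icc (-1 : ℝ) 0, (q.2 : ℝ) = -1 → collar q = bottom q.1
  /-- the collar takes `∂M × [-1,0]` to the sides of `W` -/
  collar_sides : collar '' {q | q.1 ∈ (corners m).boundary M} =
    closure ((corners (m + 1)).boundary W \ (range bottom ∪ range top))
  bottom_homotopyEquiv : IsEquivariantHomotopyEquiv G bottom
  top_homotopyEquiv : IsEquivariantHomotopyEquiv G top

variable {G m M N W}

theorem HCobordism.smul_mem_top (C : HCobordism G m M N W) (g : G) :
    ∀ w ∈ range C.top, g • w ∈ range C.top := by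
  rintro _ ⟨n, rfl⟩
  exact ⟨g • n, C.top_smul g n⟩

/-- The double of an `h`-cobordism along its top. -/
abbrev HCobordism.Dbl (C : HCobordism G m M N W) : Type uW := Double (range C.top)

variable (G m M N W)

/-- A mirror `h`-cobordism: an `h`-cobordism with a smooth structure on its double that restricts
to that of `W` on each half, and for which `G` and the reflection act smoothly. -/
structure MirrorHCobordism extends HCobordism G m M N W where
  mirror : SmoothStructure (m + 1) toHCobordism.Dbl
  half_diffeo : letI := mirror.chartedSpace
    ∀ a : Bool, IsDiffeoOnto (corners (m + 1)) (corners (m + 1))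
      (Double.half (range top) a) univ (range (Double.half (range top) a))
  smooth_smul : letI := mirror.chartedSpace
    ∀ g : G, ContMDiff (corners (m + 1)) (corners (m + 1)) ∞
      (Double.map (range top) (fun w ↦ g • w) (toHCobordism.smul_mem_top g))
  smooth_flip : letI := mirror.chartedSpace
    ContMDiff (corners (m + 1)) (corners (m + 1)) ∞ (Double.flip (range top))

/-- An encased `h`-cobordism: a mirror `h`-cobordism with an encasing function `ρ = (r, h)`. -/
structure EncasedHCobordism extends MirrorHCobordism G m M N W where
  /-- the retraction -/
  r : W → M
  /-- the height function -/
  h : W → ℝ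
  h_mem : ∀ w, h w ∈ Icc (-1 : ℝ) 0
  r_smul : ∀ (g : G) w, r (g • w) = g • r w
  h_smul : ∀ (g : G) w, h (g • w) = h w
  r_smooth : ContMDiff (corners (m + 1)) (corners m) ∞ r
  h_smooth : ContMDiff (corners (m + 1)) 𝓘(ℝ, ℝ) ∞ h
  /-- `ρ ∘ c` is the identity near the bottom and sides of `M × [-1,0]` -/
  encase_collar :
    ∀ᶠ q in 𝓝ˢ {q : M × Icc (-1 : ℝ) 0 | (q.2 : ℝ) = -1 ∨ q.1 ∈ (corners m).boundary M},
      r (collar q) = q.1 ∧ h (collar q) = q.2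
  h_eq_zero_iff : ∀ w, h w = 0 ↔ w ∈ range top
  h_rank : ∀ n, mfderiv (corners (m + 1)) 𝓘(ℝ, ℝ) h (top n) ≠ 0
  /-- the extension of `r` to the double that commutes with the reflection is smooth -/
  rDbl_smooth : letI := mirror.chartedSpace
    ContMDiff (corners (m + 1)) (corners m) ∞
      (Double.lift (range top) (fun w _ ↦ r w) fun _ _ _ _ ↦ rfl)
  /-- the extension of `h` to the double that commutes with the reflection is smooth -/
  hDbl_smooth : letI := mirror.chartedSpace
    ContMDiff (corners (m + 1)) 𝓘(ℝ, ℝ) ∞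
      (Double.lift (range top) (fun w a ↦ if a then -h w else h w) fun w hw a b ↦ by
        simp [(h_eq_zero_iff w).2 hw])

variable {G m M N W}

/-- The extension of the retraction to the double. -/
def EncasedHCobordism.rDbl (C : EncasedHCobordism G m M N W) : C.Dbl → M :=
  Double.lift (range C.top) (fun w _ ↦ C.r w) fun _ _ _ _ ↦ rfl

/-- The extension of the height function to the double. -/
def EncasedHCobordism.hDbl (C : EncasedHCobordism G m M N W) : C.Dbl → ℝ :=
  Double.lift (range C.top) (fun w a ↦ if a then -C.h w else C.h w) fun w hw a b ↦ by
    simp [(C.h_eq_zero_iff w).2 hw]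

end HCob

/-! ### Round bundles -/

section Round

variable {m k : ℕ}
  {M : Type uM} [TopologicalSpace M] [ChartedSpace (EuclideanQuadrant m) M]
  {E : Type uE} [TopologicalSpace E] [ChartedSpace (EuclideanQuadrant (m + k)) E]

/-- A smooth trivialization over `base` of `proj : E → M`, with fibre the closed unit disc of `ℝ^k`,
in which the given function `nrm` becomes the distance to the centre. -/
structure RoundTriv (proj : E → M) (nrm : E → ℝ) where
  base : Set M
  isOpen_base : IsOpen base
  /-- the parametrization of the part of `E` over `base`; only its restriction to
  `base × closedBall 0 1` matters -/
  param : M → EuclideanSpace ℝ (Fin k) → E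
  /-- the fibre coordinate; only its restriction to the part of `E` over `base` matters -/
  coord : E → EuclideanSpace ℝ (Fin k)
  proj_param : ∀ x ∈ base, ∀ v ∈ Metric.closedBall 0 1, proj (param x v) = x
  coord_param : ∀ x ∈ base, ∀ v ∈ Metric.closedBall 0 1, coord (param x v) = v
  coord_mem : ∀ e, proj e ∈ base → coord e ∈ Metric.closedBall 0 1
  param_coord : ∀ e, proj e ∈ base → param (proj e) (coord e) = e
  smooth_param : ContMDiffOn ((corners m).prod 𝓘(ℝ, EuclideanSpace ℝ (Fin k))) (corners (m + k)) ∞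
    (fun q : M × EuclideanSpace ℝ (Fin k) ↦ param q.1 q.2) (base ×ˢ Metric.closedBall 0 1)
  smooth_coord : ContMDiffOn (corners (m + k)) 𝓘(ℝ, EuclideanSpace ℝ (Fin k)) ∞ coord
    (proj ⁻¹' base)
  round : ∀ e, proj e ∈ base → ‖coord e‖ = nrm e

/-- A `G`-equivariant round bundle `D(ν) = E → M` with fibre the closed unit disc of `ℝ^k`. Two
trivializations differ by a family of round diffeomorphisms of the disc exactly if they induce the
same distance to the centre in the fibres, so a reduction of the structure group to the round
diffeomorphisms is the same as a fibrewise distance to the centre `nrm` that comes from smooth local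
trivializations; the preferred trivializations are those compatible with `nrm`. -/
structure RoundBundle (G : Type uG) [Group G] (m k : ℕ)
    (M : Type uM) [TopologicalSpace M] [ChartedSpace (EuclideanQuadrant m) M] [MulAction G M]
    (E : Type uE) [TopologicalSpace E] [ChartedSpace (EuclideanQuadrant (m + k)) E]
    [MulAction G E] where
  proj : E → M
  nrm : E → ℝ
  proj_smooth : ContMDiff (corners (m + k)) (corners m) ∞ proj
  locally_trivial : ∀ x, ∃ φ : RoundTriv (m := m) (k := k) proj nrm, x ∈ φ.base
  proj_smul : ∀ (g : G) e, proj (g • e) = g • proj e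
  nrm_smul : ∀ (g : G) e, nrm (g • e) = nrm e

end Round

/-! ### The polar stabilization -/

section Stab

variable {G : Type uG} [Group G] {m k : ℕ}
  {M : Type uM} [TopologicalSpace M] [ChartedSpace (EuclideanQuadrant m) M] [MulAction G M]
  {N : Type uN} [TopologicalSpace N] [ChartedSpace (EuclideanQuadrant m) N] [MulAction G N]
  {W : Type uW} [TopologicalSpace W] [ChartedSpace (EuclideanQuadrant (m + 1)) W] [MulAction G W]
  {E : Type uE} [TopologicalSpace E] [ChartedSpace (EuclideanQuadrant (m + k)) E] [MulAction G E]
  (C : EncasedHCobordism G m M N W) (ν : RoundBundle G m k M E)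

/-- The distance to the centre in the fibres of the round composite `D(ν × ℝ) → M`, as a function of
`u = (e, t)`. So `D(ν × ℝ)` and `S(ν × ℝ)` are the sets of `u` in `E × ℝ` where it is at most `1`
and equal to `1`, respectively. -/
def RoundBundle.nrmR (u : E × ℝ) : ℝ := Real.sqrt (ν.nrm u.1 ^ 2 + u.2 ^ 2)

/-- `C(ν × ℝ)`, the complement of the open disc bundle in `D(ν) × [-1,1]`. -/
def Trivial : Set (E × ℝ) := {u | u.2 ∈ Icc (-1 : ℝ) 1 ∧ 1 ≤ ν.nrmR u}

/-- The fibre product of `W` and `D(ν × ℝ)` over `M × [0,1]`, where `W` is mapped to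
`M × [0,1]` by `(r, -h)`. (The condition `nrmR ≤ 1` that defines `D(ν × ℝ)` follows from
`-h ≤ 1`.) -/
def Nontrivial : Set (W × (E × ℝ)) :=
  {q | C.r q.1 = ν.proj q.2.1 ∧ -C.h q.1 = ν.nrmR q.2}

/-- The relation that identifies the point `u` of `S(ν × ℝ)` in `C(ν × ℝ)` with the point
`(bottom (proj u), u)` of the fibre product. -/
def Glue : Trivial ν ⊕ Nontrivial C ν → Trivial ν ⊕ Nontrivial C ν → Prop
  | .inl u, .inr q => ν.nrmR u.1 = 1 ∧ q.1 = (C.bottom (ν.proj u.1.1), u.1)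
  | _, _ => False

/-- The stabilized double `St^ν(W̄)` as a topological space: the pushout of `C(ν × ℝ)` and the fibre
product along `S(ν × ℝ)`. -/
def St : Type (max uE uW) := Quot (Glue C ν)

instance : TopologicalSpace (St C ν) := inferInstanceAs (TopologicalSpace (Quot (Glue C ν)))

variable {C ν}

/-- The encasing `St^ν(W̄) → D(ν) × [-1,1]` of the stabilized double. -/
def St.encase : St C ν → E × ℝ :=
  Quot.lift (Sum.elim (fun u ↦ u.1) (fun q ↦ q.1.2)) (by
    rintro (u | q) (u' | q') h <;> simp only [Glue] at h
    simp [h.2])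

/-- The associated point in `W` of a point in the fibre product, extended to the trivial region
`C(ν × ℝ)` by the projection to the bottom `M` of `W`. -/
def St.toW : St C ν → W :=
  Quot.lift (Sum.elim (fun u ↦ C.bottom (ν.proj u.1.1)) (fun q ↦ q.1.1)) (by
    rintro (u | q) (u' | q') h <;> simp only [Glue] at h
    simp [h.2])

theorem RoundBundle.nrmR_smul (g : G) (u : E × ℝ) : ν.nrmR (g • u.1, u.2) = ν.nrmR u := by
  simp [RoundBundle.nrmR, ν.nrm_smul]

theorem RoundBundle.nrmR_neg (u : E × ℝ) : ν.nrmR (u.1, -u.2) = ν.nrmR u := by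
  simp [RoundBundle.nrmR]

/-- The action of `G` on the stabilized double. -/
def St.smul (g : G) : St C ν → St C ν :=
  Quot.map
    (Sum.map (fun u ↦ ⟨(g • u.1.1, u.1.2), u.2.1, u.2.2.trans (ν.nrmR_smul g u.1).ge⟩)
      (fun q ↦ ⟨(g • q.1.1, (g • q.1.2.1, q.1.2.2)),
        (C.r_smul g _).trans ((congrArg _ q.2.1).trans (ν.proj_smul g _).symm),
        (congrArg _ (C.h_smul g _)).trans (q.2.2.trans (ν.nrmR_smul g q.1.2).symm)⟩)) (by
    rintro (u | q) (u' | q') h <;> simp only [Glue] at h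
    refine ⟨(ν.nrmR_smul g u.1).trans h.1, ?_⟩
    simp [h.2, C.bottom_smul, ν.proj_smul])

/-- The reflection of the stabilized double in the `ℝ`-direction. -/
def St.flip : St C ν → St C ν :=
  Quot.map
    (Sum.map (fun u ↦ ⟨(u.1.1, -u.1.2),
        ⟨neg_le_neg u.2.1.2, (neg_le_neg u.2.1.1).trans (neg_neg _).le⟩,
        u.2.2.trans (ν.nrmR_neg u.1).ge⟩)
      (fun q ↦ ⟨(q.1.1, (q.1.2.1, -q.1.2.2)), q.2.1, q.2.2.trans (ν.nrmR_neg q.1.2).symm⟩)) (by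
    rintro (u | q) (u' | q') h <;> simp only [Glue] at h
    refine ⟨(ν.nrmR_neg u.1).trans h.1, ?_⟩
    simp [h.2])

variable (C ν)

/-- The part of `W` covered by the part of the lower collar `c` where `ρ ∘ c` is the identity. -/
def collarNhd : Set W :=
  C.collar '' interior {q | q ∈ C.collar.source ∧ C.r (C.collar q) = q.1 ∧ C.h (C.collar q) = q.2}

/-- The open neighbourhood of the trivial region of `St^ν(W̄)` that consists of the trivial region
and of the points of the nontrivial region, away from the cone locus, whose associated point in `W`
lies in the lower collar. The lower collar identifies it with a neighbourhood of `C(ν × ℝ)` in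
`D(ν) × [-1,1]`. -/
def outerRegion : Set (St C ν) := St.toW ⁻¹' (collarNhd C \ range C.top)

/-- The part of the fibre product away from the frontier and from the cone locus. -/
def middleRegion : Set (St C ν) := St.toW ⁻¹' (range C.bottom ∪ range C.top)ᶜ

/-- A smooth structure on the stabilized double has the prescribed form away from the cone locus: on
a neighbourhood of the trivial region (including the frontier) it is that of `D(ν) × [-1,1]`, and on
the rest of the nontrivial region it is that of the fibre product as a subset of
`W × D(ν × ℝ)`. -/
def IsStandardOffCone (S : SmoothStructure (m + k + 1) (St C ν)) : Prop :=
  letI := S.chartedSpace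
  (IsOpen (outerRegion C ν) ∧
    IsDiffeoOnto (corners (m + k + 1)) ((corners (m + k)).prod 𝓘(ℝ, ℝ))
      St.encase (outerRegion C ν) (St.encase '' outerRegion C ν)) ∧
  (IsOpen (middleRegion C ν) ∧
    IsDiffeoOnto (corners (m + k + 1)) ((corners (m + 1)).prod ((corners (m + k)).prod 𝓘(ℝ, ℝ)))
      (fun z ↦ (St.toW z, St.encase z)) (middleRegion C ν)
      ((fun z ↦ (St.toW z, St.encase z)) '' middleRegion C ν))

/-- The choices that define a chart at the point `n` of the cone locus: a smooth bicollar
`b : U × (-ε, ε) → W̄` of a neighbourhood `U` of `n` in `N`, which commutes with the reflections and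
for which `h ∘ b` is the projection to the second factor, and a trivialization of `ν` as a round
bundle near `r n`, over a set that contains the image of `r ∘ b`. -/
structure ConeChoice (n : N) where
  U : Set N
  isOpen_U : IsOpen U
  mem_U : n ∈ U
  ε : ℝ
  ε_pos : 0 < ε
  bicollar : OpenPartialHomeomorph (N × ℝ) C.Dbl
  bicollar_source : bicollar.source = U ×ˢ Ioo (-ε) ε
  smooth_bicollar : letI := C.mirror.chartedSpace
    ContMDiffOn ((corners m).prod 𝓘(ℝ, ℝ)) (corners (m + 1)) ∞ bicollar bicollar.source
  smooth_bicollar_symm : letI := C.mirror.chartedSpace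
    ContMDiffOn (corners (m + 1)) ((corners m).prod 𝓘(ℝ, ℝ)) ∞ bicollar.symm bicollar.target
  bicollar_zero : ∀ n' ∈ U, bicollar (n', 0) = Double.half (range C.top) false (C.top n')
  bicollar_neg : ∀ q ∈ bicollar.source,
    bicollar (q.1, -q.2) = Double.flip (range C.top) (bicollar q)
  h_bicollar : ∀ q ∈ bicollar.source, C.hDbl (bicollar q) = q.2
  triv : RoundTriv (m := m) (k := k) ν.proj ν.nrm
  mem_base : C.r (C.top n) ∈ triv.base
  r_bicollar : ∀ q ∈ bicollar.source, C.rDbl (bicollar q) ∈ triv.base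

variable {C ν}

/-- The choice respects the actions of the isotropy groups of `n` and of `r n`: the bicollar is
equivariant for the former, and the trivialization of `ν` is over a set invariant under the latter
(which then automatically acts on it by families of round diffeomorphisms of the fibre). -/
structure ConeChoice.IsEquivariant {n : N} (κ : ConeChoice C ν n) : Prop where
  smul_mem_U : ∀ g : G, g • n = n → ∀ n' ∈ κ.U, g • n' ∈ κ.U
  bicollar_smul : ∀ g : G, g • n = n → ∀ q ∈ κ.bicollar.source,
    κ.bicollar (g • q.1, q.2) =
      Double.map (range C.top) (fun w ↦ g • w) (C.smul_mem_top g) (κ.bicollar q)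
  smul_mem_base : ∀ g : G, g • C.r (C.top n) = C.r (C.top n) →
    ∀ x ∈ κ.triv.base, g • x ∈ κ.triv.base

/-- The domain of the chart at the cone locus: the points `(w, u)` of the fibre product with `w` in
the image of the collar. -/
def ConeChoice.domain {n : N} (κ : ConeChoice C ν n) : Set (St C ν) :=
  {z | Double.half (range C.top) false (St.toW z) ∈ κ.bicollar.target}

/-- The chart at the cone locus, with values in `N × (ℝ^k × ℝ)`: it sends `(w, (e, t))`, where
`w = b (n', s)`, to `n'` and the coordinate of `(e, t)` in the trivialization of `ν × ℝ`. -/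
def ConeChoice.chart {n : N} (κ : ConeChoice C ν n) (z : St C ν) :
    N × (EuclideanSpace ℝ (Fin k) × ℝ) :=
  ((κ.bicollar.symm (Double.half (range C.top) false (St.toW z))).1,
    (κ.triv.coord (St.encase z).1, (St.encase z).2))

/-- The open subset of `N × (ℝ^k × ℝ)` parametrizing the domain: the product of `U` and the
Euclidean `ε`-ball. -/
def ConeChoice.codomain {n : N} (κ : ConeChoice C ν n) :
    Set (N × (EuclideanSpace ℝ (Fin k) × ℝ)) :=
  {p | p.1 ∈ κ.U ∧ ‖p.2.1‖ ^ 2 + p.2.2 ^ 2 < κ.ε ^ 2}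

/-- The model with corners of `N × (ℝ^k × ℝ)`. -/
abbrev coneModel (m k : ℕ) :=
  (corners m).prod 𝓘(ℝ, EuclideanSpace ℝ (Fin k) × ℝ)

/-- The chart at the cone locus is a smooth chart for the smooth structure `S`. -/
def ConeChoice.IsChartOf {n : N} (κ : ConeChoice C ν n)
    (S : SmoothStructure (m + k + 1) (St C ν)) : Prop :=
  letI := S.chartedSpace
  IsOpen κ.domain ∧
    IsDiffeoOnto (corners (m + k + 1)) (coneModel m k) κ.chart κ.domain κ.codomain

/-- Two charts at the cone locus define the same smooth structure where their domains overlap: the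
transition map between them is a diffeomorphism between open subsets. -/
def ConeChoice.Compatible {n n' : N} (κ : ConeChoice C ν n) (κ' : ConeChoice C ν n') : Prop :=
  IsOpen (κ.chart '' (κ.domain ∩ κ'.domain)) ∧ IsOpen (κ'.chart '' (κ.domain ∩ κ'.domain)) ∧
    ∃ τ, IsDiffeoOnto (coneModel m k) (coneModel m k) τ
        (κ.chart '' (κ.domain ∩ κ'.domain)) (κ'.chart '' (κ.domain ∩ κ'.domain)) ∧
      EqOn (τ ∘ κ.chart) κ'.chart (κ.domain ∩ κ'.domain)

/-- The actions of `G` and of the reflection on the stabilized double are smooth. -/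
def ActsSmoothly (S : SmoothStructure (m + k + 1) (St C ν)) : Prop :=
  letI := S.chartedSpace
  (∀ g : G, ContMDiff (corners (m + k + 1)) (corners (m + k + 1)) ∞
    (St.smul g : St C ν → St C ν)) ∧
  ContMDiff (corners (m + k + 1)) (corners (m + k + 1)) ∞ (St.flip : St C ν → St C ν)

end Stab

end PolarStab

end

open Set Filter Topology
open scoped Manifold ContDiff

noncomputable section

namespace PolarStab

universe uG uM uN uW uE

/-! ### Calculus on convex sets -/

section Calculus

variable {X Y : Type} [NormedAddCommGroup X] [NormedSpace ℝ X]
  [NormedAddCommGroup Y] [NormedSpace ℝ Y]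

/-! Everything rests on Whitney's theorem on even functions, with parameters: if `f (x, s)` is
smooth and even in `s`, then `f (x, √y)` is smooth up to `y = 0`, so `f (x, |u|)` is smooth in `u`
although `|u|` is not (`contDiffOn_comp_sqrt`, `contMDiffAt_comp_euclNorm`). A cone chart has value
`(n', u)` over the point `b (n', -|u|)`. Hence a transition map between two such charts consists of
the `N`-component of `b'⁻¹ (b (n', |u|))`, a change of trivialization over `r (b (n', |u|))`, and
the unchanged `t`. The bicollars commute with the reflection and `r` is invariant under it, so the
functions of the radius that occur are even, and the transition map is smooth
(`contMDiffOn_chartHomeo_symm_trans`).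

Choices are constructed in two ways. At points of the top in the collar region, which contains the
sides, the lines of the lower collar give a product structure (`isTube_sideHomeo`). Its inverse is
visibly smooth only on each half, but this already makes the derivative invertible, and the inverse
is smooth (`contMDiffOn_symm_of_cover`). At the other points of the top, `W` has a single face, and
comparing derivatives of nonnegative functions on the two halves shows that the double has no
boundary there (`chart_pos_of_notMem_collarNhd`). In an interior chart the isotropy group is
linearized by averaging, in such a way that the height becomes a linear functional and the
reflection becomes a translation along an invariant vector `c` (`exists_equivariant_normalForm`).
The bicollar follows the direction `c` (`exists_isTube_of_linear`).

The smooth structure is assembled from three kinds of pieces: the outer region as an open subset of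
`D(ν) × [-1,1]`, polar coordinates with values in `W × S^k` on the rest of the fibre product, and
the cone charts. Pieces of different kinds overlap only in the middle region, where each is compared
with the map to `W × (D(ν) × ℝ)` (`IsCompatibleOnMiddle`). Uniqueness and smoothness of the actions
follow by reading the identity, the group elements and the reflection in these pieces
(`smoothAt_of_isDiffeoOnto`); at the cone locus, a group element carries choices to choices
(`ConeChoice.translate`). -/

theorem continuousOn_integral_of_continuousOn {D : Set X} {g : X × ℝ → Y}
    (hg : ContinuousOn g (D ×ˢ Icc 0 1)) :
    ContinuousOn (fun x ↦ ∫ τ in (0 : ℝ)..1, g (x, τ)) D := by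
  rw [continuousOn_iff_continuous_domRestrict]
  -- Clamping `τ` to `[0, 1]` makes the integrand continuous on all of `D × ℝ` without changing the
  -- integral.
  have h1 : Continuous (fun p : D × ℝ ↦ g (p.1, (projIcc (0 : ℝ) 1 zero_le_one p.2 : ℝ))) := by
    refine hg.comp_continuous (by fun_prop) fun p ↦ ⟨p.1.2, Subtype.coe_prop _⟩
  have h2 := intervalIntegral.continuous_parametric_intervalIntegral_of_continuous'
    (μ := MeasureTheory.volume) (f := fun (x : D) τ ↦ g (x, (projIcc (0 : ℝ) 1 zero_le_one τ : ℝ)))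
    h1 0 1
  convert h2 using 2 with x
  refine intervalIntegral.integral_congr fun τ hτ ↦ ?_
  rw [uIcc_of_le zero_le_one] at hτ
  simp [projIcc_of_mem _ hτ]

/-- Differentiation under the integral sign relative to a convex set, which need not be open because
charts with corners produce sets with boundary. Compactness of `[0, 1]` makes `g'` near `x` close to
its value at `x`, uniformly in `τ`, and the mean value inequality on a small ball in `D` turns this
into a uniform error bound. -/
theorem hasFDerivWithinAt_integral [CompleteSpace Y] {D : Set X} (hD : Convex ℝ D) {g : X × ℝ → Y}
    {g' : X × ℝ → X →L[ℝ] Y} (hg : ContinuousOn g (D ×ˢ Icc 0 1))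
    (hg' : ContinuousOn g' (D ×ˢ Icc 0 1))
    (h : ∀ x ∈ D, ∀ τ ∈ Icc (0 : ℝ) 1, HasFDerivWithinAt (fun x ↦ g (x, τ)) (g' (x, τ)) D x)
    {x : X} (hx : x ∈ D) :
    HasFDerivWithinAt (fun x ↦ ∫ τ in (0 : ℝ)..1, g (x, τ)) (∫ τ in (0 : ℝ)..1, g' (x, τ)) D x := by
  rw [hasFDerivWithinAt_iff_isLittleO, Asymptotics.isLittleO_iff]
  intro c hc
  obtain ⟨v, hv, hvc⟩ := isCompact_Icc.mem_uniformity_of_prod (f := fun x τ ↦ g' (x, τ))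
    (s := D) (k := Icc (0 : ℝ) 1) hg' hx (Metric.dist_mem_uniformity hc)
  obtain ⟨δ, hδ, hδv⟩ := Metric.mem_nhdsWithin_iff.1 hv
  have hint : ∀ y ∈ D, IntervalIntegrable (fun τ ↦ g (y, τ)) MeasureTheory.volume 0 1 := by
    intro y hy
    refine ContinuousOn.intervalIntegrable ?_
    rw [uIcc_of_le zero_le_one]
    exact hg.comp (by fun_prop) fun τ hτ ↦ ⟨hy, hτ⟩
  have hint' : ∀ y ∈ D, IntervalIntegrable (fun τ ↦ g' (y, τ)) MeasureTheory.volume 0 1 := by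
    intro y hy
    refine ContinuousOn.intervalIntegrable ?_
    rw [uIcc_of_le zero_le_one]
    exact hg'.comp (by fun_prop) fun τ hτ ↦ ⟨hy, hτ⟩
  have hint3 : ∀ y, IntervalIntegrable (fun τ ↦ g' (x, τ) y) MeasureTheory.volume 0 1 := by
    intro y
    refine ContinuousOn.intervalIntegrable ?_
    rw [uIcc_of_le zero_le_one]
    exact (hg'.comp (by fun_prop) fun τ hτ ↦ ⟨hx, hτ⟩ :
      ContinuousOn (fun τ ↦ g' (x, τ)) (Icc 0 1)).clm_apply continuousOn_const
  filter_upwards [inter_mem_nhdsWithin D (Metric.ball_mem_nhds x hδ), self_mem_nhdsWithin]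
    with y hy hyD
  have key : ∀ τ ∈ Icc (0 : ℝ) 1, ‖g (y, τ) - g (x, τ) - g' (x, τ) (y - x)‖ ≤ c * ‖y - x‖ := by
    intro τ hτ
    refine Convex.norm_image_sub_le_of_norm_hasFDerivWithin_le' (s := D ∩ Metric.ball x δ)
      (f := fun x ↦ g (x, τ)) (f' := fun x ↦ g' (x, τ))
      (fun z hz ↦ (h z hz.1 τ hτ).mono inter_subset_left) (fun z hz ↦ ?_)
      (hD.inter (convex_ball x δ)) ⟨hx, Metric.mem_ball_self hδ⟩ hy
    have := hvc z (hδv ⟨hz.2, hz.1⟩) τ hτ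
    rw [← dist_eq_norm]
    exact le_of_lt this
  rw [ContinuousLinearMap.intervalIntegral_apply (hint' x hx),
    ← intervalIntegral.integral_sub (hint y hyD) (hint x hx),
    ← intervalIntegral.integral_sub ((hint y hyD).sub (hint x hx))
      (hint3 _)]
  refine (intervalIntegral.norm_integral_le_of_norm_le_const (C := c * ‖y - x‖) fun τ hτ ↦ ?_).trans
    (by simp)
  rw [uIoc_of_le zero_le_one] at hτ
  exact key τ ⟨hτ.1.le, hτ.2⟩

/-- Induction on the order of differentiability. The target `Y` is quantified inside, since the
derivative of the integral is an integral of functions with values in `X →L[ℝ] Y`. -/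
theorem contDiffOn_integral {n : ℕ} {D : Set X} (hD : Convex ℝ D) (hu : UniqueDiffOn ℝ D) :
    ∀ {Y : Type} [NormedAddCommGroup Y] [NormedSpace ℝ Y] [CompleteSpace Y] {g : X × ℝ → Y},
      ContDiffOn ℝ ∞ g (D ×ˢ Icc 0 1) →
      ContDiffOn ℝ n (fun x ↦ ∫ τ in (0 : ℝ)..1, g (x, τ)) D := by
  have hU : UniqueDiffOn ℝ (D ×ˢ Icc (0 : ℝ) 1) := hu.prod (uniqueDiffOn_Icc zero_lt_one)
  induction n with
  | zero =>
    intro Y _ _ _ g hg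
    simpa [contDiffOn_zero] using continuousOn_integral_of_continuousOn hg.continuousOn
  | succ n ih =>
    intro Y _ _ _ g hg
    set g' : X × ℝ → X →L[ℝ] Y := fun p ↦
      (fderivWithin ℝ g (D ×ˢ Icc 0 1) p).comp (ContinuousLinearMap.inl ℝ X ℝ) with hg'
    have hg's : ContDiffOn ℝ ∞ g' (D ×ˢ Icc 0 1) :=
      (hg.fderivWithin hU (by simp)).clm_comp contDiffOn_const
    have hder : ∀ x ∈ D, ∀ τ ∈ Icc (0 : ℝ) 1,
        HasFDerivWithinAt (fun x ↦ g (x, τ)) (g' (x, τ)) D x := by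
      intro x hx τ hτ
      have h1 := ((hg.differentiableOn (by simp)) (x, τ) ⟨hx, hτ⟩).hasFDerivWithinAt
      exact h1.comp (f := fun x ↦ (x, τ)) x (hasFDerivAt_prodMk_left x τ).hasFDerivWithinAt
        fun y hy ↦ ⟨hy, hτ⟩
    have := (contDiffOn_succ_iff_hasFDerivWithinAt_of_uniqueDiffOn (n := n)
      (f := fun x ↦ ∫ τ in (0 : ℝ)..1, g (x, τ)) hu).2
      ⟨by simp, fun x ↦ ∫ τ in (0 : ℝ)..1, g' (x, τ), ih hg's,
        fun x hx ↦ hasFDerivWithinAt_integral hD hg.continuousOn hg's.continuousOn hder hx⟩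
    exact_mod_cast this

end Calculus

/-! ### Hadamard's lemma and even functions -/

section Even

variable {X Y : Type} [NormedAddCommGroup X] [NormedSpace ℝ X]
  [NormedAddCommGroup Y] [NormedSpace ℝ Y] {A : Set X} {ε : ℝ}

/-- Hadamard's lemma in the second variable. -/
theorem exists_eq_add_smul [CompleteSpace Y] (hA : Convex ℝ A) (hu : UniqueDiffOn ℝ A)
    {f : X × ℝ → Y} (hf : ContDiffOn ℝ ∞ f (A ×ˢ Ioo (-ε) ε)) :
    ∃ a : X × ℝ → Y, ContDiffOn ℝ ∞ a (A ×ˢ Ioo (-ε) ε) ∧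
      ∀ q ∈ A ×ˢ Ioo (-ε) ε, f q = f (q.1, 0) + q.2 • a q := by
  set D := A ×ˢ Ioo (-ε) ε with hD
  have hUI : UniqueDiffOn ℝ (Ioo (-ε) ε) := isOpen_Ioo.uniqueDiffOn
  have hU : UniqueDiffOn ℝ D := hu.prod hUI
  have hc : Convex ℝ D := hA.prod (convex_Ioo _ _)
  have hmaps : ∀ p ∈ D ×ˢ Icc (0 : ℝ) 1, (p.1.1, p.2 * p.1.2) ∈ D := by
    rintro ⟨⟨x, s⟩, τ⟩ ⟨⟨hx, hs⟩, hτ⟩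
    refine ⟨hx, ?_⟩
    dsimp only at hx hs hτ ⊢
    have h0 : (0 : ℝ) ∈ Ioo (-ε) ε := ⟨by linarith [hs.1, hs.2], by linarith [hs.1, hs.2]⟩
    have := (convex_Ioo (-ε) ε) h0 hs (sub_nonneg.2 hτ.2) hτ.1 (by ring)
    simpa using this
  set fs : X × ℝ → Y := fun p ↦ fderivWithin ℝ f D p (0, 1) with hfs
  have hfs' : ContDiffOn ℝ ∞ fs D := (hf.fderivWithin hU (by simp)).clm_apply contDiffOn_const
  have hg : ContDiffOn ℝ ∞ (fun p : (X × ℝ) × ℝ ↦ fs (p.1.1, p.2 * p.1.2)) (D ×ˢ Icc 0 1) :=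
    hfs'.comp (ContDiff.contDiffOn (by fun_prop)) hmaps
  -- The quotient is the mean of `∂f/∂s` along the segment from `(x, 0)` to `(x, s)`.
  refine ⟨fun q ↦ ∫ τ in (0 : ℝ)..1, fs (q.1, τ * q.2), ?_, ?_⟩
  · exact contDiffOn_infty.2 fun n ↦ contDiffOn_integral hc hU hg
  · rintro ⟨x, s⟩ hq
    have hder : ∀ τ ∈ uIcc (0 : ℝ) 1, HasDerivAt (fun τ ↦ f (x, τ * s)) (s • fs (x, τ * s)) τ := by
      intro τ hτ
      rw [uIcc_of_le zero_le_one] at hτ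
      have hm := hmaps ((x, s), τ) ⟨hq, hτ⟩
      have h1 := ((hf.differentiableOn (by simp)) _ hm).hasFDerivWithinAt
      have h2 : HasFDerivAt (fun σ : ℝ ↦ f (x, σ))
          ((fderivWithin ℝ f D (x, τ * s)).comp (ContinuousLinearMap.inr ℝ X ℝ)) (τ * s) :=
        (h1.comp (f := fun σ ↦ (x, σ)) (τ * s)
          (hasFDerivAt_prodMk_right x (τ * s)).hasFDerivWithinAt
          fun σ hσ ↦ ⟨hq.1, hσ⟩).hasFDerivAt (isOpen_Ioo.mem_nhds hm.2)
      have h3 := h2.hasDerivAt.scomp τ ((hasDerivAt_id τ).mul_const s)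
      simpa [fs, Function.comp_def] using h3
    have hcont : ContinuousOn (fun τ ↦ s • fs (x, τ * s)) (uIcc 0 1) := by
      rw [uIcc_of_le zero_le_one]
      exact continuousOn_const.smul
        (hg.continuousOn.comp (f := fun τ ↦ ((x, s), τ)) (by fun_prop) fun τ hτ ↦ ⟨hq, hτ⟩)
    have := intervalIntegral.integral_eq_sub_of_hasDerivAt hder hcont.intervalIntegrable
    rw [intervalIntegral.integral_smul] at this
    simp only [one_mul, zero_mul] at this
    simp [this]

/-- Hadamard's lemma is applied twice: `f = f (x, 0) + s a`, where evenness of `f` makes `a` odd, so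
that `a` vanishes at `s = 0` and `a = s b` with `b` even. -/
theorem exists_even_eq_add_sq_smul [CompleteSpace Y] (hA : Convex ℝ A) (hu : UniqueDiffOn ℝ A)
    {f : X × ℝ → Y} (hf : ContDiffOn ℝ ∞ f (A ×ˢ Ioo (-ε) ε))
    (he : ∀ q ∈ A ×ˢ Ioo (-ε) ε, f (q.1, -q.2) = f q) :
    ∃ b : X × ℝ → Y, ContDiffOn ℝ ∞ b (A ×ˢ Ioo (-ε) ε) ∧
      (∀ q ∈ A ×ˢ Ioo (-ε) ε, b (q.1, -q.2) = b q) ∧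
      ∀ q ∈ A ×ˢ Ioo (-ε) ε, f q = f (q.1, 0) + q.2 ^ 2 • b q := by
  have hneg : ∀ q ∈ A ×ˢ Ioo (-ε) ε, (q.1, -q.2) ∈ A ×ˢ Ioo (-ε) ε := fun q hq ↦
    ⟨hq.1, by have := hq.2.1; have := hq.2.2; constructor <;> dsimp only <;> linarith⟩
  obtain ⟨a, ha, hfa⟩ := exists_eq_add_smul hA hu hf
  obtain ⟨b, hb, hab⟩ := exists_eq_add_smul hA hu ha
  have hodd : ∀ q ∈ A ×ˢ Ioo (-ε) ε, q.2 ≠ 0 → a (q.1, -q.2) = - a q := by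
    intro q hq hq0
    have h1 := hfa _ (hneg q hq)
    rw [he q hq, hfa q hq] at h1
    have h2 : q.2 • (a q + a (q.1, -q.2)) = 0 := by
      have := add_left_cancel h1
      dsimp only at this
      rw [neg_smul] at this
      rw [smul_add, this, neg_add_cancel]
    exact eq_neg_of_add_eq_zero_right ((smul_eq_zero.1 h2).resolve_left hq0)
  -- Cancelling `s` gives oddness of `a` only for `s ≠ 0`; the value at `0` comes from the limit of
  -- `a (x, s) + a (x, -s)`.
  have hzero : ∀ q ∈ A ×ˢ Ioo (-ε) ε, a (q.1, 0) = 0 := by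
    intro q hq
    have h0 : (0 : ℝ) ∈ Ioo (-ε) ε :=
      ⟨by linarith [hq.2.1, hq.2.2], by linarith [hq.2.1, hq.2.2]⟩
    have hcont : ContinuousAt (fun s : ℝ ↦ a (q.1, s)) 0 :=
      (ha.continuousOn.comp (f := fun s : ℝ ↦ (q.1, s)) (s := Ioo (-ε) ε) (by fun_prop)
        fun s hs ↦ ⟨hq.1, hs⟩).continuousAt (isOpen_Ioo.mem_nhds h0)
    have hlim : Tendsto (fun s : ℝ ↦ a (q.1, s) + a (q.1, -s)) (𝓝[≠] 0) (𝓝 (a (q.1, 0) + a (q.1, 0)))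
        := by
      refine Tendsto.mono_left ?_ nhdsWithin_le_nhds
      refine hcont.tendsto.add ?_
      have : Tendsto (fun s : ℝ ↦ -s) (𝓝 0) (𝓝 0) := by simpa using (continuous_neg (G := ℝ)).tendsto 0
      exact hcont.tendsto.comp this
    have hlim0 : Tendsto (fun s : ℝ ↦ a (q.1, s) + a (q.1, -s)) (𝓝[≠] 0) (𝓝 0) := by
      refine tendsto_const_nhds.congr' ?_
      filter_upwards [self_mem_nhdsWithin, mem_nhdsWithin_of_mem_nhds (isOpen_Ioo.mem_nhds h0)]
        with s hs hs'
      rw [hodd (q.1, s) ⟨hq.1, hs'⟩ hs, add_neg_cancel]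
    have := tendsto_nhds_unique hlim hlim0
    rw [← two_smul ℝ] at this
    simpa using this
  refine ⟨b, hb, fun q hq ↦ ?_, fun q hq ↦ ?_⟩
  · by_cases hq0 : q.2 = 0
    · obtain ⟨x, s⟩ := q
      simp only at hq0
      simp [hq0]
    · have h1 := hab _ (hneg q hq)
      have h2 := hab q hq
      have h3 := hodd q hq hq0
      rw [hzero q hq, zero_add] at h2
      dsimp only at h1
      rw [hzero q hq, zero_add, h3, h2, neg_smul, neg_inj] at h1
      exact (smul_right_injective Y hq0 h1).symm
  · have h2 := hab q hq
    rw [hzero q hq, zero_add] at h2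
    rw [pow_two, mul_smul, ← h2, ← hfa q hq]

/-- The reflection in the second factor. -/
def reflectSnd (X : Type) [NormedAddCommGroup X] [NormedSpace ℝ X] : X × ℝ →L[ℝ] X × ℝ :=
  (ContinuousLinearMap.fst ℝ X ℝ).prod (-ContinuousLinearMap.snd ℝ X ℝ)

/-- The chain rule for the reflection: the derivative of an even function is even in the directions
of `X` and odd in the direction of `ℝ`. -/
theorem fderivWithin_even (hu : UniqueDiffOn ℝ A) {f : X × ℝ → Y}
    (hf : DifferentiableOn ℝ f (A ×ˢ Ioo (-ε) ε))
    (he : ∀ q ∈ A ×ˢ Ioo (-ε) ε, f (q.1, -q.2) = f q) {q : X × ℝ} (hq : q ∈ A ×ˢ Ioo (-ε) ε) :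
    fderivWithin ℝ f (A ×ˢ Ioo (-ε) ε) q =
      (fderivWithin ℝ f (A ×ˢ Ioo (-ε) ε) (q.1, -q.2)).comp (reflectSnd X) := by
  have hneg : ∀ q ∈ A ×ˢ Ioo (-ε) ε, (q.1, -q.2) ∈ A ×ˢ Ioo (-ε) ε := fun q hq ↦
    ⟨hq.1, by have := hq.2.1; have := hq.2.2; constructor <;> dsimp only <;> linarith⟩
  have hU : UniqueDiffOn ℝ (A ×ˢ Ioo (-ε) ε) := hu.prod isOpen_Ioo.uniqueDiffOn
  refine HasFDerivWithinAt.fderivWithin ?_ (hU q hq)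
  have h1 := (hf _ (hneg q hq)).hasFDerivWithinAt
  have h2 := HasFDerivWithinAt.comp (f := reflectSnd X) q h1
    (reflectSnd X).hasFDerivWithinAt hneg
  exact h2.congr (fun y hy ↦ (he y hy).symm) (he q hq).symm

end Even

/-! ### Whitney's theorem on even functions -/

section Even

variable {X Y : Type} [NormedAddCommGroup X] [NormedSpace ℝ X]
  [NormedAddCommGroup Y] [NormedSpace ℝ Y] {A : Set X} {ε : ℝ}

/-- The derivative of `(x, y) ↦ f (x, √y)` is of the same form. -/
theorem exists_hasFDerivWithinAt_comp_sqrt [CompleteSpace Y] (hA : Convex ℝ A)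
    (hu : UniqueDiffOn ℝ A) (hε : 0 < ε)
    {f : X × ℝ → Y} (hf : ContDiffOn ℝ ∞ f (A ×ˢ Ioo (-ε) ε))
    (he : ∀ q ∈ A ×ˢ Ioo (-ε) ε, f (q.1, -q.2) = f q) :
    ∃ k : X × ℝ → X × ℝ →L[ℝ] Y, ContDiffOn ℝ ∞ k (A ×ˢ Ioo (-ε) ε) ∧
      (∀ q ∈ A ×ˢ Ioo (-ε) ε, k (q.1, -q.2) = k q) ∧
      ∀ q ∈ A ×ˢ Ico 0 (ε ^ 2), HasFDerivWithinAt (fun q : X × ℝ ↦ f (q.1, √q.2))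
        (k (q.1, √q.2)) (A ×ˢ Ico 0 (ε ^ 2)) q := by
  obtain ⟨b, hb, hbe, hfb⟩ := exists_even_eq_add_sq_smul hA hu hf he
  set D := A ×ˢ Ioo (-ε) ε with hD
  have hU : UniqueDiffOn ℝ D := hu.prod isOpen_Ioo.uniqueDiffOn
  have hsqrt : ∀ q ∈ A ×ˢ Ico 0 (ε ^ 2), (q.1, √q.2) ∈ D := fun q hq ↦
    ⟨hq.1, lt_of_lt_of_le (by linarith) (Real.sqrt_nonneg _),
      (Real.sqrt_lt' hε).2 hq.2.2⟩
  have h0 : (0 : ℝ) ∈ Ioo (-ε) ε := ⟨by linarith, hε⟩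
  set bs : X × ℝ → Y := fun p ↦ fderivWithin ℝ b D p (0, 1) with hbs
  have hfd : DifferentiableOn ℝ f D := hf.differentiableOn (by simp)
  have hbd : DifferentiableOn ℝ b D := hb.differentiableOn (by simp)
  have hbs' : ContDiffOn ℝ ∞ bs D := (hb.fderivWithin hU (by simp)).clm_apply contDiffOn_const
  set fx : X × ℝ → X →L[ℝ] Y := fun p ↦
    (fderivWithin ℝ f D p).comp (ContinuousLinearMap.inl ℝ X ℝ) with hfx
  have hfx' : ContDiffOn ℝ ∞ fx D := (hf.fderivWithin hU (by simp)).clm_comp contDiffOn_const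
  -- With `f = f (x, 0) + s² b` and `y = s²`, the derivative in `y` is `(∂f/∂s) / (2s) = b + (s / 2)
  -- ∂b/∂s`. The last expression is smooth and even across `s = 0`.
  refine ⟨fun q ↦ (fx q).comp (ContinuousLinearMap.fst ℝ X ℝ) +
    (ContinuousLinearMap.snd ℝ X ℝ).smulRight (b q + (q.2 / 2) • bs q), ?_, ?_, ?_⟩
  · refine (hfx'.clm_comp contDiffOn_const).add ?_
    exact contDiffOn_const.smulRight (hb.add ((ContDiff.contDiffOn (by fun_prop)).smul hbs'))
  · intro q hq
    have h1 : fx (q.1, -q.2) = fx q := by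
      ext v
      simp only [hfx]
      rw [fderivWithin_even hu hfd he hq]
      simp [reflectSnd, ← hD]
    have h2 : bs (q.1, -q.2) = - bs q := by
      simp only [hbs]
      rw [fderivWithin_even hu hbd hbe hq, ← map_neg]
      simp [reflectSnd, ← hD]
    ext v
    · simp [h1]
    · simp [h1, h2, hbe q hq, neg_div]
  · rintro ⟨x, y⟩ hq
    have hq' := hsqrt _ hq
    rcases hq.2.1.eq_or_lt with hy | hy
    · dsimp only at hy
      subst hy
      have hx : x ∈ A := hq.1
      have e1 : HasFDerivWithinAt (fun q : X × ℝ ↦ f (q.1, 0))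
          ((fx (x, 0)).comp (ContinuousLinearMap.fst ℝ X ℝ)) (A ×ˢ Ico 0 (ε ^ 2)) (x, 0) := by
        have h1 : HasFDerivWithinAt (fun x ↦ f (x, 0)) (fx (x, 0)) A x :=
          (hfd (x, 0) ⟨hx, h0⟩).hasFDerivWithinAt.comp (f := fun x ↦ (x, (0 : ℝ))) x
            (hasFDerivAt_prodMk_left x 0).hasFDerivWithinAt fun y hy ↦ ⟨hy, h0⟩
        exact h1.comp (f := Prod.fst) (x, (0 : ℝ)) hasFDerivWithinAt_fst fun q hq ↦ hq.1
      -- The factor `y` makes this term differentiable at `y = 0`; only continuity of `b` is used.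
      have e2 : HasFDerivWithinAt (fun q : X × ℝ ↦ q.2 • b (q.1, √q.2))
          ((ContinuousLinearMap.snd ℝ X ℝ).smulRight (b (x, 0))) (A ×ˢ Ico 0 (ε ^ 2)) (x, 0) := by
        have hc : ContinuousWithinAt (fun q : X × ℝ ↦ b (q.1, √q.2)) (A ×ˢ Ico 0 (ε ^ 2)) (x, 0) := by
          have : ContinuousOn (fun q : X × ℝ ↦ b (q.1, √q.2)) (A ×ˢ Ico 0 (ε ^ 2)) :=
            hb.continuousOn.comp (by fun_prop) hsqrt
          exact this _ hq
        rw [hasFDerivWithinAt_iff_isLittleO, Asymptotics.isLittleO_iff]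
        intro c hc'
        have h3 := (Metric.continuousWithinAt_iff'.1 hc) c hc'
        filter_upwards [h3] with p hp
        rw [dist_eq_norm] at hp
        simp only [Real.sqrt_zero, zero_smul, sub_zero, ContinuousLinearMap.smulRight_apply,
          ContinuousLinearMap.coe_snd', Prod.snd_sub, ← smul_sub] at hp ⊢
        rw [norm_smul, mul_comm]
        refine mul_le_mul hp.le ?_ (norm_nonneg _) hc'.le
        have := norm_snd_le (p - (x, (0 : ℝ)))
        rwa [Prod.snd_sub, sub_zero] at this
      have e3 := e1.add e2
      have e4 : HasFDerivWithinAt (fun q : X × ℝ ↦ f (q.1, √q.2))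
          ((fx (x, 0)).comp (ContinuousLinearMap.fst ℝ X ℝ) +
          (ContinuousLinearMap.snd ℝ X ℝ).smulRight (b (x, 0))) (A ×ˢ Ico 0 (ε ^ 2)) (x, 0) := by
        refine e3.congr (fun p hp ↦ ?_) ?_
        · have := hfb _ (hsqrt p hp)
          simp only [Real.sq_sqrt hp.2.1] at this
          simpa using this
        · simp
      simpa using e4
    · dsimp only at hy
      have hs : 0 < √y := Real.sqrt_pos.2 hy
      set s := √y with hs'
      have hfs : fderivWithin ℝ f D (x, s) (0, 1) = (2 * s) • b (x, s) + s ^ 2 • bs (x, s) := by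
        have g1 : ∀ {Z : Type} [NormedAddCommGroup Z] [NormedSpace ℝ Z] (φ : X × ℝ → Z),
            DifferentiableOn ℝ φ D →
            HasDerivAt (fun σ : ℝ ↦ φ (x, σ)) (fderivWithin ℝ φ D (x, s) (0, 1)) s := by
          intro Z _ _ φ hφ
          have h2 : HasFDerivAt (fun σ : ℝ ↦ φ (x, σ))
              ((fderivWithin ℝ φ D (x, s)).comp (ContinuousLinearMap.inr ℝ X ℝ)) s :=
            ((hφ _ hq').hasFDerivWithinAt.comp (f := fun σ ↦ (x, σ)) s
              (hasFDerivAt_prodMk_right x s).hasFDerivWithinAt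
              fun σ hσ ↦ ⟨hq.1, hσ⟩).hasFDerivAt (isOpen_Ioo.mem_nhds hq'.2)
          simpa using h2.hasDerivAt
        have g2 : HasDerivAt (fun σ : ℝ ↦ f (x, 0) + σ ^ 2 • b (x, σ))
            (s ^ 2 • bs (x, s) + (2 * s) • b (x, s)) s := by
          have := ((hasDerivAt_pow 2 s).smul (g1 b hbd)).const_add (f (x, 0))
          simpa using this
        have g3 : (fun σ : ℝ ↦ f (x, σ)) =ᶠ[𝓝 s] fun σ : ℝ ↦ f (x, 0) + σ ^ 2 • b (x, σ) := by
          filter_upwards [isOpen_Ioo.mem_nhds hq'.2] with σ hσ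
          exact hfb (x, σ) ⟨hq.1, hσ⟩
        rw [(g1 f hfd).unique (g2.congr_of_eventuallyEq g3), add_comm]
      have h1 : HasFDerivAt (fun q : X × ℝ ↦ (q.1, √q.2))
          ((ContinuousLinearMap.fst ℝ X ℝ).prod ((1 / (2 * √y)) • ContinuousLinearMap.snd ℝ X ℝ))
          (x, y) :=
        hasFDerivAt_fst.prodMk ((hasFDerivAt_snd (p := (x, y))).sqrt hy.ne')
      have h2 := (hfd _ hq').hasFDerivWithinAt.comp (x, y) h1.hasFDerivWithinAt hsqrt
      refine h2.congr_fderiv ?_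
      ext v
      · simp [hfx]
      · have : ((0 : X), (2 * s)⁻¹) = (2 * s)⁻¹ • ((0 : X), (1 : ℝ)) := by simp
        simp only [one_div, ContinuousLinearMap.coe_comp, Function.comp_apply,
          ContinuousLinearMap.inr_apply, ContinuousLinearMap.prod_apply,
          ContinuousLinearMap.coe_fst', smul_apply,
          ContinuousLinearMap.coe_snd', smul_eq_mul, mul_one, add_apply,
          map_zero, zero_add, ContinuousLinearMap.smulRight_apply, one_smul, ← hs']
        rw [this, map_smul, hfs, smul_add, smul_smul, smul_smul,
          inv_mul_cancel₀ (by positivity), one_smul]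
        congr 2
        field_simp

/-- Whitney's theorem on even functions, with parameters. -/
theorem contDiffOn_comp_sqrt (hA : Convex ℝ A) (hu : UniqueDiffOn ℝ A) (hε : 0 < ε) (n : ℕ) :
    ∀ {Y : Type} [NormedAddCommGroup Y] [NormedSpace ℝ Y] [CompleteSpace Y] {f : X × ℝ → Y},
      ContDiffOn ℝ ∞ f (A ×ˢ Ioo (-ε) ε) → (∀ q ∈ A ×ˢ Ioo (-ε) ε, f (q.1, -q.2) = f q) →
      ContDiffOn ℝ n (fun q : X × ℝ ↦ f (q.1, √q.2)) (A ×ˢ Ico 0 (ε ^ 2)) := by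
  induction n with
  | zero =>
    intro Y _ _ _ f hf _
    simp only [Nat.cast_zero, contDiffOn_zero]
    exact hf.continuousOn.comp (by fun_prop) fun q hq ↦
      ⟨hq.1, lt_of_lt_of_le (by linarith) (Real.sqrt_nonneg _), (Real.sqrt_lt' hε).2 hq.2.2⟩
  | succ n ih =>
    intro Y _ _ _ f hf he
    -- The derivative again has the form `k (x, √y)` with `k` smooth and even, so the induction
    -- hypothesis applies to it.
    obtain ⟨k, hk, hke, hfk⟩ := exists_hasFDerivWithinAt_comp_sqrt hA hu hε hf he
    have := (contDiffOn_succ_iff_hasFDerivWithinAt_of_uniqueDiffOn (n := n)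
      (f := fun q : X × ℝ ↦ f (q.1, √q.2)) (hu.prod (uniqueDiffOn_Ico 0 (ε ^ 2)))).2
      ⟨by simp, fun q ↦ k (q.1, √q.2), ih hk hke, hfk⟩
    exact_mod_cast this

end Even

/-! ### Smoothness of inverse maps -/

section Inverse

variable {X Y : Type*} [NormedAddCommGroup X] [NormedSpace ℝ X] [CompleteSpace X]
  [NormedAddCommGroup Y] [NormedSpace ℝ Y]

/-- A continuous right inverse of a smooth map with invertible derivatives is smooth. -/
theorem contDiffOn_of_rightInverse {s : Set X} {t : Set Y} (hs : UniqueDiffOn ℝ s)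
    (ht : UniqueDiffOn ℝ t) {f : X → Y} {g : Y → X} (hf : ContDiffOn ℝ ∞ f s)
    (hg : ContinuousOn g t) (hgm : MapsTo g t s) (hfg : ∀ y ∈ t, f (g y) = y)
    (hf' : ∀ x ∈ g '' t, (fderivWithin ℝ f s x).IsInvertible) : ContDiffOn ℝ ∞ g t := by
  have hder : ∀ y ∈ t, HasFDerivWithinAt g (fderivWithin ℝ f s (g y)).inverse t y := by
    intro y hy
    obtain ⟨e, he⟩ := hf' _ (mem_image_of_mem g hy)
    have h1 : HasFDerivWithinAt f (e : X →L[ℝ] Y) s (g y) := by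
      rw [he]; exact (hf.differentiableOn (by simp) _ (hgm hy)).hasFDerivWithinAt
    rw [← he, ContinuousLinearMap.inverse_equiv]
    exact h1.of_local_left_inverse ((hg y hy).tendsto_nhdsWithin hgm) hy
      (eventually_of_mem self_mem_nhdsWithin hfg)
  -- Bootstrapping: if `g` is `C^n`, then its derivative, the inverse of `f'` along `g`, is `C^n`,
  -- so `g` is `C^(n+1)`.
  have key : ∀ n : ℕ, ContDiffOn ℝ n g t := by
    intro n
    induction n with
    | zero => simpa [contDiffOn_zero] using hg
    | succ n ih =>
      have := (contDiffOn_succ_iff_hasFDerivWithinAt_of_uniqueDiffOn (n := n) (f := g) ht).2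
        ⟨by simp, fun y ↦ (fderivWithin ℝ f s (g y)).inverse, ?_, hder⟩
      · exact_mod_cast this
      · intro y hy
        obtain ⟨e, he⟩ := hf' _ (mem_image_of_mem g hy)
        have h1 : ContDiffWithinAt ℝ n (fun y ↦ fderivWithin ℝ f s (g y)) t y :=
          (((hf.fderivWithin (m := ∞) hs (by simp)).of_le (by exact_mod_cast le_top)).comp ih hgm)
            y hy
        have h2 : ContDiffAt ℝ n ContinuousLinearMap.inverse (fderivWithin ℝ f s (g y)) := by
          rw [← he]; exact contDiffAt_map_inverse e
        exact h2.comp_contDiffWithinAt y h1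
  exact contDiffOn_infty.2 key

end Inverse

theorem contMDiffWithinAt_comp_of_eventually {𝕜 E₁ H₁ M₁ E₂ H₂ M₂ E₃ H₃ M₃ : Type*}
    [NontriviallyNormedField 𝕜]
    [NormedAddCommGroup E₁] [NormedSpace 𝕜 E₁] [TopologicalSpace H₁] {I₁ : ModelWithCorners 𝕜 E₁ H₁}
    [TopologicalSpace M₁] [ChartedSpace H₁ M₁]
    [NormedAddCommGroup E₂] [NormedSpace 𝕜 E₂] [TopologicalSpace H₂] {I₂ : ModelWithCorners 𝕜 E₂ H₂}
    [TopologicalSpace M₂] [ChartedSpace H₂ M₂]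
    [NormedAddCommGroup E₃] [NormedSpace 𝕜 E₃] [TopologicalSpace H₃] {I₃ : ModelWithCorners 𝕜 E₃ H₃}
    [TopologicalSpace M₃] [ChartedSpace H₃ M₃] {n : ℕ∞ω} {g : M₂ → M₃} {f : M₁ → M₂}
    {s : Set M₁} {t : Set M₂} {x : M₁}
    (hg : ContMDiffWithinAt I₂ I₃ n g t (f x)) (hf : ContMDiffWithinAt I₁ I₂ n f s x)
    (h : ∀ᶠ y in 𝓝[s] x, f y ∈ t) : ContMDiffWithinAt I₁ I₃ n (fun y ↦ g (f y)) s x :=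
  (hg.comp' x hf).mono_of_mem_nhdsWithin (inter_mem self_mem_nhdsWithin h)

/-! ### Even functions of the radius on manifolds with corners -/

section EvenManifold

variable {F F' : Type} [NormedAddCommGroup F] [NormedSpace ℝ F]
  [NormedAddCommGroup F'] [NormedSpace ℝ F'] [CompleteSpace F']
  {H H' : Type*} [TopologicalSpace H] [TopologicalSpace H']
  {I : ModelWithCorners ℝ F H} {I' : ModelWithCorners ℝ F' H'}
  {X Z : Type*} [TopologicalSpace X] [ChartedSpace H X] [IsManifold I ∞ X]
  [TopologicalSpace Z] [ChartedSpace H' Z] [IsManifold I' ∞ Z]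

/-- Whitney's theorem read in charts. The range of a model with corners is convex, so its
intersection with a ball is a convex set with unique derivatives, as the local statement requires.
-/
theorem contMDiffWithinAt_comp_sqrt {φ : X × ℝ → Z} {O : Set (X × ℝ)} {x : X}
    (hO : O ∈ 𝓝 (x, (0 : ℝ))) (hφ : ContMDiffOn (I.prod 𝓘(ℝ, ℝ)) I' ∞ φ O)
    (he : ∀ q ∈ O, φ (q.1, -q.2) = φ q) :
    ContMDiffWithinAt (I.prod 𝓘(ℝ, ℝ)) I' ∞ (fun q : X × ℝ ↦ φ (q.1, √q.2)) (univ ×ˢ Ici 0)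
      (x, 0) := by
  set z := φ (x, 0) with hz
  set c := extChartAt I x with hc
  set d := extChartAt I' z with hd
  set P : F × ℝ → X × ℝ := fun q ↦ (c.symm q.1, q.2) with hP
  have hPs : ContMDiffOn 𝓘(ℝ, F × ℝ) (I.prod 𝓘(ℝ, ℝ)) ∞ P (c.target ×ˢ univ) :=
    ((contMDiffOn_extChartAt_symm x).comp (contDiff_fst.contMDiff.contMDiffOn)
      fun q hq ↦ hq.1).prodMk contDiff_snd.contMDiff.contMDiffOn
  have hx : c x ∈ c.target := mem_extChartAt_target x
  have hφc : ContinuousAt φ (x, 0) := hφ.continuousOn.continuousAt hO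
  have hO' : O ∩ φ ⁻¹' d.source ∈ 𝓝 (P (c x, 0)) := by
    have : P (c x, 0) = (x, 0) := by simp [hP, hc]
    rw [this]
    exact inter_mem hO (hφc.preimage_mem_nhds (extChartAt_source_mem_nhds z))
  have hS : P ⁻¹' (O ∩ φ ⁻¹' d.source) ∈ 𝓝[range I ×ˢ univ] (c x, (0 : ℝ)) := by
    have h1 : ContinuousWithinAt P (c.target ×ˢ univ) (c x, 0) :=
      hPs.continuousOn _ ⟨hx, mem_univ _⟩
    have h2 := h1 hO'
    have h3 : c.target ×ˢ (univ : Set ℝ) ∈ 𝓝[range I ×ˢ univ] (c x, (0 : ℝ)) := by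
      rw [nhdsWithin_prod_eq]
      exact prod_mem_prod (extChartAt_target_mem_nhdsWithin x) univ_mem
    exact nhdsWithin_le_of_mem h3 h2
  have hS2 : (c.target ×ˢ univ) ∩ P ⁻¹' (O ∩ φ ⁻¹' d.source) ∈
      𝓝[range I ×ˢ univ] (c x, (0 : ℝ)) := by
    refine inter_mem ?_ hS
    rw [nhdsWithin_prod_eq]
    exact prod_mem_prod (extChartAt_target_mem_nhdsWithin x) univ_mem
  obtain ⟨ε, hε, hball⟩ := Metric.mem_nhdsWithin_iff.1 hS2
  set A := Metric.ball (c x) ε ∩ range I with hA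
  have hsub : A ×ˢ Ioo (-ε) ε ⊆ (c.target ×ˢ univ) ∩ P ⁻¹' (O ∩ φ ⁻¹' d.source) := by
    intro q hq
    refine hball ⟨?_, hq.1.2, mem_univ _⟩
    rw [← ball_prod_same]
    refine ⟨hq.1.1, ?_⟩
    rw [Real.ball_eq_Ioo]
    simpa using hq.2
  have hAc : Convex ℝ A := (convex_ball _ _).inter I.convex_range
  have hAu : UniqueDiffOn ℝ A := by
    rw [hA, inter_comm]
    exact I.uniqueDiffOn.inter Metric.isOpen_ball
  set f : F × ℝ → F' := fun q ↦ d (φ (P q)) with hf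
  have hfs : ContDiffOn ℝ ∞ f (A ×ˢ Ioo (-ε) ε) := by
    rw [← contMDiffOn_iff_contDiffOn]
    refine (contMDiffOn_extChartAt (x := z)).comp
      (hφ.comp (hPs.mono fun q hq ↦ (hsub hq).1) fun q hq ↦ (hsub hq).2.1) fun q hq ↦ ?_
    have := (hsub hq).2.2
    rwa [mem_preimage, hd, extChartAt_source] at this
  have hfe : ∀ q ∈ A ×ˢ Ioo (-ε) ε, f (q.1, -q.2) = f q := by
    intro q hq
    have h1 := he _ (hsub hq).2.1
    simp only [hf, hP] at h1 ⊢
    rw [h1]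
  have hF : ContDiffOn ℝ ∞ (fun q : F × ℝ ↦ f (q.1, √q.2)) (A ×ˢ Ico 0 (ε ^ 2)) :=
    contDiffOn_infty.2 fun n ↦ contDiffOn_comp_sqrt hAc hAu hε n hfs hfe
  have h0mem : (c x, (0 : ℝ)) ∈ A ×ˢ Ico 0 (ε ^ 2) :=
    ⟨⟨Metric.mem_ball_self hε, extChartAt_target_subset_range x hx⟩, le_rfl, by positivity⟩
  have hf0 : f (c x, √0) = d z := by simp [hf, hP, hc, hz]
  -- the map written through the charts
  have hQ : ContMDiffWithinAt (I.prod 𝓘(ℝ, ℝ)) 𝓘(ℝ, F × ℝ) ∞ (fun q : X × ℝ ↦ (c q.1, q.2))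
      (univ ×ˢ Ici 0) (x, 0) :=
    (((contMDiffAt_extChartAt (n := ∞)).comp (x, (0 : ℝ)) contMDiffAt_fst).prodMk_space
      contMDiffAt_snd).contMDiffWithinAt
  have hQm : ∀ᶠ q in 𝓝[univ ×ˢ Ici 0] (x, (0 : ℝ)),
      q.1 ∈ c.source ∧ (c q.1, q.2) ∈ A ×ˢ Ico 0 (ε ^ 2) := by
    have h1 : ∀ᶠ q in 𝓝 (x, (0 : ℝ)), q.1 ∈ c.source := continuousAt_fst (extChartAt_source_mem_nhds x)
    have h2 : ∀ᶠ q in 𝓝 (x, (0 : ℝ)), c q.1 ∈ Metric.ball (c x) ε :=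
      ((continuousAt_extChartAt x).comp (x := (x, (0 : ℝ))) continuousAt_fst)
        (Metric.ball_mem_nhds _ hε)
    have h3 : ∀ᶠ q in 𝓝 (x, (0 : ℝ)), q.2 < ε ^ 2 :=
      continuousAt_snd (Iio_mem_nhds (by positivity))
    filter_upwards [nhdsWithin_le_nhds h1, nhdsWithin_le_nhds h2, nhdsWithin_le_nhds h3,
      self_mem_nhdsWithin] with q h1 h2 h3 h4
    exact ⟨h1, ⟨h2, extChartAt_target_subset_range x (c.map_source h1)⟩, h4.2, h3⟩
  have hG : ContMDiffWithinAt (I.prod 𝓘(ℝ, ℝ)) I' ∞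
      (fun q : X × ℝ ↦ d.symm (f (c q.1, √q.2))) (univ ×ˢ Ici 0) (x, 0) := by
    have e1 : ContMDiffWithinAt (I.prod 𝓘(ℝ, ℝ)) 𝓘(ℝ, F') ∞
        (fun q : X × ℝ ↦ f (c q.1, √q.2)) (univ ×ˢ Ici 0) (x, 0) := by
      refine contMDiffWithinAt_comp_of_eventually (t := A ×ˢ Ico 0 (ε ^ 2))
        (g := fun q : F × ℝ ↦ f (q.1, √q.2)) ?_ hQ ?_
      · exact (hF _ h0mem).contMDiffWithinAt
      · filter_upwards [hQm] with q hq using hq.2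
    refine contMDiffWithinAt_comp_of_eventually (t := d.target)
      (g := d.symm) ?_ e1 ?_
    · dsimp only
      rw [hf0]
      exact contMDiffWithinAt_extChartAt_symm_target z (mem_extChartAt_target z)
    · filter_upwards [hQm] with q hq
      have : (c q.1, √q.2) ∈ A ×ˢ Ioo (-ε) ε := ⟨hq.2.1,
        lt_of_lt_of_le (by linarith) (Real.sqrt_nonneg _), (Real.sqrt_lt' hε).2 hq.2.2.2⟩
      exact d.map_source (hsub this).2.2
  refine hG.congr_of_eventuallyEq_of_mem ?_ ⟨mem_univ _, mem_Ici.2 le_rfl⟩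
  filter_upwards [hQm] with q hq
  have : (c q.1, √q.2) ∈ A ×ˢ Ioo (-ε) ε := ⟨hq.2.1,
    lt_of_lt_of_le (by linarith) (Real.sqrt_nonneg _), (Real.sqrt_lt' hε).2 hq.2.2.2⟩
  have h2 := (hsub this).2.2
  simp only [hf, hP] at h2 ⊢
  rw [d.left_inv h2, c.left_inv hq.1]

variable {V : Type} [NormedAddCommGroup V]

/-- The Euclidean norm on `V × ℝ`. -/
def euclNorm (u : V × ℝ) : ℝ := √(‖u.1‖ ^ 2 + u.2 ^ 2)

theorem euclNorm_sq (u : V × ℝ) : euclNorm u ^ 2 = ‖u.1‖ ^ 2 + u.2 ^ 2 :=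
  Real.sq_sqrt (by positivity)

theorem euclNorm_nonneg (u : V × ℝ) : 0 ≤ euclNorm u := Real.sqrt_nonneg _

theorem euclNorm_eq_zero {u : V × ℝ} : euclNorm u = 0 ↔ u = 0 := by
  rw [euclNorm, Real.sqrt_eq_zero (by positivity), add_eq_zero_iff_of_nonneg (by positivity)
    (by positivity), Prod.ext_iff]
  simp

theorem norm_fst_le_euclNorm (u : V × ℝ) : ‖u.1‖ ≤ euclNorm u :=
  Real.le_sqrt_of_sq_le (by nlinarith [sq_nonneg u.2])

variable [InnerProductSpace ℝ V]

theorem contDiff_euclNorm_sq : ContDiff ℝ ∞ fun u : V × ℝ ↦ ‖u.1‖ ^ 2 + u.2 ^ 2 :=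
  (contDiff_fst.norm_sq ℝ).add (contDiff_snd.pow 2)

theorem contDiffAt_euclNorm {u : V × ℝ} (hu : u ≠ 0) : ContDiffAt ℝ ∞ euclNorm u := by
  refine contDiff_euclNorm_sq.contDiffAt.sqrt ?_
  rw [← euclNorm_sq]
  exact pow_ne_zero 2 (mt euclNorm_eq_zero.1 hu)

theorem continuous_euclNorm : Continuous (euclNorm : V × ℝ → ℝ) :=
  Real.continuous_sqrt.comp contDiff_euclNorm_sq.continuous

/-- A smooth even function composed with the norm is smooth. -/
theorem contMDiffAt_comp_euclNorm {φ : X × ℝ → Z} {O : Set (X × ℝ)}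
    (hO : IsOpen O) (hφ : ContMDiffOn (I.prod 𝓘(ℝ, ℝ)) I' ∞ φ O)
    (he : ∀ q ∈ O, φ (q.1, -q.2) = φ q) {p : X × (V × ℝ)} (hp : (p.1, euclNorm p.2) ∈ O) :
    ContMDiffAt (I.prod 𝓘(ℝ, V × ℝ)) I' ∞
      (fun p : X × (V × ℝ) ↦ φ (p.1, euclNorm p.2)) p := by
  obtain ⟨x, u⟩ := p
  by_cases hu : u = 0
  · subst hu
    have h0 : euclNorm (0 : V × ℝ) = 0 := euclNorm_eq_zero.2 rfl
    dsimp only at hp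
    rw [h0] at hp
    -- At `u = 0` the map is factored through the smooth function `|u|²`, followed by `φ (x, √y)`.
    have h1 := contMDiffWithinAt_comp_sqrt (hO.mem_nhds hp) hφ he
    have h2 : ContMDiffAt (I.prod 𝓘(ℝ, V × ℝ)) (I.prod 𝓘(ℝ, ℝ)) ∞
        (fun p : X × (V × ℝ) ↦ (p.1, ‖p.2.1‖ ^ 2 + p.2.2 ^ 2)) (x, 0) :=
      contMDiffAt_fst.prodMk (contDiff_euclNorm_sq.contMDiff.comp contMDiff_snd).contMDiffAt
    have h3 : ((fun p : X × (V × ℝ) ↦ (p.1, ‖p.2.1‖ ^ 2 + p.2.2 ^ 2)) (x, 0)) = (x, (0 : ℝ)) := by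
      simp
    rw [← h3] at h1
    rw [← contMDiffWithinAt_univ] at h2 ⊢
    exact contMDiffWithinAt_comp_of_eventually (g := fun q : X × ℝ ↦ φ (q.1, √q.2))
      (f := fun p : X × (V × ℝ) ↦ (p.1, ‖p.2.1‖ ^ 2 + p.2.2 ^ 2)) h1 h2
      (Eventually.of_forall fun q ↦ ⟨mem_univ _, mem_Ici.2 (add_nonneg (sq_nonneg _) (sq_nonneg _))⟩)
  · have h2 : ContMDiffAt (I.prod 𝓘(ℝ, V × ℝ)) (I.prod 𝓘(ℝ, ℝ)) ∞
        (fun p : X × (V × ℝ) ↦ (p.1, euclNorm p.2)) (x, u) :=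
      contMDiffAt_fst.prodMk
        (ContMDiffAt.comp (g := euclNorm) (f := Prod.snd) (x, u)
          (contDiffAt_euclNorm hu).contMDiffAt contMDiffAt_snd)
    exact ((hφ _ hp).contMDiffAt (hO.mem_nhds hp)).comp (x, u) h2

end EvenManifold

/-! ### Smooth structures -/

section Structures

variable {d : ℕ} {X : Type*} [TopologicalSpace X]

theorem SmoothStructure.isManifold (S : SmoothStructure d X) :
    letI := S.chartedSpace
    IsManifold (corners d) ∞ X := by
  let := S.chartedSpace
  have : HasGroupoid X (contDiffGroupoid ∞ (corners d)) := ⟨fun he he' ↦ S.compatible _ he _ he'⟩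
  exact IsManifold.mk' (corners d) ∞ X

theorem mem_contDiffGroupoid_iff {e : OpenPartialHomeomorph (EuclideanQuadrant d)
    (EuclideanQuadrant d)} : e ∈ contDiffGroupoid ∞ (corners d) ↔
      ContMDiffOn (corners d) (corners d) ∞ e e.source ∧
        ContMDiffOn (corners d) (corners d) ∞ e.symm e.target := by
  rw [← IsManifold.mem_maximalAtlas_iff_contMDiffOn]
  refine ⟨fun h ↦ StructureGroupoid.mem_maximalAtlas_of_mem_groupoid _ h, fun h ↦ ?_⟩
  have := (contDiffGroupoid ∞ (corners d)).compatible_of_mem_maximalAtlas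
    (StructureGroupoid.mem_maximalAtlas_of_mem_groupoid _ (contDiffGroupoid ∞ (corners d)).id_mem) h
  simpa using this

/-- Maximality of the atlas enters here. With this description, equality of two structures reduces
to smoothness of the identity in both directions. -/
theorem SmoothStructure.mem_atlas_iff (S : SmoothStructure d X)
    {e : OpenPartialHomeomorph X (EuclideanQuadrant d)} :
    letI := S.chartedSpace
    e ∈ S.atlas ↔ ContMDiffOn (corners d) (corners d) ∞ e e.source ∧
      ContMDiffOn (corners d) (corners d) ∞ e.symm e.target := by
  let := S.chartedSpace
  have := S.isManifold
  rw [← IsManifold.mem_maximalAtlas_iff_contMDiffOn, IsManifold.mem_maximalAtlas_iff,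
    mem_maximalAtlas_iff]
  constructor
  · exact fun he e' he' ↦ ⟨S.compatible _ he _ he', S.compatible _ he' _ he⟩
  · exact fun h ↦ S.maximal e h

/-- The maximal atlas generated by a set of compatible charts. -/
def SmoothStructure.ofCharts (A : Set (OpenPartialHomeomorph X (EuclideanQuadrant d)))
    (cover : ∀ x, ∃ e ∈ A, x ∈ e.source)
    (compatible : ∀ e ∈ A, ∀ e' ∈ A,
      ContMDiffOn (corners d) (corners d) ∞ (e.symm ≫ₕ e') (e.symm ≫ₕ e').source) :
    SmoothStructure d X :=
  letI : ChartedSpace (EuclideanQuadrant d) X :=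
    { atlas := A
      chartAt := fun x ↦ (cover x).choose
      mem_chart_source := fun x ↦ (cover x).choose_spec.2
      chart_mem_atlas := fun x ↦ (cover x).choose_spec.1 }
  haveI : HasGroupoid X (contDiffGroupoid ∞ (corners d)) := ⟨fun he he' ↦
    mem_contDiffGroupoid_iff.2 ⟨compatible _ he _ he', compatible _ he' _ he⟩⟩
  { atlas := (contDiffGroupoid ∞ (corners d)).maximalAtlas X
    cover := fun x ↦ ⟨_, StructureGroupoid.subset_maximalAtlas _ (cover x).choose_spec.1,
      (cover x).choose_spec.2⟩
    compatible := fun _ he _ he' ↦ StructureGroupoid.compatible_of_mem_maximalAtlas he he'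
    maximal := fun _ h ↦ mem_maximalAtlas_iff.2 fun e' he' ↦
      h e' (StructureGroupoid.subset_maximalAtlas _ he') }

theorem SmoothStructure.subset_ofCharts {A : Set (OpenPartialHomeomorph X (EuclideanQuadrant d))}
    (cover : ∀ x, ∃ e ∈ A, x ∈ e.source)
    (compatible : ∀ e ∈ A, ∀ e' ∈ A,
      ContMDiffOn (corners d) (corners d) ∞ (e.symm ≫ₕ e') (e.symm ≫ₕ e').source) :
    A ⊆ (SmoothStructure.ofCharts A cover compatible).atlas := by
  let : ChartedSpace (EuclideanQuadrant d) X :=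
    { atlas := A
      chartAt := fun x ↦ (cover x).choose
      mem_chart_source := fun x ↦ (cover x).choose_spec.2
      chart_mem_atlas := fun x ↦ (cover x).choose_spec.1 }
  have : HasGroupoid X (contDiffGroupoid ∞ (corners d)) := ⟨fun he he' ↦
    mem_contDiffGroupoid_iff.2 ⟨compatible _ he _ he', compatible _ he' _ he⟩⟩
  exact StructureGroupoid.subset_maximalAtlas (contDiffGroupoid ∞ (corners d))

theorem SmoothStructure.ext_atlas {S S' : SmoothStructure d X} (h : S.atlas = S'.atlas) :
    S = S' := by
  cases S; cases S'; simpa using h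

/-- The map `f` from `X` with the smooth structure `S` to `Y` with the smooth structure `S'` is
smooth at `x`. -/
def SmoothAt {Y : Type*} [TopologicalSpace Y] (S : SmoothStructure d X) (S' : SmoothStructure d Y)
    (f : X → Y) (x : X) : Prop :=
  letI := S.chartedSpace
  letI := S'.chartedSpace
  ContMDiffAt (corners d) (corners d) ∞ f x

section Comp

variable {F₁ H₁ M₁ F₂ H₂ M₂ F₃ H₃ M₃ : Type*}
  [NormedAddCommGroup F₁] [NormedSpace ℝ F₁] [TopologicalSpace H₁] (I₁ : ModelWithCorners ℝ F₁ H₁)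
  [TopologicalSpace M₁] [c₁ : ChartedSpace H₁ M₁]
  [NormedAddCommGroup F₂] [NormedSpace ℝ F₂] [TopologicalSpace H₂] (I₂ : ModelWithCorners ℝ F₂ H₂)
  [TopologicalSpace M₂] [c₂ : ChartedSpace H₂ M₂]
  [NormedAddCommGroup F₃] [NormedSpace ℝ F₃] [TopologicalSpace H₃] (I₃ : ModelWithCorners ℝ F₃ H₃)
  [TopologicalSpace M₃] [c₃ : ChartedSpace H₃ M₃] {g : M₂ → M₃} {f : M₁ → M₂}
  {s : Set M₁} {t : Set M₂} {x : M₁}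

theorem contMDiffAt_comp_of_isOpen (hg : ContMDiffOn I₂ I₃ ∞ g t) (ht : IsOpen t)
    (hx : f x ∈ t) (hf : ContMDiffAt I₁ I₂ ∞ f x) : ContMDiffAt I₁ I₃ ∞ (fun y ↦ g (f y)) x :=
  ((hg _ hx).contMDiffAt (ht.mem_nhds hx)).comp x hf

theorem contMDiffWithinAt_comp_of_contMDiffAt (hg : ContMDiffAt I₂ I₃ ∞ g (f x))
    (hf : ContMDiffWithinAt I₁ I₂ ∞ f s x) : ContMDiffWithinAt I₁ I₃ ∞ (fun y ↦ g (f y)) s x :=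
  hg.comp_contMDiffWithinAt x hf

theorem contMDiffOn_of_contMDiffAt (h : ∀ x ∈ s, ContMDiffAt I₁ I₂ ∞ f x) :
    ContMDiffOn I₁ I₂ ∞ f s := fun x hx ↦ (h x hx).contMDiffWithinAt

end Comp

theorem SmoothStructure.atlas_subset {S S' : SmoothStructure d X}
    (h : ∀ x, SmoothAt S S' id x) (h' : ∀ x, SmoothAt S' S id x) : S.atlas ⊆ S'.atlas := by
  intro e he
  rw [S.mem_atlas_iff] at he
  rw [S'.mem_atlas_iff]
  constructor
  · exact contMDiffOn_of_contMDiffAt (c₁ := S'.chartedSpace) _ _ fun x hx ↦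
      contMDiffAt_comp_of_isOpen (c₁ := S'.chartedSpace) (c₂ := S.chartedSpace)
      (corners d) (corners d) (corners d) (f := id) he.1 e.open_source hx (h' x)
  · exact fun y hy ↦ contMDiffWithinAt_comp_of_contMDiffAt (c₂ := S.chartedSpace)
      (c₃ := S'.chartedSpace) (corners d) (corners d) (corners d) (g := id) (h _) (he.2 y hy)

theorem SmoothStructure.eq_of_smoothAt {S S' : SmoothStructure d X}
    (h : ∀ x, SmoothAt S S' id x) (h' : ∀ x, SmoothAt S' S id x) : S = S' :=
  ext_atlas (subset_antisymm (atlas_subset h h') (atlas_subset h' h))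

variable {F H Y : Type*} [NormedAddCommGroup F] [NormedSpace ℝ F] [TopologicalSpace H]
  [TopologicalSpace Y] [ChartedSpace H Y] {I : ModelWithCorners ℝ F H}

/-- A version of `IsDiffeoOnto` for maps on the space `X` with the smooth structure `S`. -/
abbrev SmoothStructure.IsDiffeoOnto (S : SmoothStructure d X) (I : ModelWithCorners ℝ F H)
    (f : X → Y) (A : Set X) (B : Set Y) : Prop :=
  letI := S.chartedSpace
  PolarStab.IsDiffeoOnto (corners d) I f A B

/-- On `A`, the map `φ` is the inverse of `f'` after `ψ ∘ f`. This is the common tool for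
uniqueness, where `φ` and `ψ` are identities, and for the actions, where `ψ` is the action on the
manifold containing the chart values. -/
theorem smoothAt_of_isDiffeoOnto {X' : Type*} [TopologicalSpace X'] {S : SmoothStructure d X}
    {S' : SmoothStructure d X'} {f : X → Y} {f' : X' → Y} {A : Set X} {A' : Set X'} {B B' : Set Y}
    (hA : IsOpen A) (h : S.IsDiffeoOnto I f A B) (h' : S'.IsDiffeoOnto I f' A' B')
    {φ : X → X'} {ψ : Y → Y} (hφ : MapsTo φ A A') (hψ : ContMDiffOn I I ∞ ψ B)
    (hf : ∀ x ∈ A, f' (φ x) = ψ (f x)) {x : X} (hx : x ∈ A) : SmoothAt S S' φ x := by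
  have key : ∀ {X X' : Type _} [TopologicalSpace X] [TopologicalSpace X']
      [ChartedSpace (EuclideanQuadrant d) X] [ChartedSpace (EuclideanQuadrant d) X']
      {f : X → Y} {f' : X' → Y} {A : Set X} {A' : Set X'},
      IsOpen A → PolarStab.IsDiffeoOnto (corners d) I f A B →
      PolarStab.IsDiffeoOnto (corners d) I f' A' B' → ∀ {φ : X → X'} {x : X}, MapsTo φ A A' →
      (∀ x ∈ A, f' (φ x) = ψ (f x)) → x ∈ A → ContMDiffAt (corners d) (corners d) ∞ φ x := by
    intro X X' _ _ _ _ f f' A A' hA h h' φ x hφ hf hx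
    obtain ⟨h1, h2, -⟩ := h
    obtain ⟨-, h1', g', h3', -, h4'⟩ := h'
    have h5 : ContMDiffOn (corners d) (corners d) ∞ (g' ∘ ψ ∘ f) A := by
      refine h3'.comp (hψ.comp h1 h2) fun y hy ↦ ?_
      rw [mem_preimage, Function.comp_apply, ← hf y hy]
      exact h1' (hφ hy)
    refine (h5.congr fun y hy ↦ ?_).contMDiffAt (hA.mem_nhds hx)
    rw [Function.comp_apply, Function.comp_apply, ← hf y hy, h4'.1 (hφ hy)]
  let := S.chartedSpace
  let := S'.chartedSpace
  exact key hA h h' hφ hf hx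

end Structures

/-! ### Embeddings of models -/

section Models

variable {F F' H H' : Type*} [NormedAddCommGroup F] [NormedSpace ℝ F] [TopologicalSpace H]
  [NormedAddCommGroup F'] [NormedSpace ℝ F'] [TopologicalSpace H']

theorem contMDiffOn_of_model {I : ModelWithCorners ℝ F H} {I' : ModelWithCorners ℝ F' H'}
    {g : H → H'} {A : F → F'} {s : Set H} (hA : ContDiffOn ℝ ∞ A (I '' s))
    (hg : ∀ x ∈ s, I' (g x) = A (I x)) : ContMDiffOn I I' ∞ g s := by
  have h1 : ContMDiffOn I I' ∞ (I'.symm ∘ A ∘ I) s := by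
    refine I'.contMDiffOn_symm.comp (hA.contMDiffOn.comp I.contMDiff.contMDiffOn
      fun x hx ↦ mem_image_of_mem I hx) fun x hx ↦ ?_
    rw [mem_preimage, Function.comp_apply, ← hg x hx]
    exact mem_range_self _
  refine h1.congr fun x hx ↦ ?_
  rw [Function.comp_apply, Function.comp_apply, ← hg x hx, I'.left_inv]

/-- A smooth open embedding of the model `H` of some manifolds with corners into `[0,∞)^d`. -/
structure IsModelEmbedding (I : ModelWithCorners ℝ F H) (d : ℕ)
    (c : OpenPartialHomeomorph H (EuclideanQuadrant d)) : Prop where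
  source_eq : c.source = univ
  smooth : ContMDiffOn I (corners d) ∞ c univ
  smooth_symm : ContMDiffOn (corners d) I ∞ c.symm c.target

section Coords

variable {a b d : ℕ}

/-- Indices of coordinates of a product. -/
def coordIndex (h : a + b = d) : Fin a ⊕ Fin b ≃ Fin d := finSumFinEquiv.trans (finCongr h)

/-- Concatenation of coordinates. -/
def glueCoords (h : a + b = d) (x : EuclideanSpace ℝ (Fin a)) (u : Fin b → ℝ) :
    EuclideanSpace ℝ (Fin d) :=
  WithLp.toLp 2 fun i ↦ Sum.elim (fun j ↦ x j) u ((coordIndex h).symm i)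

/-- The first coordinates. -/
def fstCoords (h : a + b = d) (y : EuclideanSpace ℝ (Fin d)) : EuclideanSpace ℝ (Fin a) :=
  WithLp.toLp 2 fun j ↦ y (coordIndex h (.inl j))

/-- The last coordinates. -/
def sndCoords (h : a + b = d) (y : EuclideanSpace ℝ (Fin d)) : Fin b → ℝ :=
  fun j ↦ y (coordIndex h (.inr j))

theorem glueCoords_inl (h : a + b = d) (x : EuclideanSpace ℝ (Fin a)) (u : Fin b → ℝ) (j : Fin a) :
    glueCoords h x u (coordIndex h (.inl j)) = x j := by simp [glueCoords]

theorem glueCoords_inr (h : a + b = d) (x : EuclideanSpace ℝ (Fin a)) (u : Fin b → ℝ) (j : Fin b) :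
    glueCoords h x u (coordIndex h (.inr j)) = u j := by simp [glueCoords]

theorem fstCoords_glueCoords (h : a + b = d) (x : EuclideanSpace ℝ (Fin a)) (u : Fin b → ℝ) :
    fstCoords h (glueCoords h x u) = x := by
  ext j; exact glueCoords_inl h x u j

theorem sndCoords_glueCoords (h : a + b = d) (x : EuclideanSpace ℝ (Fin a)) (u : Fin b → ℝ) :
    sndCoords h (glueCoords h x u) = u := by
  ext j; exact glueCoords_inr h x u j

theorem glueCoords_coords (h : a + b = d) (y : EuclideanSpace ℝ (Fin d)) :
    glueCoords h (fstCoords h y) (sndCoords h y) = y := by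
  ext i
  obtain ⟨i, rfl⟩ := (coordIndex h).surjective i
  rcases i with j | j
  · rw [glueCoords_inl]; rfl
  · rw [glueCoords_inr]; rfl

theorem glueCoords_nonneg (h : a + b = d) {x : EuclideanSpace ℝ (Fin a)} {u : Fin b → ℝ}
    (hx : ∀ j, 0 ≤ x j) (hu : ∀ j, 0 ≤ u j) (i : Fin d) : 0 ≤ glueCoords h x u i := by
  obtain ⟨i, rfl⟩ := (coordIndex h).surjective i
  rcases i with j | j
  · rw [glueCoords_inl]; exact hx j
  · rw [glueCoords_inr]; exact hu j

theorem contDiff_glueCoords (h : a + b = d) :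
    ContDiff ℝ ∞ fun q : EuclideanSpace ℝ (Fin a) × (Fin b → ℝ) ↦ glueCoords h q.1 q.2 := by
  rw [contDiff_euclidean]
  intro i
  obtain ⟨i, rfl⟩ := (coordIndex h).surjective i
  rcases i with j | j
  · simp only [glueCoords_inl]; fun_prop
  · simp only [glueCoords_inr]; fun_prop

theorem contDiff_fstCoords (h : a + b = d) : ContDiff ℝ ∞ (fstCoords h) := by
  rw [contDiff_euclidean]
  intro i
  simp only [fstCoords]
  fun_prop

theorem contDiff_sndCoords (h : a + b = d) : ContDiff ℝ ∞ (sndCoords h) := by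
  rw [contDiff_pi]
  intro i
  simp only [sndCoords]
  fun_prop

theorem corners_apply {d : ℕ} (x : EuclideanQuadrant d) : corners d x = x.1 := rfl

variable {L : Type*} [NormedAddCommGroup L] [NormedSpace ℝ L]

/-- The stabilized double is modelled on `[0,∞)^d`, while some of its pieces are modelled on
products with a vector space. Exponentials of the linear coordinates embed such a factor as an open
set of positive coordinates. -/
theorem exists_isModelEmbedding_prod (h : a + b = d) (Λ : L ≃L[ℝ] EuclideanSpace ℝ (Fin b)) :
    ∃ c : OpenPartialHomeomorph (ModelProd (EuclideanQuadrant a) L) (EuclideanQuadrant d),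
      IsModelEmbedding ((corners a).prod 𝓘(ℝ, L)) d c := by
  set f : ModelProd (EuclideanQuadrant a) L → EuclideanQuadrant d := fun q ↦
    ⟨glueCoords h q.1.1 fun j ↦ Real.exp (Λ q.2 j),
      glueCoords_nonneg h q.1.2 fun _ ↦ (Real.exp_pos _).le⟩ with hf
  set T : Set (EuclideanQuadrant d) := {y | ∀ j, 0 < sndCoords h y.1 j} with hT
  set g : EuclideanQuadrant d → ModelProd (EuclideanQuadrant a) L := fun y ↦
    (⟨fstCoords h y.1, fun j ↦ y.2 _⟩,
      Λ.symm (WithLp.toLp 2 fun j ↦ Real.log (sndCoords h y.1 j))) with hg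
  have hTo : IsOpen T := by
    simp only [hT, ofPred_forall]
    refine isOpen_iInter_of_finite fun j ↦ isOpen_lt continuous_const ?_
    exact (continuous_apply j).comp ((contDiff_sndCoords h).continuous.comp continuous_subtype_val)
  have hfs : ContMDiffOn ((corners a).prod 𝓘(ℝ, L)) (corners d) ∞ f univ := by
    refine contMDiffOn_of_model (A := fun q : EuclideanSpace ℝ (Fin a) × L ↦
      glueCoords h q.1 fun j ↦ Real.exp (Λ q.2 j)) (ContDiff.contDiffOn ?_) fun x _ ↦ rfl
    refine (contDiff_glueCoords h).comp (contDiff_fst.prodMk (contDiff_pi.2 fun j ↦ ?_))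
    exact Real.contDiff_exp.comp ((contDiff_euclidean.1 (Λ.contDiff.comp contDiff_snd)) j)
  have hgs : ContMDiffOn (corners d) ((corners a).prod 𝓘(ℝ, L)) ∞ g T := by
    refine contMDiffOn_of_model (A := fun y : EuclideanSpace ℝ (Fin d) ↦
      (fstCoords h y, Λ.symm (WithLp.toLp 2 fun j ↦ Real.log (sndCoords h y j)))) ?_ fun x _ ↦ rfl
    refine (contDiff_fstCoords h).contDiffOn.prodMk (Λ.symm.contDiff.comp_contDiffOn ?_)
    rw [contDiffOn_euclidean]
    intro j
    refine ContDiffOn.log (((contDiff_pi.1 (contDiff_sndCoords h)) j).contDiffOn) ?_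
    rintro _ ⟨y, hy, rfl⟩
    exact (hy j).ne'
  refine ⟨{ toFun := f
            invFun := g
            source := univ
            target := T
            map_source' := fun q _ j ↦ ?_
            map_target' := fun _ _ ↦ mem_univ _
            left_inv' := fun q _ ↦ ?_
            right_inv' := fun y hy ↦ ?_
            open_source := isOpen_univ
            open_target := hTo
            continuousOn_toFun := hfs.continuousOn
            continuousOn_invFun := hgs.continuousOn }, rfl, hfs, hgs⟩
  · simp only [hf, sndCoords_glueCoords]
    exact Real.exp_pos _
  · obtain ⟨x, l⟩ := q
    refine Prod.ext (Subtype.ext (fstCoords_glueCoords h _ _)) ?_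
    simp only [hg, hf, sndCoords_glueCoords, Real.log_exp]
    exact Λ.symm_apply_apply l
  · refine Subtype.ext ?_
    simp only [hf, hg, ContinuousLinearEquiv.apply_symm_apply]
    have : (fun j ↦ Real.exp (Real.log (sndCoords h y.1 j))) = sndCoords h y.1 :=
      funext fun j ↦ Real.exp_log (hy j)
    rw [this, glueCoords_coords]

/-- A half-line is already a coordinate of the quadrant, so no exponential is needed. This case
serves the factor `[-1,1]` of the outer region. -/
theorem exists_isModelEmbedding_halfSpace (h : a + 1 = d) :
    ∃ c : OpenPartialHomeomorph (ModelProd (EuclideanQuadrant a) (EuclideanHalfSpace 1))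
        (EuclideanQuadrant d), IsModelEmbedding ((corners a).prod (𝓡∂ 1)) d c := by
  set f : ModelProd (EuclideanQuadrant a) (EuclideanHalfSpace 1) → EuclideanQuadrant d := fun q ↦
    ⟨glueCoords h q.1.1 fun j ↦ q.2.1 j, glueCoords_nonneg h q.1.2 fun j ↦ by
      rw [Subsingleton.elim j 0]; exact q.2.2⟩ with hf
  set g : EuclideanQuadrant d → ModelProd (EuclideanQuadrant a) (EuclideanHalfSpace 1) := fun y ↦
    (⟨fstCoords h y.1, fun j ↦ y.2 _⟩, ⟨WithLp.toLp 2 (sndCoords h y.1), y.2 _⟩) with hg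
  have hfs : ContMDiffOn ((corners a).prod (𝓡∂ 1)) (corners d) ∞ f univ := by
    refine contMDiffOn_of_model (A := fun q : EuclideanSpace ℝ (Fin a) × EuclideanSpace ℝ (Fin 1) ↦
      glueCoords h q.1 fun j ↦ q.2 j) (ContDiff.contDiffOn ?_) fun x _ ↦ rfl
    refine (contDiff_glueCoords h).comp (contDiff_fst.prodMk (contDiff_pi.2 fun j ↦ ?_))
    exact contDiff_euclidean.1 contDiff_snd j
  have hgs : ContMDiffOn (corners d) ((corners a).prod (𝓡∂ 1)) ∞ g univ := by
    refine contMDiffOn_of_model (A := fun y : EuclideanSpace ℝ (Fin d) ↦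
      (fstCoords h y, (WithLp.toLp 2 (sndCoords h y) : EuclideanSpace ℝ (Fin 1))))
      (ContDiff.contDiffOn ?_) fun x _ ↦ rfl
    refine (contDiff_fstCoords h).prodMk ?_
    rw [contDiff_euclidean]
    exact fun j ↦ contDiff_pi.1 (contDiff_sndCoords h) j
  refine ⟨{ toFun := f
            invFun := g
            source := univ
            target := univ
            map_source' := fun _ _ ↦ mem_univ _
            map_target' := fun _ _ ↦ mem_univ _
            left_inv' := fun q _ ↦ ?_
            right_inv' := fun y hy ↦ ?_
            open_source := isOpen_univ
            open_target := isOpen_univ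
            continuousOn_toFun := hfs.continuousOn
            continuousOn_invFun := hgs.continuousOn }, rfl, hfs, hgs⟩
  · obtain ⟨x, l⟩ := q
    refine Prod.ext (Subtype.ext (fstCoords_glueCoords h _ _)) (Subtype.ext ?_)
    simp only [hg, hf, sndCoords_glueCoords]
  · exact Subtype.ext (glueCoords_coords h _)

end Coords

/-! ### Charts from local diffeomorphisms -/

variable {d : ℕ} {X Y Y' : Type*} [TopologicalSpace X] [TopologicalSpace Y] [ChartedSpace H Y]
  [TopologicalSpace Y'] [ChartedSpace H' Y']
  {I : ModelWithCorners ℝ F H} {I' : ModelWithCorners ℝ F' H'}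

/-- The charts obtained from a local homeomorphism to a manifold `Y` and an embedding of its
model. -/
def pieceCharts (f : OpenPartialHomeomorph X Y)
    (c : OpenPartialHomeomorph H (EuclideanQuadrant d)) :
    Set (OpenPartialHomeomorph X (EuclideanQuadrant d)) :=
  range fun y : Y ↦ f ≫ₕ (chartAt H y ≫ₕ c)

theorem exists_mem_pieceCharts {c : OpenPartialHomeomorph H (EuclideanQuadrant d)}
    (hc : IsModelEmbedding I d c) (f : OpenPartialHomeomorph X Y) {x : X} (hx : x ∈ f.source) :
    ∃ e ∈ pieceCharts f c, x ∈ e.source :=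
  ⟨_, ⟨f x, rfl⟩, by simp [hx, hc.source_eq]⟩

variable [IsManifold I ∞ Y] [IsManifold I' ∞ Y']

theorem contMDiffOn_chart_trans {c : OpenPartialHomeomorph H (EuclideanQuadrant d)}
    (hc : IsModelEmbedding I d c) (y : Y) :
    ContMDiffOn I (corners d) ∞ (chartAt H y ≫ₕ c) (chartAt H y ≫ₕ c).source :=
  hc.smooth.comp ((contMDiffOn_chart (x := y)).mono fun _ hx ↦ hx.1) fun _ _ ↦ mem_univ _

theorem contMDiffOn_chart_trans_symm {c : OpenPartialHomeomorph H (EuclideanQuadrant d)}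
    (hc : IsModelEmbedding I d c) (y : Y) :
    ContMDiffOn (corners d) I ∞ (chartAt H y ≫ₕ c).symm (chartAt H y ≫ₕ c).target :=
  (contMDiffOn_chart_symm (x := y)).comp (hc.smooth_symm.mono fun _ hx ↦ hx.1) fun _ hx ↦ hx.2

theorem contMDiffOn_pieceCharts {c : OpenPartialHomeomorph H (EuclideanQuadrant d)}
    (hc : IsModelEmbedding I d c) {c' : OpenPartialHomeomorph H' (EuclideanQuadrant d)}
    (hc' : IsModelEmbedding I' d c') {f : OpenPartialHomeomorph X Y}
    {f' : OpenPartialHomeomorph X Y'}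
    (h : ContMDiffOn I I' ∞ (f.symm ≫ₕ f') (f.symm ≫ₕ f').source) :
    ∀ e ∈ pieceCharts f c, ∀ e' ∈ pieceCharts f' c',
      ContMDiffOn (corners d) (corners d) ∞ (e.symm ≫ₕ e') (e.symm ≫ₕ e').source := by
  rintro _ ⟨y, rfl⟩ _ ⟨y', rfl⟩
  have h1 := contMDiffOn_chart_trans_symm hc y
  have h2 := contMDiffOn_chart_trans hc' y'
  have h3 := (h2.comp' h).comp' h1
  refine h3.mono ?_
  rintro x ⟨⟨hx1, hx2⟩, hx3, hx4⟩
  exact ⟨hx1, ⟨hx2, hx3⟩, hx4⟩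

/-- Locally `f` is the chart `f ≫ₕ e` followed by `e.symm`, where `e` is a chart of `Y` composed
with the model embedding; both are smooth, and the inverse is treated in the same way. -/
theorem SmoothStructure.isDiffeoOnto_of_pieceCharts {S : SmoothStructure d X}
    {c : OpenPartialHomeomorph H (EuclideanQuadrant d)}
    (hc : IsModelEmbedding I d c) {f : OpenPartialHomeomorph X Y}
    (h : pieceCharts f c ⊆ S.atlas) : S.IsDiffeoOnto I f f.source f.target := by
  let _ := S.chartedSpace
  refine ⟨fun x hx ↦ ?_, f.mapsTo, f.symm, fun y hy ↦ ?_, f.mapsTo_symm, f.leftInvOn, f.rightInvOn⟩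
  · set e := chartAt H (f x) ≫ₕ c with hedef
    have he : ContMDiffOn (corners d) (corners d) ∞ (f ≫ₕ e) (f ≫ₕ e).source :=
      (S.mem_atlas_iff.1 (h ⟨f x, rfl⟩)).1
    have h1 : ContMDiffOn (corners d) I ∞ (e.symm ∘ (f ≫ₕ e)) _ :=
      (contMDiffOn_chart_trans_symm hc (f x)).comp' he
    have hxs : x ∈ (f ≫ₕ e).source := by simp [hx, hedef, hc.source_eq]
    have h2 : ContMDiffAt (corners d) I ∞ (e.symm ∘ (f ≫ₕ e)) x := by
      refine (h1.mono (t := (f ≫ₕ e).source) fun z hz ↦ ⟨hz, e.map_source hz.2⟩).contMDiffAt ?_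
      exact (f ≫ₕ e).open_source.mem_nhds hxs
    refine (h2.congr_of_eventuallyEq ?_).contMDiffWithinAt
    filter_upwards [(f ≫ₕ e).open_source.mem_nhds hxs] with z hz
    exact (e.left_inv hz.2).symm
  · set e := chartAt H y ≫ₕ c with hedef
    have he : ContMDiffOn (corners d) (corners d) ∞ (f ≫ₕ e).symm (f ≫ₕ e).target :=
      (S.mem_atlas_iff.1 (h ⟨y, rfl⟩)).2
    have hys : y ∈ f.target ∩ e.source := by simp [hy, hedef, hc.source_eq]
    have h1 : ContMDiffOn I (corners d) ∞ ((f ≫ₕ e).symm ∘ e) _ :=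
      he.comp' (contMDiffOn_chart_trans hc y)
    have h2 : ContMDiffAt I (corners d) ∞ ((f ≫ₕ e).symm ∘ e) y := by
      refine (h1.mono (t := f.target ∩ e.source) fun z hz ↦ ⟨hz.2, e.map_source hz.2, ?_⟩).contMDiffAt
        ((f.open_target.inter e.open_source).mem_nhds hys)
      simp [e.left_inv hz.2, hz.1]
    refine (h2.congr_of_eventuallyEq ?_).contMDiffWithinAt
    filter_upwards [(f.open_target.inter e.open_source).mem_nhds hys] with z hz
    simp [e.left_inv hz.2]

end Models

/-! ### Doubles -/

section DoubleBasics

variable {W : Type*} (T : Set W)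

theorem Double.exists_half (x : Double T) : ∃ a w, Double.half T a w = x := by
  induction x using Quotient.inductionOn with
  | h p => exact ⟨p.2, p.1, rfl⟩

theorem Double.half_eq_half {a b : Bool} {w w' : W} :
    Double.half T a w = Double.half T b w' ↔ w = w' ∧ (a = b ∨ w ∈ T) :=
  Quotient.eq (r := doubleSetoid T)

theorem Double.half_of_mem {w : W} (hw : w ∈ T) (a b : Bool) :
    Double.half T a w = Double.half T b w := (Double.half_eq_half T).2 ⟨rfl, Or.inr hw⟩

theorem Double.flip_flip (x : Double T) : Double.flip T (Double.flip T x) = x := by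
  obtain ⟨a, w, rfl⟩ := Double.exists_half T x
  change Double.half T (!!a) w = Double.half T a w
  rw [Bool.not_not]

/-- The folding map. -/
def Double.fold : Double T → W := Double.lift T (fun w _ ↦ w) fun _ _ _ _ ↦ rfl

theorem Double.fold_flip (x : Double T) : Double.fold T (Double.flip T x) = Double.fold T x := by
  obtain ⟨a, w, rfl⟩ := Double.exists_half T x
  rfl

variable [TopologicalSpace W]

theorem Double.continuous_half (a : Bool) : Continuous (Double.half T a) :=
  continuous_quotient_mk'.comp (by fun_prop : Continuous fun w : W ↦ (w, a))

theorem Double.continuous_fold : Continuous (Double.fold T) :=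
  Continuous.quotient_lift continuous_fst _

end DoubleBasics

/-! ### The double of an `h`-cobordism -/

section CobBasics

variable {G : Type uG} [Group G] {m k : ℕ}
  {M : Type uM} [TopologicalSpace M] [ChartedSpace (EuclideanQuadrant m) M] [MulAction G M]
  {N : Type uN} [TopologicalSpace N] [ChartedSpace (EuclideanQuadrant m) N] [MulAction G N]
  {W : Type uW} [TopologicalSpace W] [ChartedSpace (EuclideanQuadrant (m + 1)) W] [MulAction G W]
  {E : Type uE} [TopologicalSpace E] [ChartedSpace (EuclideanQuadrant (m + k)) E] [MulAction G E]
  (C : EncasedHCobordism G m M N W)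

instance : ChartedSpace (EuclideanQuadrant (m + 1)) C.Dbl := C.mirror.chartedSpace

instance : IsManifold (corners (m + 1)) ∞ C.Dbl := C.mirror.isManifold

namespace EncasedHCobordism

/-- The two inclusions of an `h`-cobordism into its double. -/
abbrev half (a : Bool) : W → C.Dbl := Double.half (range C.top) a

/-- The reflection of the double. -/
abbrev flip : C.Dbl → C.Dbl := Double.flip (range C.top)

/-- The action on the double. -/
abbrev act (g : G) : C.Dbl → C.Dbl := Double.map (range C.top) (fun w ↦ g • w) (C.smul_mem_top g)

/-- The folding map of the double. -/
abbrev fold : C.Dbl → W := Double.fold (range C.top)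

theorem exists_half (x : C.Dbl) : ∃ a w, C.half a w = x := Double.exists_half _ x

theorem flip_half (a : Bool) (w : W) : C.flip (C.half a w) = C.half (!a) w := rfl

theorem act_half (g : G) (a : Bool) (w : W) : C.act g (C.half a w) = C.half a (g • w) := rfl

theorem fold_half (a : Bool) (w : W) : C.fold (C.half a w) = w := rfl

theorem contMDiff_bottom : ContMDiff (corners m) (corners (m + 1)) ∞ C.bottom :=
  contMDiffOn_univ.1 C.bottom_diffeo.1

theorem contMDiff_top : ContMDiff (corners m) (corners (m + 1)) ∞ C.top :=
  contMDiffOn_univ.1 C.top_diffeo.1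

/-- The inverse of the inclusion of the top. -/
def topInv : W → N := C.top_diffeo.2.2.choose

theorem contMDiffOn_topInv : ContMDiffOn (corners (m + 1)) (corners m) ∞ C.topInv (range C.top) :=
  C.top_diffeo.2.2.choose_spec.1

theorem topInv_top (n : N) : C.topInv (C.top n) = n :=
  C.top_diffeo.2.2.choose_spec.2.2.1 (mem_univ n)

theorem top_topInv {w : W} (hw : w ∈ range C.top) : C.top (C.topInv w) = w := by
  obtain ⟨n, rfl⟩ := hw
  rw [C.topInv_top]

theorem h_top (n : N) : C.h (C.top n) = 0 := (C.h_eq_zero_iff _).2 (mem_range_self n)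

theorem collar_eq_of_bottom_or_side {q : M × Icc (-1 : ℝ) 0}
    (hq : (q.2 : ℝ) = -1 ∨ q.1 ∈ (corners m).boundary M) :
    C.r (C.collar q) = q.1 ∧ C.h (C.collar q) = q.2 :=
  C.encase_collar.self_of_nhdsSet q hq

theorem r_bottom (x : M) : C.r (C.bottom x) = x := by
  have h := C.collar_eq_of_bottom_or_side (q := (x, ⟨-1, by norm_num⟩)) (Or.inl rfl)
  rw [C.collar_bottom _ rfl] at h
  exact h.1

theorem h_bottom (x : M) : C.h (C.bottom x) = -1 := by
  have h := C.collar_eq_of_bottom_or_side (q := (x, ⟨-1, by norm_num⟩)) (Or.inl rfl)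
  rw [C.collar_bottom _ rfl] at h
  exact h.2

/-- The interior of the set where the encasing function inverts the lower collar. -/
def core : Set (M × Icc (-1 : ℝ) 0) :=
  interior {q | q ∈ C.collar.source ∧ C.r (C.collar q) = q.1 ∧ C.h (C.collar q) = q.2}

theorem isOpen_core : IsOpen C.core := isOpen_interior

variable {C} in
theorem mem_core {q : M × Icc (-1 : ℝ) 0} (hq : q ∈ C.core) :
    q ∈ C.collar.source ∧ C.r (C.collar q) = q.1 ∧ C.h (C.collar q) = q.2 := by
  have := interior_subset (s := {q | q ∈ C.collar.source ∧ C.r (C.collar q) = q.1 ∧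
    C.h (C.collar q) = q.2}) hq
  exact this

theorem mem_core_of_bottom_or_side {q : M × Icc (-1 : ℝ) 0}
    (hq : (q.2 : ℝ) = -1 ∨ q.1 ∈ (corners m).boundary M) : q ∈ C.core := by
  have h1 : C.collar.source ∈ 𝓝 q :=
    C.collar.open_source.mem_nhds (C.subset_collar_source hq)
  have h2 := (eventually_nhdsSet_iff_forall.1 C.encase_collar) q hq
  rw [core, mem_interior_iff_mem_nhds]
  filter_upwards [h1, h2] with p hp1 hp2 using ⟨hp1, hp2⟩

theorem isOpen_collarNhd : IsOpen (collarNhd C) :=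
  C.collar.isOpen_image_of_subset_source C.isOpen_core fun _ hq ↦ (mem_core hq).1

theorem bottom_mem_collarNhd (x : M) : C.bottom x ∈ collarNhd C :=
  ⟨(x, ⟨-1, by norm_num⟩), C.mem_core_of_bottom_or_side (Or.inl rfl), C.collar_bottom _ rfl⟩

theorem bottom_notMem_top (x : M) : C.bottom x ∉ range C.top := fun h ↦
  disjoint_left.1 C.disjoint (mem_range_self x) h

theorem isClosed_top : IsClosed (range C.top) := C.top_face.1

theorem isClosed_bottom : IsClosed (range C.bottom) := C.bottom_face.1

theorem contMDiff_half (a : Bool) : ContMDiff (corners (m + 1)) (corners (m + 1)) ∞ (C.half a) :=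
  contMDiffOn_univ.1 (C.half_diffeo a).1

/-- Smoothness holds on each half only: folding turns the height into minus its absolute value,
which has a kink along the top. -/
theorem contMDiffOn_fold (a : Bool) :
    ContMDiffOn (corners (m + 1)) (corners (m + 1)) ∞ C.fold (range (C.half a)) := by
  obtain ⟨-, -, f', h1, -, h2⟩ := C.half_diffeo a
  refine ContMDiffOn.congr h1 ?_
  rintro _ ⟨w, rfl⟩
  rw [C.fold_half]
  exact (h2.1 (mem_univ w)).symm

theorem contMDiff_flip : ContMDiff (corners (m + 1)) (corners (m + 1)) ∞ C.flip := C.smooth_flip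

theorem contMDiff_act (g : G) : ContMDiff (corners (m + 1)) (corners (m + 1)) ∞ (C.act g) :=
  C.smooth_smul g

theorem contMDiff_rDbl : ContMDiff (corners (m + 1)) (corners m) ∞ C.rDbl := C.rDbl_smooth

theorem contMDiff_hDbl : ContMDiff (corners (m + 1)) 𝓘(ℝ, ℝ) ∞ C.hDbl := C.hDbl_smooth

theorem rDbl_half (a : Bool) (w : W) : C.rDbl (C.half a w) = C.r w := rfl

theorem hDbl_half (a : Bool) (w : W) : C.hDbl (C.half a w) = if a then -C.h w else C.h w := rfl

theorem rDbl_eq_fold (x : C.Dbl) : C.rDbl x = C.r (C.fold x) := by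
  obtain ⟨a, w, rfl⟩ := C.exists_half x; rfl

theorem hDbl_flip (x : C.Dbl) : C.hDbl (C.flip x) = -C.hDbl x := by
  obtain ⟨a, w, rfl⟩ := C.exists_half x
  rw [C.flip_half, hDbl_half, hDbl_half]
  cases a <;> simp

theorem rDbl_flip (x : C.Dbl) : C.rDbl (C.flip x) = C.rDbl x := by
  obtain ⟨a, w, rfl⟩ := C.exists_half x; rfl

theorem hDbl_act (g : G) (x : C.Dbl) : C.hDbl (C.act g x) = C.hDbl x := by
  obtain ⟨a, w, rfl⟩ := C.exists_half x
  rw [C.act_half, hDbl_half, hDbl_half, C.h_smul]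

theorem rDbl_act (g : G) (x : C.Dbl) : C.rDbl (C.act g x) = g • C.rDbl x := by
  obtain ⟨a, w, rfl⟩ := C.exists_half x
  exact C.r_smul g w

theorem act_act (g g' : G) (x : C.Dbl) : C.act g (C.act g' x) = C.act (g * g') x := by
  obtain ⟨a, w, rfl⟩ := C.exists_half x
  simp only [C.act_half, mul_smul]

theorem act_one (x : C.Dbl) : C.act 1 x = x := by
  obtain ⟨a, w, rfl⟩ := C.exists_half x
  simp only [C.act_half, one_smul]

theorem act_flip (g : G) (x : C.Dbl) : C.act g (C.flip x) = C.flip (C.act g x) := by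
  obtain ⟨a, w, rfl⟩ := C.exists_half x; rfl

theorem half_top (a b : Bool) (n : N) : C.half a (C.top n) = C.half b (C.top n) :=
  Double.half_of_mem _ (mem_range_self n) a b

theorem act_half_top (g : G) (a : Bool) (n : N) :
    C.act g (C.half a (C.top n)) = C.half a (C.top (g • n)) := by
  rw [C.act_half, C.top_smul]

theorem flip_half_top (a : Bool) (n : N) : C.flip (C.half a (C.top n)) = C.half a (C.top n) := by
  rw [C.flip_half]; exact C.half_top _ _ n

theorem hDbl_half_false (w : W) : C.hDbl (C.half false w) = C.h w := by simp [hDbl_half]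

/-- On the upper copy the height is `-h ≥ 0`, so a height `≤ 0` forces `h = 0` there, that is, a
point of the top, where the copies agree. -/
theorem half_false_fold {x : C.Dbl} (hx : C.hDbl x ≤ 0) : C.half false (C.fold x) = x := by
  obtain ⟨a, w, rfl⟩ := C.exists_half x
  cases a
  · rfl
  · have h1 : C.hDbl (C.half true w) = -C.h w := by
      rw [hDbl_half]; simp
    rw [h1] at hx
    have h2 : C.h w = 0 := le_antisymm (C.h_mem w).2 (by linarith)
    exact Double.half_of_mem _ ((C.h_eq_zero_iff w).1 h2) _ _

theorem fold_mem_top {x : C.Dbl} (hx : C.hDbl x = 0) : C.fold x ∈ range C.top := by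
  rw [← C.h_eq_zero_iff, ← C.hDbl_half_false, C.half_false_fold hx.le, hx]

theorem hDbl_mem (x : C.Dbl) : C.hDbl x ∈ Icc (-1 : ℝ) 1 := by
  obtain ⟨a, w, rfl⟩ := C.exists_half x
  have := C.h_mem w
  rw [hDbl_half]
  cases a <;> simp only [Bool.false_eq_true, ↓reduceIte] <;> constructor <;>
    linarith [this.1, this.2]

end EncasedHCobordism
end CobBasics

open EncasedHCobordism

/-! ### Points and symmetries of the stabilized double -/

section StBasics

variable {G : Type uG} [Group G] {m k : ℕ}
  {M : Type uM} [TopologicalSpace M] [ChartedSpace (EuclideanQuadrant m) M] [MulAction G M]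
  {N : Type uN} [TopologicalSpace N] [ChartedSpace (EuclideanQuadrant m) N] [MulAction G N]
  {W : Type uW} [TopologicalSpace W] [ChartedSpace (EuclideanQuadrant (m + 1)) W] [MulAction G W]
  {E : Type uE} [TopologicalSpace E] [ChartedSpace (EuclideanQuadrant (m + k)) E] [MulAction G E]

namespace RoundBundle

variable (ν : RoundBundle G m k M E)

theorem continuous_proj : Continuous ν.proj := ν.proj_smooth.continuous

theorem nrmR_eq_euclNorm (φ : RoundTriv (m := m) (k := k) ν.proj ν.nrm) {u : E × ℝ}
    (hu : ν.proj u.1 ∈ φ.base) : ν.nrmR u = euclNorm (φ.coord u.1, u.2) := by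
  rw [nrmR, euclNorm, φ.round _ hu]

theorem contMDiffOn_coord_prod (φ : RoundTriv (m := m) (k := k) ν.proj ν.nrm) :
    ContMDiffOn ((corners (m + k)).prod 𝓘(ℝ, ℝ)) 𝓘(ℝ, EuclideanSpace ℝ (Fin k) × ℝ) ∞
      (fun u : E × ℝ ↦ (φ.coord u.1, u.2)) {u | ν.proj u.1 ∈ φ.base} :=
  (φ.smooth_coord.comp contMDiffOn_fst fun _ hu ↦ hu).prodMk_space contMDiffOn_snd

theorem isOpen_setOf_proj_fst_mem (φ : RoundTriv (m := m) (k := k) ν.proj ν.nrm) :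
    IsOpen {u : E × ℝ | ν.proj u.1 ∈ φ.base} :=
  φ.isOpen_base.preimage (ν.continuous_proj.comp continuous_fst)

theorem continuous_nrmR : Continuous ν.nrmR := by
  rw [continuous_iff_continuousAt]
  intro u
  obtain ⟨φ, hφ⟩ := ν.locally_trivial (ν.proj u.1)
  have ho := (ν.isOpen_setOf_proj_fst_mem φ).mem_nhds (x := u) hφ
  have h1 := (ν.contMDiffOn_coord_prod φ).continuousOn.continuousAt ho
  refine (continuous_euclNorm.continuousAt.comp h1).congr ?_
  filter_upwards [ho] with u' hu'
  exact (ν.nrmR_eq_euclNorm φ hu').symm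

theorem contMDiffAt_nrmR {u : E × ℝ} (hu : ν.nrmR u ≠ 0) :
    ContMDiffAt ((corners (m + k)).prod 𝓘(ℝ, ℝ)) 𝓘(ℝ, ℝ) ∞ ν.nrmR u := by
  obtain ⟨φ, hφ⟩ := ν.locally_trivial (ν.proj u.1)
  have ho := (ν.isOpen_setOf_proj_fst_mem φ).mem_nhds (x := u) hφ
  have h1 := ((ν.contMDiffOn_coord_prod φ) u hφ).contMDiffAt ho
  rw [ν.nrmR_eq_euclNorm φ hφ] at hu
  have h2 := (contDiffAt_euclNorm (mt euclNorm_eq_zero.2 hu)).contMDiffAt.comp u h1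
  refine h2.congr_of_eventuallyEq ?_
  filter_upwards [ho] with u' hu'
  exact ν.nrmR_eq_euclNorm φ hu'

theorem nrmR_nonneg (u : E × ℝ) : 0 ≤ ν.nrmR u := Real.sqrt_nonneg _

theorem abs_snd_le_nrmR (u : E × ℝ) : |u.2| ≤ ν.nrmR u :=
  Real.le_sqrt_of_sq_le (by rw [sq_abs]; nlinarith [sq_nonneg (ν.nrm u.1)])

end RoundBundle

variable (C : EncasedHCobordism G m M N W) (ν : RoundBundle G m k M E)

theorem St.continuous_toW : Continuous (St.toW : St C ν → W) :=
  continuous_quot_lift _ (Continuous.sumElim (C.contMDiff_bottom.continuous.comp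
    (ν.continuous_proj.comp (continuous_fst.comp continuous_subtype_val)))
    (continuous_fst.comp continuous_subtype_val))

theorem St.continuous_encase : Continuous (St.encase : St C ν → E × ℝ) :=
  continuous_quot_lift _ (Continuous.sumElim continuous_subtype_val
    (continuous_snd.comp continuous_subtype_val))

section Constructors

theorem bottom_mem_nontrivial {u : E × ℝ} (h1 : ν.nrmR u = 1) :
    (C.bottom (ν.proj u.1), u) ∈ Nontrivial C ν :=
  ⟨C.r_bottom _, by rw [C.h_bottom, neg_neg, h1]⟩

variable [Nonempty (St C ν)]

/-- The point of the stabilized double given by a point of the fibre product. -/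
def St.ofNontrivial (q : W × (E × ℝ)) : St C ν :=
  open Classical in
  if h : q ∈ Nontrivial C ν then Quot.mk _ (Sum.inr ⟨q, h⟩) else Classical.arbitrary _

/-- The point of the stabilized double given by a point of the trivial region. -/
def St.ofTrivial (u : E × ℝ) : St C ν :=
  open Classical in
  if h : u ∈ Trivial ν then Quot.mk _ (Sum.inl ⟨u, h⟩) else Classical.arbitrary _

variable {C ν}

theorem St.ofNontrivial_of_mem {q : W × (E × ℝ)} (hq : q ∈ Nontrivial C ν) :
    St.ofNontrivial C ν q = Quot.mk _ (Sum.inr ⟨q, hq⟩) := dif_pos hq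

theorem St.ofTrivial_of_mem {u : E × ℝ} (hu : u ∈ Trivial ν) :
    St.ofTrivial C ν u = Quot.mk _ (Sum.inl ⟨u, hu⟩) := dif_pos hu

theorem St.toW_ofNontrivial {q : W × (E × ℝ)} (hq : q ∈ Nontrivial C ν) :
    St.toW (St.ofNontrivial C ν q) = q.1 := by rw [St.ofNontrivial_of_mem hq]; rfl

theorem St.encase_ofNontrivial {q : W × (E × ℝ)} (hq : q ∈ Nontrivial C ν) :
    St.encase (St.ofNontrivial C ν q) = q.2 := by rw [St.ofNontrivial_of_mem hq]; rfl

theorem St.toW_ofTrivial {u : E × ℝ} (hu : u ∈ Trivial ν) :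
    St.toW (St.ofTrivial C ν u) = C.bottom (ν.proj u.1) := by rw [St.ofTrivial_of_mem hu]; rfl

theorem St.encase_ofTrivial {u : E × ℝ} (hu : u ∈ Trivial ν) :
    St.encase (St.ofTrivial C ν u) = u := by rw [St.ofTrivial_of_mem hu]; rfl

theorem St.cases (z : St C ν) : (∃ u ∈ Trivial ν, z = St.ofTrivial C ν u) ∨
    ∃ q ∈ Nontrivial C ν, z = St.ofNontrivial C ν q := by
  induction z using Quot.inductionOn with
  | h a =>
    rcases a with u | q
    · exact Or.inl ⟨u.1, u.2, (St.ofTrivial_of_mem u.2).symm⟩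
    · exact Or.inr ⟨q.1, q.2, (St.ofNontrivial_of_mem q.2).symm⟩

theorem St.ofTrivial_eq_ofNontrivial {u : E × ℝ} (hu : u ∈ Trivial ν) (h1 : ν.nrmR u = 1) :
    St.ofTrivial C ν u = St.ofNontrivial C ν (C.bottom (ν.proj u.1), u) := by
  rw [St.ofTrivial_of_mem hu, St.ofNontrivial_of_mem (bottom_mem_nontrivial C ν h1)]
  exact Quot.sound ⟨h1, rfl⟩

theorem St.continuousOn_ofNontrivial :
    ContinuousOn (St.ofNontrivial C ν) (Nontrivial C ν) := by
  rw [continuousOn_iff_continuous_domRestrict]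
  have : Continuous fun q : Nontrivial C ν ↦ (Quot.mk (Glue C ν) (Sum.inr q) : St C ν) :=
    continuous_quot_mk.comp continuous_inr
  exact this.congr fun q ↦ (St.ofNontrivial_of_mem q.2).symm

theorem St.continuousOn_ofTrivial :
    ContinuousOn (St.ofTrivial C ν) (Trivial ν) := by
  rw [continuousOn_iff_continuous_domRestrict]
  have : Continuous fun u : Trivial ν ↦ (Quot.mk (Glue C ν) (Sum.inl u) : St C ν) :=
    continuous_quot_mk.comp continuous_inl
  exact this.congr fun q ↦ (St.ofTrivial_of_mem q.2).symm

end Constructors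

variable {C ν}

/-- The associated points in `W` and in `E × ℝ`. -/
def St.pair (z : St C ν) : W × (E × ℝ) := (St.toW z, St.encase z)

theorem St.pair_mem [Nonempty (St C ν)] {z : St C ν} (hz : St.toW z ∉ range C.bottom) :
    St.pair z ∈ Nontrivial C ν ∧ St.ofNontrivial C ν (St.pair z) = z := by
  rcases St.cases z with ⟨u, hu, rfl⟩ | ⟨q, hq, rfl⟩
  · rw [St.toW_ofTrivial hu] at hz
    exact absurd (mem_range_self _) hz
  · have : St.pair (St.ofNontrivial C ν q) = q :=
      Prod.ext (St.toW_ofNontrivial hq) (St.encase_ofNontrivial hq)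
    rw [this]
    exact ⟨hq, rfl⟩

theorem St.pair_ofNontrivial [Nonempty (St C ν)] {q : W × (E × ℝ)} (hq : q ∈ Nontrivial C ν) :
    St.pair (St.ofNontrivial C ν q) = q :=
  Prod.ext (St.toW_ofNontrivial hq) (St.encase_ofNontrivial hq)

theorem St.proj_encase (z : St C ν) : ν.proj (St.encase z).1 = C.r (St.toW z) := by
  have : Nonempty (St C ν) := ⟨z⟩
  rcases St.cases z with ⟨u, hu, rfl⟩ | ⟨q, hq, rfl⟩
  · rw [St.toW_ofTrivial hu, St.encase_ofTrivial hu, C.r_bottom]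
  · rw [St.toW_ofNontrivial hq, St.encase_ofNontrivial hq, hq.1]

theorem St.encase_snd_mem (z : St C ν) : (St.encase z).2 ∈ Icc (-1 : ℝ) 1 := by
  have : Nonempty (St C ν) := ⟨z⟩
  rcases St.cases z with ⟨u, hu, rfl⟩ | ⟨q, hq, rfl⟩
  · rw [St.encase_ofTrivial hu]; exact hu.1
  · rw [St.encase_ofNontrivial hq, mem_Icc, ← abs_le]
    refine (ν.abs_snd_le_nrmR _).trans ?_
    rw [← hq.2]
    linarith [(C.h_mem q.1).1]

theorem St.neg_h_toW (z : St C ν) (hz : St.toW z ∉ range C.bottom) :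
    -C.h (St.toW z) = ν.nrmR (St.encase z) := by
  have : Nonempty (St C ν) := ⟨z⟩
  exact (St.pair_mem hz).1.2

theorem St.toW_smul (g : G) (z : St C ν) : St.toW (St.smul g z) = g • St.toW z := by
  induction z using Quot.inductionOn with
  | h a =>
    rcases a with u | q
    · change C.bottom (ν.proj (g • u.1.1)) = g • C.bottom (ν.proj u.1.1)
      rw [ν.proj_smul, C.bottom_smul]
    · rfl

theorem St.encase_smul (g : G) (z : St C ν) :
    St.encase (St.smul g z) = (g • (St.encase z).1, (St.encase z).2) := by
  induction z using Quot.inductionOn with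
  | h a => rcases a with u | q <;> rfl

theorem St.toW_flip (z : St C ν) : St.toW (St.flip z) = St.toW z := by
  induction z using Quot.inductionOn with
  | h a => rcases a with u | q <;> rfl

theorem St.encase_flip (z : St C ν) :
    St.encase (St.flip z) = ((St.encase z).1, -(St.encase z).2) := by
  induction z using Quot.inductionOn with
  | h a => rcases a with u | q <;> rfl

end StBasics

/-! ### Charts at the cone locus and their transition maps -/

section Cone

variable {G : Type uG} [Group G] {m k : ℕ}
  {M : Type uM} [TopologicalSpace M] [ChartedSpace (EuclideanQuadrant m) M] [MulAction G M]
  {N : Type uN} [TopologicalSpace N] [ChartedSpace (EuclideanQuadrant m) N] [MulAction G N]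
  {W : Type uW} [TopologicalSpace W] [ChartedSpace (EuclideanQuadrant (m + 1)) W] [MulAction G W]
  {E : Type uE} [TopologicalSpace E] [ChartedSpace (EuclideanQuadrant (m + k)) E] [MulAction G E]
  {C : EncasedHCobordism G m M N W} {ν : RoundBundle G m k M E}

/-- Heights are at least `-1`, so `|u| = -h w ≤ 1` puts the first component of `u` in the closed
disc, where the trivialization is meaningful. -/
theorem nontrivial_param {φ : RoundTriv (m := m) (k := k) ν.proj ν.nrm} {w : W}
    (hw : C.r w ∈ φ.base) {u : EuclideanSpace ℝ (Fin k) × ℝ} (hu : euclNorm u = -C.h w) :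
    (w, (φ.param (C.r w) u.1, u.2)) ∈ Nontrivial C ν := by
  have hv : u.1 ∈ Metric.closedBall 0 1 := by
    rw [mem_closedBall_zero_iff]
    refine (norm_fst_le_euclNorm u).trans ?_
    rw [hu]
    linarith [(C.h_mem w).1]
  have h1 : ν.proj (φ.param (C.r w) u.1) = C.r w := φ.proj_param _ hw _ hv
  refine ⟨h1.symm, ?_⟩
  rw [ν.nrmR_eq_euclNorm φ (by rw [h1]; exact hw), φ.coord_param _ hw _ hv]
  exact hu.symm

namespace ConeChoice

variable {n n' : N} (κ : ConeChoice C ν n) (κ' : ConeChoice C ν n')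

theorem nonempty_st {n : N} (κ : ConeChoice C ν n) : Nonempty (St C ν) :=
  ⟨Quot.mk _ (Sum.inr ⟨_, nontrivial_param (φ := κ.triv) (u := 0) κ.mem_base (by
    rw [C.h_top, neg_zero, euclNorm_eq_zero])⟩)⟩

theorem contMDiffOn_bicollar : ContMDiffOn ((corners m).prod 𝓘(ℝ, ℝ)) (corners (m + 1)) ∞
    κ.bicollar κ.bicollar.source := κ.smooth_bicollar

theorem contMDiffOn_bicollar_symm : ContMDiffOn (corners (m + 1)) ((corners m).prod 𝓘(ℝ, ℝ)) ∞
    κ.bicollar.symm κ.bicollar.target := κ.smooth_bicollar_symm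

theorem mem_source {q : N × ℝ} : q ∈ κ.bicollar.source ↔ q.1 ∈ κ.U ∧ |q.2| < κ.ε := by
  rw [κ.bicollar_source, mem_prod, mem_Ioo, abs_lt]

theorem bicollar_neg' {q : N × ℝ} (hq : q ∈ κ.bicollar.source) :
    κ.bicollar (q.1, -q.2) = C.flip (κ.bicollar q) := κ.bicollar_neg q hq

theorem neg_mem_source {q : N × ℝ} (hq : q ∈ κ.bicollar.source) :
    (q.1, -q.2) ∈ κ.bicollar.source := by
  rw [mem_source] at hq ⊢
  simpa using hq

/-- The height takes all values in `(-ε, ε)` on the image of the bicollar, but it is bounded by `1`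
on the double. Consequently the chart domain misses the bottom, where the height is `-1`. -/
theorem ε_le_one : κ.ε ≤ 1 := by
  by_contra! h
  have hs : (n, (1 + κ.ε) / 2) ∈ κ.bicollar.source :=
    κ.mem_source.2 ⟨κ.mem_U, abs_lt.2 ⟨by dsimp only; linarith, by dsimp only; linarith⟩⟩
  have h1 := κ.h_bicollar _ hs
  have h2 := (C.hDbl_mem (κ.bicollar (n, (1 + κ.ε) / 2))).2
  rw [h1] at h2
  dsimp only at h2
  linarith

theorem flip_mem_target {x : C.Dbl} (hx : x ∈ κ.bicollar.target) :
    C.flip x ∈ κ.bicollar.target ∧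
      κ.bicollar.symm (C.flip x) = ((κ.bicollar.symm x).1, -(κ.bicollar.symm x).2) := by
  have h1 := κ.bicollar.map_target hx
  have h2 := κ.bicollar_neg' h1
  rw [κ.bicollar.right_inv hx] at h2
  rw [← h2]
  exact ⟨κ.bicollar.map_source (κ.neg_mem_source h1), κ.bicollar.left_inv (κ.neg_mem_source h1)⟩

theorem symm_snd {x : C.Dbl} (hx : x ∈ κ.bicollar.target) : (κ.bicollar.symm x).2 = C.hDbl x := by
  rw [← κ.h_bicollar _ (κ.bicollar.map_target hx), κ.bicollar.right_inv hx]

theorem rDbl_mem {x : C.Dbl} (hx : x ∈ κ.bicollar.target) : C.rDbl x ∈ κ.triv.base := by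
  rw [← κ.bicollar.right_inv hx]
  exact κ.r_bicollar _ (κ.bicollar.map_target hx)

theorem mem_codomain {p : N × (EuclideanSpace ℝ (Fin k) × ℝ)} :
    p ∈ κ.codomain ↔ (p.1, euclNorm p.2) ∈ κ.bicollar.source := by
  rw [mem_source, abs_of_nonneg (euclNorm_nonneg _), euclNorm, Real.sqrt_lt' κ.ε_pos]
  rfl

theorem isOpen_codomain : IsOpen κ.codomain := by
  have : κ.codomain = (fun p : N × (EuclideanSpace ℝ (Fin k) × ℝ) ↦ (p.1, euclNorm p.2)) ⁻¹'
      κ.bicollar.source := Set.ext fun p ↦ κ.mem_codomain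
  rw [this]
  exact κ.bicollar.open_source.preimage
    (continuous_fst.prodMk (continuous_euclNorm.comp continuous_snd))

theorem isOpen_domain : IsOpen κ.domain :=
  κ.bicollar.open_target.preimage ((Double.continuous_half _ _).comp (St.continuous_toW C ν))

theorem toW_notMem_bottom {z : St C ν} (hz : z ∈ κ.domain) : St.toW z ∉ range C.bottom := by
  rintro ⟨x, hx⟩
  have h1 : C.half false (St.toW z) ∈ κ.bicollar.target := hz
  have h2 := κ.symm_snd h1
  rw [C.hDbl_half_false, ← hx, C.h_bottom, hx] at h2
  have h3 := (κ.mem_source.1 (κ.bicollar.map_target h1)).2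
  rw [h2] at h3
  norm_num at h3
  exact absurd κ.ε_le_one (not_le.2 h3)

/-- The point of the upper half of the bicollar given by the value of a chart at the cone locus. -/
def pt (p : N × (EuclideanSpace ℝ (Fin k) × ℝ)) : C.Dbl := κ.bicollar (p.1, euclNorm p.2)

theorem hDbl_pt {p : N × (EuclideanSpace ℝ (Fin k) × ℝ)} (hp : p ∈ κ.codomain) :
    C.hDbl (κ.pt p) = euclNorm p.2 := κ.h_bicollar _ (κ.mem_codomain.1 hp)

theorem flip_pt {p : N × (EuclideanSpace ℝ (Fin k) × ℝ)} (hp : p ∈ κ.codomain) :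
    C.flip (κ.pt p) = κ.bicollar (p.1, -euclNorm p.2) :=
  (κ.bicollar_neg' (κ.mem_codomain.1 hp)).symm

/-- The fibre product sees the lower half, at parameter `-|u|`, while `pt` uses `+|u|`; the
reflection relates the two. The positive sign allows even functions of the collar parameter to be
evaluated directly at the radius. -/
theorem half_fold_pt {p : N × (EuclideanSpace ℝ (Fin k) × ℝ)} (hp : p ∈ κ.codomain) :
    C.half false (C.fold (κ.pt p)) = C.flip (κ.pt p) := by
  have h1 : C.fold (κ.pt p) = C.fold (C.flip (κ.pt p)) := (Double.fold_flip _ _).symm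
  rw [h1, C.half_false_fold]
  rw [C.hDbl_flip, κ.hDbl_pt hp]
  linarith [euclNorm_nonneg p.2]

theorem h_fold_pt {p : N × (EuclideanSpace ℝ (Fin k) × ℝ)} (hp : p ∈ κ.codomain) :
    C.h (C.fold (κ.pt p)) = -euclNorm p.2 := by
  rw [← C.hDbl_half_false, κ.half_fold_pt hp, C.hDbl_flip, κ.hDbl_pt hp]

theorem rDbl_pt_mem {p : N × (EuclideanSpace ℝ (Fin k) × ℝ)} (hp : p ∈ κ.codomain) :
    C.rDbl (κ.pt p) ∈ κ.triv.base := κ.r_bicollar _ (κ.mem_codomain.1 hp)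

theorem fst_mem_closedBall {p : N × (EuclideanSpace ℝ (Fin k) × ℝ)} (hp : p ∈ κ.codomain) :
    p.2.1 ∈ Metric.closedBall 0 1 := by
  rw [mem_closedBall_zero_iff]
  refine (norm_fst_le_euclNorm _).trans ?_
  rw [← κ.hDbl_pt hp]
  exact (C.hDbl_mem _).2

/-- The point of `W × (E × ℝ)` given by the value of a chart at the cone locus. -/
def pairInv (p : N × (EuclideanSpace ℝ (Fin k) × ℝ)) : W × (E × ℝ) :=
  (C.fold (κ.pt p), (κ.triv.param (C.rDbl (κ.pt p)) p.2.1, p.2.2))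

theorem pairInv_mem {p : N × (EuclideanSpace ℝ (Fin k) × ℝ)} (hp : p ∈ κ.codomain) :
    κ.pairInv p ∈ Nontrivial C ν := by
  rw [pairInv, C.rDbl_eq_fold]
  refine nontrivial_param (by rw [← C.rDbl_eq_fold]; exact κ.rDbl_pt_mem hp) ?_
  rw [κ.h_fold_pt hp, neg_neg]

theorem continuousOn_pt : ContinuousOn κ.pt κ.codomain :=
  κ.bicollar.continuousOn.comp (f := fun p : N × (EuclideanSpace ℝ (Fin k) × ℝ) ↦
    (p.1, euclNorm p.2)) (continuous_fst.prodMk (continuous_euclNorm.comp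
    continuous_snd)).continuousOn fun _ hp ↦ κ.mem_codomain.1 hp

/-- The function underlying a chart at the cone locus on pairs of points. -/
def pairChart (q : W × (E × ℝ)) : N × (EuclideanSpace ℝ (Fin k) × ℝ) :=
  ((κ.bicollar.symm (C.half false q.1)).1, (κ.triv.coord q.2.1, q.2.2))

theorem chart_eq (z : St C ν) : κ.chart z = κ.pairChart (St.pair z) := rfl

/-- An open set on which a chart at the cone locus is defined as a function of pairs of points. -/
def pairDomain : Set (W × (E × ℝ)) :=
  {q | C.half false q.1 ∈ κ.bicollar.target ∧ ν.proj q.2.1 ∈ κ.triv.base}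

theorem pair_mem_pairDomain {z : St C ν} (hz : z ∈ κ.domain) : St.pair z ∈ κ.pairDomain := by
  have h1 : C.half false (St.toW z) ∈ κ.bicollar.target := hz
  refine ⟨h1, ?_⟩
  rw [St.pair, St.proj_encase, ← C.rDbl_half false]
  exact κ.rDbl_mem h1

theorem contMDiffOn_pairChart :
    ContMDiffOn ((corners (m + 1)).prod ((corners (m + k)).prod 𝓘(ℝ, ℝ))) (coneModel m k) ∞
      κ.pairChart κ.pairDomain := by
  refine ContMDiffOn.prodMk ?_ (ContMDiffOn.prodMk_space ?_ ?_)
  · refine contMDiffOn_fst.comp (t := univ) (κ.contMDiffOn_bicollar_symm.comp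
      ((C.contMDiff_half false).comp contMDiff_fst).contMDiffOn fun q hq ↦ hq.1)
      fun _ _ ↦ mem_univ _
  · exact κ.triv.smooth_coord.comp (contMDiff_fst.comp contMDiff_snd).contMDiffOn fun q hq ↦ hq.2
  · exact (contMDiff_snd.comp contMDiff_snd).contMDiffOn

/-- The target of a bicollar is invariant under the reflection, so membership can be tested with
either sign of the radius. -/
theorem mem_domain_iff [Nonempty (St C ν)] {p : N × (EuclideanSpace ℝ (Fin k) × ℝ)}
    (hp : p ∈ κ.codomain) :
    St.ofNontrivial C ν (κ.pairInv p) ∈ κ'.domain ↔ κ.pt p ∈ κ'.bicollar.target := by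
  have h : St.toW (St.ofNontrivial C ν (κ.pairInv p)) = C.fold (κ.pt p) :=
    St.toW_ofNontrivial (κ.pairInv_mem hp)
  change C.half false (St.toW (St.ofNontrivial C ν (κ.pairInv p))) ∈ κ'.bicollar.target ↔ _
  rw [h, κ.half_fold_pt hp]
  refine ⟨fun h ↦ ?_, fun h ↦ (κ'.flip_mem_target h).1⟩
  have := (κ'.flip_mem_target h).1
  rwa [show C.flip (C.flip (κ.pt p)) = κ.pt p from Double.flip_flip _ _] at this

section

variable [IsManifold (corners m) ∞ M] [IsManifold (corners m) ∞ N]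

/-- The retraction of the double is invariant under the reflection, so `r ∘ b` is even in the collar
parameter, and Whitney's theorem covers the points with `u = 0`. -/
theorem contMDiffOn_rDbl_pt :
    ContMDiffOn (coneModel m k) (corners m) ∞ (fun p ↦ C.rDbl (κ.pt p)) κ.codomain :=
  contMDiffOn_of_contMDiffAt _ _ fun p hp ↦
    contMDiffAt_comp_euclNorm (φ := fun q ↦ C.rDbl (κ.bicollar q)) κ.bicollar.open_source
      (C.contMDiff_rDbl.contMDiffOn.comp (t := univ) κ.contMDiffOn_bicollar fun _ _ ↦ mem_univ _)
      (fun q hq ↦ by rw [κ.bicollar_neg' hq, C.rDbl_flip]) (κ.mem_codomain.1 hp)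

theorem contMDiffOn_param_pt :
    ContMDiffOn (coneModel m k) (corners (m + k)) ∞
      (fun p ↦ κ.triv.param (C.rDbl (κ.pt p)) p.2.1) κ.codomain :=
  κ.triv.smooth_param.comp (κ.contMDiffOn_rDbl_pt.prodMk
    ((contDiff_fst.contMDiff.comp contMDiff_snd).contMDiffOn)) fun _ hp ↦
    ⟨κ.rDbl_pt_mem hp, κ.fst_mem_closedBall hp⟩

variable [Nonempty (St C ν)]

/-- The chart at the cone locus as a local homeomorphism. -/
def chartHomeo : OpenPartialHomeomorph (St C ν) (N × (EuclideanSpace ℝ (Fin k) × ℝ)) where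
  toFun := κ.chart
  invFun p := St.ofNontrivial C ν (κ.pairInv p)
  source := κ.domain
  target := κ.codomain
  map_source' z hz := by
    have h1 := κ.pair_mem_pairDomain hz
    have h2 : C.half false (St.toW z) ∈ κ.bicollar.target := hz
    rw [mem_codomain, chart_eq, pairChart]
    dsimp only
    -- In the fibre product `|u| = -h w`, and `h w` is the collar parameter of `w`. So `(n', |u|)`
    -- is the mirror image of a point of the source.
    rw [show euclNorm (κ.triv.coord (St.pair z).2.1, (St.pair z).2.2) =
      -(κ.bicollar.symm (C.half false (St.toW z))).2 by
        rw [← ν.nrmR_eq_euclNorm κ.triv h1.2, κ.symm_snd h2, C.hDbl_half_false,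
          St.neg_h_toW z (κ.toW_notMem_bottom hz)]; rfl]
    exact κ.neg_mem_source (κ.bicollar.map_target h2)
  map_target' p hp := (κ.mem_domain_iff κ hp).2 (κ.bicollar.map_source (κ.mem_codomain.1 hp))
  left_inv' z hz := by
    have h1 := κ.pair_mem_pairDomain hz
    have h2 : C.half false (St.toW z) ∈ κ.bicollar.target := hz
    have h3 : κ.pt (κ.chart z) = C.flip (C.half false (St.toW z)) := by
      rw [chart_eq, pairChart, pt]
      dsimp only
      rw [show euclNorm (κ.triv.coord (St.pair z).2.1, (St.pair z).2.2) =
        -(κ.bicollar.symm (C.half false (St.toW z))).2 by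
          rw [← ν.nrmR_eq_euclNorm κ.triv h1.2, κ.symm_snd h2, C.hDbl_half_false,
            St.neg_h_toW z (κ.toW_notMem_bottom hz)]; rfl]
      have := κ.bicollar_neg' (κ.bicollar.map_target h2)
      rw [κ.bicollar.right_inv h2] at this
      exact this
    have h4 : κ.pairInv (κ.chart z) = St.pair z := by
      rw [pairInv, h3, C.rDbl_flip, C.rDbl_half, C.flip_half, C.fold_half, ← St.proj_encase]
      exact Prod.ext rfl (Prod.ext (κ.triv.param_coord _ h1.2) rfl)
    rw [h4]
    exact (St.pair_mem (κ.toW_notMem_bottom hz)).2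
  right_inv' p hp := by
    rw [chart_eq, St.pair_ofNontrivial (κ.pairInv_mem hp), pairChart, pairInv]
    dsimp only
    rw [κ.half_fold_pt hp, κ.flip_pt hp,
      κ.bicollar.left_inv (κ.neg_mem_source (κ.mem_codomain.1 hp)),
      κ.triv.coord_param _ (κ.rDbl_pt_mem hp) _ (κ.fst_mem_closedBall hp)]
  open_source := κ.isOpen_domain
  open_target := κ.isOpen_codomain
  continuousOn_toFun := κ.contMDiffOn_pairChart.continuousOn.comp
    ((St.continuous_toW C ν).prodMk (St.continuous_encase C ν)).continuousOn fun _ hz ↦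
      κ.pair_mem_pairDomain hz
  continuousOn_invFun := by
    refine St.continuousOn_ofNontrivial.comp (ContinuousOn.prodMk ?_ (ContinuousOn.prodMk ?_ ?_))
      fun p hp ↦ κ.pairInv_mem hp
    · exact (Double.continuous_fold _).comp_continuousOn κ.continuousOn_pt
    · exact κ.contMDiffOn_param_pt.continuousOn
    · exact (continuous_snd.comp continuous_snd).continuousOn

/-- The transition map can be written through `pt` alone, without the folding map, which is not
smooth across the top. The component in `N` is an even function of the radius. The disc component is
a change of trivialization whose base point is an even function of the radius. -/
theorem contMDiffOn_chartHomeo_symm_trans :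
    ContMDiffOn (coneModel m k) (coneModel m k) ∞ (κ.chartHomeo.symm ≫ₕ κ'.chartHomeo)
      (κ.chartHomeo.symm ≫ₕ κ'.chartHomeo).source := by
  have hmem : ∀ p ∈ (κ.chartHomeo.symm ≫ₕ κ'.chartHomeo).source,
      p ∈ κ.codomain ∧ κ.pt p ∈ κ'.bicollar.target := fun p hp ↦
    ⟨hp.1, (κ.mem_domain_iff κ' hp.1).1 hp.2⟩
  have h1 : ContMDiffOn (coneModel m k) (coneModel m k) ∞
      (fun p ↦ ((κ'.bicollar.symm (κ.pt p)).1,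
        (κ'.triv.coord (κ.triv.param (C.rDbl (κ.pt p)) p.2.1), p.2.2)))
      (κ.chartHomeo.symm ≫ₕ κ'.chartHomeo).source := by
    refine ContMDiffOn.prodMk ?_ (ContMDiffOn.prodMk_space ?_ ?_)
    · refine contMDiffOn_of_contMDiffAt _ _ fun p hp ↦ ?_
      refine contMDiffAt_comp_euclNorm (φ := fun q ↦ (κ'.bicollar.symm (κ.bicollar q)).1)
        (κ.bicollar.continuousOn.isOpen_inter_preimage κ.bicollar.open_source
          κ'.bicollar.open_target) ?_ ?_ ⟨κ.mem_codomain.1 (hmem p hp).1, (hmem p hp).2⟩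
      · exact contMDiffOn_fst.comp (t := univ) (κ'.contMDiffOn_bicollar_symm.comp
          (κ.contMDiffOn_bicollar.mono inter_subset_left) fun _ hq ↦ hq.2) fun _ _ ↦ mem_univ _
      -- Since both bicollars commute with the reflections, replacing `s` by `-s` leaves the
      -- component in `N` unchanged.
      · rintro q ⟨hq1, hq2⟩
        rw [κ.bicollar_neg' hq1, (κ'.flip_mem_target hq2).2]
    · refine κ'.triv.smooth_coord.comp (κ.contMDiffOn_param_pt.mono fun p hp ↦ (hmem p hp).1)
        fun p hp ↦ ?_
      obtain ⟨hp1, hp2⟩ := hmem p hp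
      rw [mem_preimage, mem_preimage, κ.triv.proj_param _ (κ.rDbl_pt_mem hp1) _
        (κ.fst_mem_closedBall hp1)]
      exact κ'.rDbl_mem hp2
    · exact (contDiff_snd.contMDiff.comp contMDiff_snd).contMDiffOn
  refine h1.congr fun p hp ↦ ?_
  obtain ⟨hp1, hp2⟩ := hmem p hp
  change κ'.chart (St.ofNontrivial C ν (κ.pairInv p)) = _
  rw [chart_eq, St.pair_ofNontrivial (κ.pairInv_mem hp1), pairChart, pairInv]
  dsimp only
  rw [κ.half_fold_pt hp1, (κ'.flip_mem_target hp2).2]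

end

theorem compatible [IsManifold (corners m) ∞ M] [IsManifold (corners m) ∞ N] :
    κ.Compatible κ' := by
  have := κ.nonempty_st
  have hi : ∀ {e e' : OpenPartialHomeomorph (St C ν) (N × (EuclideanSpace ℝ (Fin k) × ℝ))},
      e '' (e.source ∩ e'.source) = (e.symm ≫ₕ e').source := fun {e e'} ↦ by
    rw [OpenPartialHomeomorph.trans_source'']; simp
  have hi' : ∀ {e e' : OpenPartialHomeomorph (St C ν) (N × (EuclideanSpace ℝ (Fin k) × ℝ))},
      image e' (e.source ∩ e'.source) = (e.symm ≫ₕ e').target := fun {e e'} ↦ by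
    rw [OpenPartialHomeomorph.trans_target'']; simp [inter_comm]
  have h1 : κ.chart '' (κ.domain ∩ κ'.domain) = (κ.chartHomeo.symm ≫ₕ κ'.chartHomeo).source :=
    hi (e := κ.chartHomeo) (e' := κ'.chartHomeo)
  have h2 : κ'.chart '' (κ.domain ∩ κ'.domain) = (κ.chartHomeo.symm ≫ₕ κ'.chartHomeo).target :=
    hi' (e := κ.chartHomeo) (e' := κ'.chartHomeo)
  refine ⟨h1 ▸ OpenPartialHomeomorph.open_source _, h2 ▸ OpenPartialHomeomorph.open_target _,
    κ.chartHomeo.symm ≫ₕ κ'.chartHomeo, ?_, fun z hz ↦ ?_⟩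
  · rw [h1, h2]
    exact ⟨κ.contMDiffOn_chartHomeo_symm_trans κ', OpenPartialHomeomorph.mapsTo _,
      (κ.chartHomeo.symm ≫ₕ κ'.chartHomeo).symm, κ'.contMDiffOn_chartHomeo_symm_trans κ,
      OpenPartialHomeomorph.mapsTo_symm _, OpenPartialHomeomorph.leftInvOn _,
      OpenPartialHomeomorph.rightInvOn _⟩
  · change κ'.chartHomeo (κ.chartHomeo.symm (κ.chartHomeo z)) = _
    rw [κ.chartHomeo.left_inv hz.1]
    rfl

end ConeChoice
end Cone

/-! ### From product structures of the double to equivariant choices -/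

section Choice

variable {G : Type uG} [Group G] {m k : ℕ}
  {M : Type uM} [TopologicalSpace M] [ChartedSpace (EuclideanQuadrant m) M] [MulAction G M]
  {N : Type uN} [TopologicalSpace N] [ChartedSpace (EuclideanQuadrant m) N] [MulAction G N]
  {W : Type uW} [TopologicalSpace W] [ChartedSpace (EuclideanQuadrant (m + 1)) W] [MulAction G W]
  {E : Type uE} [TopologicalSpace E] [ChartedSpace (EuclideanQuadrant (m + k)) E] [MulAction G E]
  {C : EncasedHCobordism G m M N W} {ν : RoundBundle G m k M E}

/-- The restriction of a trivialization to a smaller open set. -/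
def RoundTriv.restr {proj : E → M} {nrm : E → ℝ} (φ : RoundTriv (m := m) (k := k) proj nrm)
    (s : Set M) (hs : IsOpen s) : RoundTriv (m := m) (k := k) proj nrm where
  base := φ.base ∩ s
  isOpen_base := φ.isOpen_base.inter hs
  param := φ.param
  coord := φ.coord
  proj_param x hx := φ.proj_param x hx.1
  coord_param x hx := φ.coord_param x hx.1
  coord_mem e he := φ.coord_mem e he.1
  param_coord e he := φ.param_coord e he.1
  smooth_param := φ.smooth_param.mono fun _ hq ↦ ⟨hq.1.1, hq.2⟩
  smooth_coord := φ.smooth_coord.mono fun _ he ↦ he.1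
  round e he := φ.round e he.1

/-- Intersecting translates of the base under the finite isotropy group makes it invariant. The
trivialization itself is only restricted: the action is round in it because it preserves the
distance to the centre. -/
theorem exists_roundTriv_invariant [Finite G] (hM : IsGManifold G m M) (ν : RoundBundle G m k M E)
    (x : M) : ∃ φ : RoundTriv (m := m) (k := k) ν.proj ν.nrm, x ∈ φ.base ∧
      ∀ g : G, g • x = x → ∀ y ∈ φ.base, g • y ∈ φ.base := by
  obtain ⟨φ, hφ⟩ := ν.locally_trivial x
  have ho : IsOpen {y : M | ∀ g : G, g • x = x → g • y ∈ φ.base} := by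
    simp only [ofPred_forall]
    exact isOpen_iInter_of_finite fun g ↦ isOpen_iInter_of_finite fun _ ↦
      φ.isOpen_base.preimage (hM.smooth_smul g).continuous
  refine ⟨φ.restr _ ho, ⟨hφ, fun g hg ↦ by rw [hg]; exact hφ⟩, fun g hg y hy ↦
    ⟨hy.2 g hg, fun g' hg' ↦ ?_⟩⟩
  rw [← mul_smul]
  exact hy.2 (g' * g) (by rw [mul_smul, hg, hg'])

namespace EncasedHCobordism

variable (C)

/-- The isotropy group and the reflection are finite in number and fix the given point of the top,
so the intersection of the translates of `O` is still a neighbourhood. -/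
theorem exists_invariant_nhds [Finite G] (n : N) {O : Set C.Dbl} (hO : IsOpen O)
    (hn : C.half false (C.top n) ∈ O) : ∃ O' ⊆ O, IsOpen O' ∧ C.half false (C.top n) ∈ O' ∧
      (∀ x ∈ O', C.flip x ∈ O') ∧ ∀ g : G, g • n = n → ∀ x ∈ O', C.act g x ∈ O' := by
  refine ⟨{x | ∀ g : G, g • n = n → C.act g x ∈ O ∧ C.act g (C.flip x) ∈ O}, fun x hx ↦ ?_, ?_,
    fun g hg ↦ ?_, fun x hx g hg ↦ ?_, fun g hg x hx g' hg' ↦ ?_⟩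
  · have := (hx 1 (one_smul _ _)).1
    rwa [C.act_one] at this
  · simp only [ofPred_forall]
    refine isOpen_iInter_of_finite fun g ↦ isOpen_iInter_of_finite fun _ ↦ ?_
    exact (hO.preimage (C.contMDiff_act g).continuous).inter
      (hO.preimage ((C.contMDiff_act g).continuous.comp C.contMDiff_flip.continuous))
  · rw [C.flip_half_top, C.act_half_top, hg]
    exact ⟨hn, hn⟩
  · have := hx g hg
    rw [show C.flip (C.flip x) = x from Double.flip_flip _ _]
    exact ⟨this.2, this.1⟩
  · rw [← C.act_flip, C.act_act, C.act_act]
    exact hx _ (by rw [mul_smul, hg, hg'])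

theorem exists_top_of_hDbl {x : C.Dbl} (hx : C.hDbl x = 0) :
    ∃ n, x = C.half false (C.top n) := by
  obtain ⟨n, hn⟩ := C.fold_mem_top hx
  exact ⟨n, by rw [hn, C.half_false_fold hx.le]⟩

theorem hDbl_top (n : N) : C.hDbl (C.half false (C.top n)) = 0 := by
  rw [C.hDbl_half_false, C.h_top]

/-- Smooth product structures of the double near `n` that are compatible with the actions. -/
structure IsTube (n : N) (Θ : OpenPartialHomeomorph C.Dbl (N × ℝ)) : Prop where
  mem_source : C.half false (C.top n) ∈ Θ.source
  smooth : ContMDiffOn (corners (m + 1)) ((corners m).prod 𝓘(ℝ, ℝ)) ∞ Θ Θ.source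
  smooth_symm : ContMDiffOn ((corners m).prod 𝓘(ℝ, ℝ)) (corners (m + 1)) ∞ Θ.symm Θ.target
  snd : ∀ x ∈ Θ.source, (Θ x).2 = C.hDbl x
  fst_top : ∀ n', C.half false (C.top n') ∈ Θ.source → (Θ (C.half false (C.top n'))).1 = n'
  fst_flip : ∀ x ∈ Θ.source, C.flip x ∈ Θ.source → (Θ (C.flip x)).1 = (Θ x).1
  fst_act : ∀ g : G, g • n = n → ∀ x ∈ Θ.source, C.act g x ∈ Θ.source →
    (Θ (C.act g x)).1 = g • (Θ x).1

variable {C}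

/-- The bicollar is the inverse of the product structure, restricted to a product neighbourhood
whose first factor is invariant and whose image lies in an invariant open set `O`. -/
theorem IsTube.exists_isEquivariant [Finite G] (hM : IsGManifold G m M) (hN : IsGManifold G m N)
    {n : N} {Θ : OpenPartialHomeomorph C.Dbl (N × ℝ)} (h : C.IsTube n Θ) :
    ∃ κ : ConeChoice C ν n, κ.IsEquivariant := by
  obtain ⟨φ, hφ, hφ'⟩ := exists_roundTriv_invariant hM ν (C.r (C.top n))
  obtain ⟨O, hOs, hO, hnO, hflip, hact⟩ := C.exists_invariant_nhds n
    (Θ.open_source.inter (φ.isOpen_base.preimage C.contMDiff_rDbl.continuous))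
    ⟨h.mem_source, hφ⟩
  have hΘn : ∀ n', C.half false (C.top n') ∈ Θ.source → Θ (C.half false (C.top n')) = (n', 0) :=
    fun n' hn' ↦ Prod.ext (h.fst_top n' hn') ((h.snd _ hn').trans (C.hDbl_top n'))
  have hT : IsOpen (Θ.target ∩ Θ.symm ⁻¹' O) :=
    Θ.symm.continuousOn.isOpen_inter_preimage Θ.open_target hO
  have hnT : (n, (0 : ℝ)) ∈ Θ.target ∩ Θ.symm ⁻¹' O := by
    rw [← hΘn n h.mem_source]
    exact ⟨Θ.map_source h.mem_source, by rwa [mem_preimage, Θ.left_inv h.mem_source]⟩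
  obtain ⟨U₀, hU₀, I₀, hI₀, hUI⟩ := mem_nhds_prod_iff.1 (hT.mem_nhds hnT)
  obtain ⟨U₁, hU₁, hU₁o, hnU₁⟩ := mem_nhds_iff.1 hU₀
  obtain ⟨ε, hε, hεI⟩ := Metric.mem_nhds_iff.1 hI₀
  rw [Real.ball_eq_Ioo, zero_sub, zero_add] at hεI
  set U : Set N := {n' | ∀ g : G, g • n = n → g • n' ∈ U₁} with hUdef
  have hU : IsOpen U := by
    simp only [hUdef, ofPred_forall]
    exact isOpen_iInter_of_finite fun g ↦ isOpen_iInter_of_finite fun _ ↦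
      hU₁o.preimage (hN.smooth_smul g).continuous
  have hUU₁ : U ⊆ U₁ := fun n' hn' ↦ by simpa using hn' 1 (one_smul _ _)
  have hsub : U ×ˢ Ioo (-ε) ε ⊆ Θ.target ∩ Θ.symm ⁻¹' O := fun q hq ↦
    hUI ⟨hU₁ (hUU₁ hq.1), hεI hq.2⟩
  have hopen : IsOpen (U ×ˢ Ioo (-ε) ε) := hU.prod isOpen_Ioo
  set b := Θ.symm.restrOpen _ hopen with hb
  have hbs : b.source = U ×ˢ Ioo (-ε) ε := by
    rw [hb, OpenPartialHomeomorph.restrOpen_source]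
    exact inter_eq_right.2 fun q hq ↦ (hsub hq).1
  have hbt : b.target ⊆ Θ.source := fun x hx ↦ hx.1
  -- Points of `O` are determined by their coordinates, so compatibility with the reflection and the
  -- isotropy group can be checked by comparing coordinates.
  have key : ∀ q ∈ b.source, ∀ x ∈ O, (Θ x).1 = q.1 → (Θ x).2 = q.2 → b q = x := by
    intro q _ x hx h1 h2
    change Θ.symm q = x
    rw [show q = Θ x from Prod.ext h1.symm h2.symm, Θ.left_inv (hOs hx).1]
  have hbO : ∀ q ∈ b.source, b q ∈ O ∧ Θ (b q) = q := fun q hq ↦ by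
    rw [hbs] at hq
    exact ⟨(hsub hq).2, Θ.right_inv (hsub hq).1⟩
  have hbh : ∀ q ∈ b.source, C.hDbl (b q) = q.2 := fun q hq ↦ by
    rw [← h.snd _ (hOs (hbO q hq).1).1, (hbO q hq).2]
  have hsmulU : ∀ g : G, g • n = n → ∀ n' ∈ U, g • n' ∈ U := fun g hg n' hn' g' hg' ↦ by
    rw [← mul_smul]
    exact hn' _ (by rw [mul_smul, hg, hg'])
  refine ⟨{ U := U
            isOpen_U := hU
            mem_U := fun g hg ↦ by rw [hg]; exact hnU₁
            ε := ε
            ε_pos := hε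
            bicollar := b
            bicollar_source := hbs
            smooth_bicollar := h.smooth_symm.mono fun q hq ↦ hq.1
            smooth_bicollar_symm := h.smooth.mono fun q hq ↦ hq.1
            bicollar_zero := fun n' hn' ↦ ?_
            bicollar_neg := fun q hq ↦ ?_
            h_bicollar := hbh
            triv := φ
            mem_base := hφ
            r_bicollar := fun q hq ↦ (hOs (hbO q hq).1).2 }, ⟨hsmulU, fun g hg q hq ↦ ?_, hφ'⟩⟩
  · have hq : (n', (0 : ℝ)) ∈ b.source := by
      rw [hbs]
      exact ⟨hn', neg_lt_zero.2 hε, hε⟩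
    -- A point of height `0` lies in the top, where the first coordinate is the point of `N` itself.
    obtain ⟨n'', hn''⟩ := C.exists_top_of_hDbl (hbh _ hq)
    have h1 := (hbO _ hq).2
    rw [hn'', hΘn n'' (by rw [← hn'']; exact (hOs (hbO _ hq).1).1)] at h1
    rw [hn'', show n'' = n' from congrArg Prod.fst h1]
  · have h1 : (q.1, -q.2) ∈ b.source := by
      rw [hbs] at hq ⊢
      exact ⟨hq.1, neg_lt_neg hq.2.2, neg_lt.1 hq.2.1⟩
    have h2 := hflip _ (hbO q hq).1
    refine key _ h1 _ h2 ?_ ?_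
    · rw [h.fst_flip _ (hOs (hbO q hq).1).1 (hOs h2).1, (hbO q hq).2]
    · rw [h.snd _ (hOs h2).1, C.hDbl_flip, hbh q hq]
  · have h1 : (g • q.1, q.2) ∈ b.source := by
      rw [hbs] at hq ⊢
      exact ⟨hsmulU g hg _ hq.1, hq.2⟩
    have h2 := hact g hg _ (hbO q hq).1
    refine key _ h1 _ h2 ?_ ?_
    · rw [h.fst_act g hg _ (hOs (hbO q hq).1).1 (hOs h2).1, (hbO q hq).2]
    · rw [h.snd _ (hOs h2).1, C.hDbl_act, hbh q hq]

end EncasedHCobordism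
end Choice

/-! ### Smooth inverses, checked on pieces -/

section InverseCover

variable {F F' H H' X Y : Type*} [NormedAddCommGroup F] [NormedSpace ℝ F] [FiniteDimensional ℝ F]
  [NormedAddCommGroup F'] [NormedSpace ℝ F'] [FiniteDimensional ℝ F']
  [TopologicalSpace H] [TopologicalSpace H'] {I : ModelWithCorners ℝ F H}
  {I' : ModelWithCorners ℝ F' H'} [TopologicalSpace X] [ChartedSpace H X] [IsManifold I ∞ X]
  [TopologicalSpace Y] [ChartedSpace H' Y] [IsManifold I' ∞ Y]

theorem continuousOn_of_closed_cover {f : X → Y} {s T T' : Set X} (hs : s ⊆ T ∪ T')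
    (hT : IsClosed T) (hT' : IsClosed T') (h : ContinuousOn f (s ∩ T))
    (h' : ContinuousOn f (s ∩ T')) : ContinuousOn f s := by
  have key : ∀ {A : Set X}, IsClosed A → ContinuousOn f (s ∩ A) → ∀ x ∈ s,
      ContinuousWithinAt f (s ∩ A) x := by
    intro A hA hf x hx
    by_cases hxA : x ∈ A
    · exact hf x ⟨hx, hxA⟩
    · exact continuousWithinAt_of_notMem_closure fun hc ↦
        hxA (closure_minimal inter_subset_right hA hc)
  intro x hx
  refine ((key hT h x hx).union (key hT' h' x hx)).mono fun y hy ↦ ?_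
  rw [← inter_union_distrib_left]
  exact ⟨hy, hs hy⟩

/-- The inverse of a smooth local homeomorphism is smooth if it is smooth separately on pieces with
unique derivatives that cover its domain. -/
theorem contMDiffOn_symm_of_cover (hd : Module.finrank ℝ F = Module.finrank ℝ F')
    {Θ : OpenPartialHomeomorph X Y} (hΘ : ContMDiffOn I I' ∞ Θ Θ.source) {ι : Type*}
    {T : ι → Set Y} (hT : ∀ i, UniqueMDiffOn I' (Θ.target ∩ T i)) (hcov : Θ.target ⊆ ⋃ i, T i)
    (hs : ∀ i, ContMDiffOn I' I ∞ Θ.symm (Θ.target ∩ T i)) :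
    ContMDiffOn I' I ∞ Θ.symm Θ.target := by
  intro y₀ hy₀
  set x₀ := Θ.symm y₀ with hx₀
  set φ := extChartAt I x₀ with hφ
  set ψ := extChartAt I' y₀ with hψ
  set S : Set X := Θ.source ∩ Θ ⁻¹' ψ.source with hS
  set T' : Set Y := Θ.target ∩ Θ.symm ⁻¹' φ.source with hT'
  have hSo : IsOpen S := Θ.continuousOn.isOpen_inter_preimage Θ.open_source
    (isOpen_extChartAt_source y₀)
  have hTo : IsOpen T' := Θ.symm.continuousOn.isOpen_inter_preimage Θ.open_target
    (isOpen_extChartAt_source x₀)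
  set s := φ.target ∩ φ.symm ⁻¹' S with hsdef
  set t := ψ.target ∩ ψ.symm ⁻¹' T' with htdef
  set f : F → F' := fun x ↦ ψ (Θ (φ.symm x)) with hf
  set g : F' → F := fun y ↦ φ (Θ.symm (ψ.symm y)) with hg
  have hφc : ContMDiffOn I 𝓘(ℝ, F) ∞ φ φ.source := by
    rw [hφ, extChartAt_source]; exact contMDiffOn_extChartAt
  have hψc : ContMDiffOn I' 𝓘(ℝ, F') ∞ ψ ψ.source := by
    rw [hψ, extChartAt_source]; exact contMDiffOn_extChartAt
  have hfs : ContDiffOn ℝ ∞ f s := by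
    rw [← contMDiffOn_iff_contDiffOn]
    exact hψc.comp (hΘ.comp ((contMDiffOn_extChartAt_symm x₀).mono inter_subset_left)
      fun x hx ↦ hx.2.1) fun x hx ↦ hx.2.2
  have hgT : ∀ i, ContDiffOn ℝ ∞ g (ψ.target ∩ ψ.symm ⁻¹' (T' ∩ T i)) := fun i ↦ by
    rw [← contMDiffOn_iff_contDiffOn]
    exact hφc.comp ((hs i).comp ((contMDiffOn_extChartAt_symm y₀).mono inter_subset_left)
      fun x hx ↦ ⟨hx.2.1.1, hx.2.2⟩) fun x hx ↦ hx.2.1.2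
  have hgc : ContinuousOn g t :=
    (continuousOn_extChartAt x₀).comp (Θ.symm.continuousOn.comp
      ((continuousOn_extChartAt_symm y₀).mono inter_subset_left) fun x hx ↦ hx.2.1)
      fun x hx ↦ hx.2.2
  have hgm : MapsTo g t s := fun y hy ↦ by
    obtain ⟨hy1, hy2, hy3⟩ := hy
    refine ⟨φ.map_source hy3, ?_⟩
    rw [mem_preimage, hg]
    dsimp only
    rw [φ.left_inv hy3]
    refine ⟨Θ.map_target hy2, ?_⟩
    rw [mem_preimage, Θ.right_inv hy2]
    exact ψ.map_target hy1
  have hfg : ∀ y ∈ t, f (g y) = y := fun y hy ↦ by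
    simp only [hf, hg]
    rw [φ.left_inv hy.2.2, Θ.right_inv hy.2.1, ψ.right_inv hy.1]
  have hsu : UniqueDiffOn ℝ s := hSo.uniqueMDiffOn.uniqueDiffOn_target_inter x₀
  have htu : UniqueDiffOn ℝ t := hTo.uniqueMDiffOn.uniqueDiffOn_target_inter y₀
  -- Only derivatives of `g` along a piece are available. There `f ∘ g = id` gives `f' g' = id`, so
  -- `f'` is surjective, and it is invertible because the dimensions agree. The conclusion no longer
  -- refers to the piece.
  have hinv : ∀ x ∈ g '' t, (fderivWithin ℝ f s x).IsInvertible := by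
    rintro _ ⟨y, hy, rfl⟩
    obtain ⟨i, hi⟩ := mem_iUnion.1 (hcov hy.2.1)
    set ti := ψ.target ∩ ψ.symm ⁻¹' (T' ∩ T i) with hti
    have hyi : y ∈ ti := ⟨hy.1, hy.2, hi⟩
    have hsub : ti ⊆ t := fun z hz ↦ ⟨hz.1, hz.2.1⟩
    have hui : UniqueDiffWithinAt ℝ ti y := by
      refine UniqueMDiffOn.uniqueDiffOn_target_inter ?_ y₀ y hyi
      have : T' ∩ T i = (Θ.target ∩ T i) ∩ T' := by
        rw [hT']; ext z; simp only [mem_inter_iff]; tauto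
      rw [this]
      exact (hT i).inter hTo
    have h1 : HasFDerivWithinAt f (fderivWithin ℝ f s (g y)) s (g y) :=
      (hfs.differentiableOn (by simp) _ (hgm hy)).hasFDerivWithinAt
    have h2 : HasFDerivWithinAt g (fderivWithin ℝ g ti y) ti y :=
      ((hgT i).differentiableOn (by simp) _ hyi).hasFDerivWithinAt
    have h3 := h1.comp y h2 (hgm.mono_left hsub)
    have h4 : HasFDerivWithinAt (f ∘ g) (ContinuousLinearMap.id ℝ F') ti y :=
      (hasFDerivWithinAt_id y ti).congr (fun z hz ↦ hfg z (hsub hz)) (hfg y hy)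
    have h5 := hui.eq h3 h4
    have hsurj : Function.Surjective (fderivWithin ℝ f s (g y)) := fun v ↦
      ⟨_, by simpa using congrArg (fun A : F' →L[ℝ] F' ↦ A v) h5⟩
    have hbij : Function.Injective (fderivWithin ℝ f s (g y)) :=
      (LinearMap.injective_iff_surjective_of_finrank_eq_finrank
        (f := (fderivWithin ℝ f s (g y)).toLinearMap) hd).2 hsurj
    exact ⟨(LinearEquiv.ofBijective (fderivWithin ℝ f s (g y)).toLinearMap
      ⟨hbij, hsurj⟩).toContinuousLinearEquiv, by ext v; rfl⟩
  have hmain := contDiffOn_of_rightInverse hsu htu hfs hgc hgm hfg hinv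
  have hN : T' ∩ ψ.source ∈ 𝓝 y₀ :=
    (hTo.inter (isOpen_extChartAt_source y₀)).mem_nhds
      ⟨⟨hy₀, mem_extChartAt_source x₀⟩, mem_extChartAt_source y₀⟩
  have h6 : ContMDiffOn I' I ∞ (fun y ↦ φ.symm (g (ψ y))) (T' ∩ ψ.source) := by
    refine (contMDiffOn_extChartAt_symm x₀).comp ((contMDiffOn_iff_contDiffOn.2 hmain).comp
      (hψc.mono inter_subset_right) fun y hy ↦ ?_) fun y hy ↦ ?_
    · exact ⟨ψ.map_source hy.2, by rw [mem_preimage, ψ.left_inv hy.2]; exact hy.1⟩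
    · change φ (Θ.symm (ψ.symm (ψ y))) ∈ φ.target
      rw [ψ.left_inv hy.2]
      exact φ.map_source hy.1.2
  refine ((h6.contMDiffAt hN).congr_of_eventuallyEq ?_).contMDiffWithinAt
  filter_upwards [hN] with y hy
  simp only [hg]
  rw [ψ.left_inv hy.2, φ.left_inv hy.1.2]

end InverseCover

/-! ### Product structures near the sides, from the lower collar -/

section Sides

variable {G : Type uG} [Group G] {m k : ℕ}
  {M : Type uM} [TopologicalSpace M] [ChartedSpace (EuclideanQuadrant m) M] [MulAction G M]
  {N : Type uN} [TopologicalSpace N] [ChartedSpace (EuclideanQuadrant m) N] [MulAction G N]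
  {W : Type uW} [TopologicalSpace W] [ChartedSpace (EuclideanQuadrant (m + 1)) W] [MulAction G W]
  {E : Type uE} [TopologicalSpace E] [ChartedSpace (EuclideanQuadrant (m + k)) E] [MulAction G E]
  (C : EncasedHCobordism G m M N W)

namespace EncasedHCobordism

/-- A point of the interval `[-1,0]`. -/
def negAbs (s : ℝ) : Icc (-1 : ℝ) 0 := projIcc (-1) 0 (by norm_num) (-|s|)

theorem coe_negAbs {s : ℝ} (hs : |s| ≤ 1) : (negAbs s : ℝ) = -|s| := by
  rw [negAbs, projIcc_of_mem _ ⟨neg_le_neg hs, neg_nonpos.2 (abs_nonneg s)⟩]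

theorem continuous_negAbs : Continuous negAbs := continuous_projIcc.comp (by fun_prop)

/-- The point `0` of the interval `[-1,0]`. -/
def zeroIcc : Icc (-1 : ℝ) 0 := ⟨0, by norm_num⟩

theorem h_fold (x : C.Dbl) : C.h (C.fold x) = -|C.hDbl x| := by
  obtain ⟨a, w, rfl⟩ := C.exists_half x
  have := (C.h_mem w).2
  rw [C.fold_half, hDbl_half]
  cases a
  · simp [abs_of_nonpos this]
  · simp [abs_of_nonpos this]

theorem half_fold (x : C.Dbl) : C.half (decide (0 < C.hDbl x)) (C.fold x) = x := by
  by_cases hx : 0 < C.hDbl x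
  · obtain ⟨a, w, rfl⟩ := C.exists_half x
    cases a
    · rw [C.hDbl_half_false] at hx
      exact absurd hx (not_lt.2 (C.h_mem w).2)
    · simp [hx, C.fold_half]
  · simp only [hx, decide_false]
    exact C.half_false_fold (not_lt.1 hx)

variable {C} in
-- On the core the encasing function inverts the collar, so a point is recovered from its retraction
-- and its height.
theorem collar_eq_of_mem_collarNhd {w : W} (hw : w ∈ collarNhd C) {s : Icc (-1 : ℝ) 0}
    (hs : (s : ℝ) = C.h w) : (C.r w, s) ∈ C.core ∧ C.collar (C.r w, s) = w := by
  obtain ⟨q, hq, rfl⟩ := hw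
  obtain ⟨h1, h2, h3⟩ := mem_core hq
  have : (C.r (C.collar q), s) = q := Prod.ext h2 (Subtype.ext (hs.trans h3))
  rw [this]
  exact ⟨hq, rfl⟩

variable {C} in
theorem collar_zero_mem_top {y : M} (hy : (y, zeroIcc) ∈ C.core) :
    C.collar (y, zeroIcc) ∈ range C.top :=
  (C.h_eq_zero_iff _).1 (mem_core hy).2.2

/-- The inverse of the product structure of the double induced by the lower collar. -/
def sideInv (q : N × ℝ) : C.Dbl :=
  C.half (decide (0 < q.2)) (C.collar (C.r (C.top q.1), negAbs q.2))

/-- The target of the product structure of the double induced by the lower collar. -/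
def sideTarget : Set (N × ℝ) :=
  {q | |q.2| < 1 ∧ C.top q.1 ∈ collarNhd C ∧ (C.r (C.top q.1), negAbs q.2) ∈ C.core}

theorem isOpen_sideTarget : IsOpen C.sideTarget := by
  refine (isOpen_lt continuous_snd.abs continuous_const).inter (IsOpen.inter ?_ ?_)
  · exact C.isOpen_collarNhd.preimage (C.contMDiff_top.continuous.comp continuous_fst)
  · exact C.isOpen_core.preimage (((C.r_smooth.continuous.comp
      (C.contMDiff_top.continuous.comp continuous_fst))).prodMk
      (continuous_negAbs.comp continuous_snd))

/-- The halves of `N × ℝ`. -/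
def sideHalf (N : Type*) (a : Bool) : Set (N × ℝ) := univ ×ˢ (if a then Ici 0 else Iic 0)

/-- On one half `-|s|` is `s` or `-s`, so the formula is smooth up to `s = 0` from that side;
smoothness across `s = 0` needs a separate argument. -/
theorem contMDiffOn_sideInv (a : Bool) :
    ContMDiffOn ((corners m).prod 𝓘(ℝ, ℝ)) (corners (m + 1)) ∞ C.sideInv
      (C.sideTarget ∩ sideHalf N a) := by
  have hq : ∀ q ∈ C.sideTarget ∩ sideHalf N a,
      (if a then -q.2 else q.2) = -|q.2| := fun q hq ↦ by
    have h2 := hq.2.2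
    cases a
    · simp only [Bool.false_eq_true, ↓reduceIte] at h2 ⊢
      rw [abs_of_nonpos h2, neg_neg]
    · simp only [↓reduceIte] at h2 ⊢
      rw [abs_of_nonneg h2]
  have hlin : ContMDiff ((corners m).prod 𝓘(ℝ, ℝ)) 𝓘(ℝ, ℝ) ∞
      (fun q : N × ℝ ↦ if a then -q.2 else q.2) := by
    cases a
    · exact contMDiff_snd
    · exact (contDiff_neg.contMDiff (n := ∞)).comp contMDiff_snd
  have h0 : ContMDiffOn ((corners m).prod 𝓘(ℝ, ℝ)) (𝓡∂ 1) ∞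
      (fun q : N × ℝ ↦ negAbs q.2) (C.sideTarget ∩ sideHalf N a) := by
    refine ContMDiffOn.congr (contMDiffOn_projIcc.comp (t := Icc (-1) 0) hlin.contMDiffOn
      fun q hqm ↦ ?_) fun q hqm ↦ ?_
    · rw [mem_preimage, hq q hqm]
      exact ⟨neg_le_neg hqm.1.1.le, neg_nonpos.2 (abs_nonneg _)⟩
    · rw [Function.comp_apply, hq q hqm]
      rfl
  have h1 : ContMDiffOn ((corners m).prod 𝓘(ℝ, ℝ)) (corners (m + 1)) ∞
      (fun q : N × ℝ ↦ C.half a (C.collar (C.r (C.top q.1), negAbs q.2)))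
      (C.sideTarget ∩ sideHalf N a) := by
    refine (C.contMDiff_half a).contMDiffOn.comp (t := univ) (C.collar_smooth.comp
      (ContMDiffOn.prodMk ?_ h0) fun q hqm ↦ (mem_core hqm.1.2.2).1) fun _ _ ↦ mem_univ _
    exact (C.r_smooth.comp (C.contMDiff_top.comp contMDiff_fst)).contMDiffOn
  refine h1.congr fun q hqm ↦ ?_
  rw [sideInv]
  by_cases h4 : q.2 = 0
  · refine Double.half_of_mem _ ?_ _ _
    rw [← C.h_eq_zero_iff, (mem_core hqm.1.2.2).2.2, coe_negAbs (by simp [h4])]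
    simp [h4]
  · have h2 := hqm.2.2
    cases a
    · simp only [Bool.false_eq_true, ↓reduceIte] at h2
      rw [decide_eq_false (not_lt.2 h2)]
    · simp only [↓reduceIte] at h2
      rw [decide_eq_true (lt_of_le_of_ne (mem_Ici.1 h2) (Ne.symm h4))]

theorem sideTarget_subset : C.sideTarget ⊆ sideHalf N false ∪ sideHalf N true := fun q _ ↦ by
  rcases le_total q.2 0 with h | h
  · exact Or.inl ⟨mem_univ _, by simpa using h⟩
  · exact Or.inr ⟨mem_univ _, by simpa using h⟩

theorem continuousOn_sideInv : ContinuousOn C.sideInv C.sideTarget :=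
  continuousOn_of_closed_cover C.sideTarget_subset
    (isClosed_univ.prod (by simpa using isClosed_Iic))
    (isClosed_univ.prod (by simpa using isClosed_Ici))
    (C.contMDiffOn_sideInv false).continuousOn (C.contMDiffOn_sideInv true).continuousOn

/-- The source of the product structure of the double induced by the lower collar. -/
def sideSource : Set C.Dbl :=
  {x | C.fold x ∈ collarNhd C ∧ (C.rDbl x, zeroIcc) ∈ C.core ∧ |C.hDbl x| < 1}

theorem contMDiffOn_side : ContMDiffOn (corners (m + 1)) ((corners m).prod 𝓘(ℝ, ℝ)) ∞
    (fun x : C.Dbl ↦ (C.topInv (C.collar (C.rDbl x, zeroIcc)), C.hDbl x)) C.sideSource := by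
  refine ContMDiffOn.prodMk ?_ C.contMDiff_hDbl.contMDiffOn
  refine C.contMDiffOn_topInv.comp (C.collar_smooth.comp
    (C.contMDiff_rDbl.prodMk contMDiff_const).contMDiffOn fun x hx ↦ (mem_core hx.2.1).1)
    fun x hx ↦ collar_zero_mem_top hx.2.1

theorem collar_zero_r_top {n : N} (hn : C.top n ∈ collarNhd C) :
    (C.r (C.top n), zeroIcc) ∈ C.core ∧ C.collar (C.r (C.top n), zeroIcc) = C.top n :=
  collar_eq_of_mem_collarNhd hn (C.h_top n).symm

/-- The product structure of the double induced by the lower collar. -/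
def sideHomeo : OpenPartialHomeomorph C.Dbl (N × ℝ) where
  toFun x := (C.topInv (C.collar (C.rDbl x, zeroIcc)), C.hDbl x)
  invFun := C.sideInv
  source := C.sideSource
  target := C.sideTarget
  map_source' x hx := by
    have h1 : C.top (C.topInv (C.collar (C.rDbl x, zeroIcc))) = _ :=
      C.top_topInv (collar_zero_mem_top hx.2.1)
    refine ⟨hx.2.2, ?_, ?_⟩
    · rw [h1]; exact ⟨_, hx.2.1, rfl⟩
    · rw [h1, (mem_core hx.2.1).2.1, C.rDbl_eq_fold]
      exact (collar_eq_of_mem_collarNhd hx.1 (by rw [coe_negAbs hx.2.2.le, C.h_fold])).1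
  map_target' q hq := by
    obtain ⟨h1, h2, h3⟩ := mem_core hq.2.2
    refine ⟨⟨_, hq.2.2, rfl⟩, ?_, ?_⟩
    · rw [sideInv, C.rDbl_half, h2]
      exact (C.collar_zero_r_top hq.2.1).1
    · rw [← abs_neg, ← abs_abs, abs_neg, ← abs_neg (|_|), ← C.h_fold, sideInv, C.fold_half, h3,
        coe_negAbs hq.1.le, abs_neg, abs_abs]
      exact hq.1
  left_inv' x hx := by
    have h1 : C.top (C.topInv (C.collar (C.rDbl x, zeroIcc))) = _ :=
      C.top_topInv (collar_zero_mem_top hx.2.1)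
    rw [sideInv]
    dsimp only
    rw [h1, (mem_core hx.2.1).2.1]
    dsimp only
    rw [C.rDbl_eq_fold, (collar_eq_of_mem_collarNhd (s := negAbs (C.hDbl x)) hx.1 (by rw [coe_negAbs hx.2.2.le, C.h_fold])).2,
      C.half_fold]
  right_inv' q hq := by
    obtain ⟨h1, h2, h3⟩ := mem_core hq.2.2
    refine Prod.ext ?_ ?_
    · dsimp only
      rw [sideInv, C.rDbl_half, h2, (C.collar_zero_r_top hq.2.1).2, C.topInv_top]
    · dsimp only
      rw [sideInv, hDbl_half, h3, coe_negAbs hq.1.le]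
      by_cases h : 0 < q.2
      · simp [h, abs_of_pos h]
      · simp [h, abs_of_nonpos (not_lt.1 h)]
  open_source := (C.isOpen_collarNhd.preimage (Double.continuous_fold _)).inter
    ((C.isOpen_core.preimage (C.contMDiff_rDbl.continuous.prodMk continuous_const)).inter
      (isOpen_lt C.contMDiff_hDbl.continuous.abs continuous_const))
  open_target := C.isOpen_sideTarget
  continuousOn_toFun := C.contMDiffOn_side.continuousOn
  continuousOn_invFun := C.continuousOn_sideInv

theorem uniqueMDiffOn_sideHalf (a : Bool) :
    UniqueMDiffOn ((corners m).prod 𝓘(ℝ, ℝ)) (sideHalf N a) := by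
  refine UniqueMDiffOn.prod uniqueMDiffOn_univ (uniqueMDiffOn_iff_uniqueDiffOn.2 ?_)
  cases a
  · simpa using uniqueDiffOn_Iic (0 : ℝ)
  · simpa using uniqueDiffOn_Ici (0 : ℝ)

/-- Points are moved to the top along the collar lines, on which `r` is constant. The first
coordinate depends on `r` alone, hence is invariant under the reflection, and it is equivariant
because the collar is. -/
theorem isTube_sideHomeo [IsManifold (corners m) ∞ N] {n : N} (hn : C.top n ∈ collarNhd C) : C.IsTube n C.sideHomeo where
  mem_source := by
    refine ⟨hn, (C.collar_zero_r_top hn).1, ?_⟩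
    rw [C.hDbl_top]
    norm_num
  smooth := C.contMDiffOn_side
  smooth_symm := by
    -- The inverse is smooth on each closed half; the halves have unique derivatives, so this gives
    -- smoothness across `s = 0`.
    refine contMDiffOn_symm_of_cover (T := sideHalf N) (by simp) C.contMDiffOn_side (fun a ↦ ?_)
      (fun q hq ↦ ?_) C.contMDiffOn_sideInv
    · rw [inter_comm]
      exact (uniqueMDiffOn_sideHalf a).inter C.sideHomeo.open_target
    · rcases C.sideTarget_subset hq with h | h
      · exact mem_iUnion.2 ⟨_, h⟩
      · exact mem_iUnion.2 ⟨_, h⟩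
  snd _ _ := rfl
  fst_top n' hn' := by
    change C.topInv (C.collar (C.r (C.top n'), zeroIcc)) = n'
    rw [(C.collar_zero_r_top hn'.1).2, C.topInv_top]
  fst_flip x _ _ := by
    change C.topInv (C.collar (C.rDbl (C.flip x), zeroIcc)) = _
    rw [C.rDbl_flip]
    rfl
  fst_act g _ x hx _ := by
    change C.topInv (C.collar (C.rDbl (C.act g x), zeroIcc)) =
      g • C.topInv (C.collar (C.rDbl x, zeroIcc))
    obtain ⟨n', hn'⟩ := collar_zero_mem_top hx.2.1
    rw [C.rDbl_act, C.collar_smul g (C.rDbl x, zeroIcc) (mem_core hx.2.1).1, ← hn', ← C.top_smul,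
      C.topInv_top, C.topInv_top]

end EncasedHCobordism
end Sides

/-! ### Equivariant normal form near a fixed point -/

section NormalForm

variable {F : Type*} [NormedAddCommGroup F] [NormedSpace ℝ F] [FiniteDimensional ℝ F]

/-- The inverse function theorem, for a smooth map near a point. -/
theorem exists_openPartialHomeomorph_of_injective {f : F → F} {y₀ : F}
    (hf : ∀ᶠ y in 𝓝 y₀, ContDiffAt ℝ ∞ f y) {L : F →L[ℝ] F} (hL : HasFDerivAt f L y₀)
    (hinj : ∀ v, L v = 0 → v = 0) {O : Set F} (hO : O ∈ 𝓝 y₀) :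
    ∃ Φ : OpenPartialHomeomorph F F, ⇑Φ = f ∧ Φ.source ⊆ O ∧ y₀ ∈ Φ.source ∧
      ContDiffOn ℝ ∞ Φ Φ.source ∧ ContDiffOn ℝ ∞ Φ.symm Φ.target := by
  have : CompleteSpace F := FiniteDimensional.complete ℝ F
  set e : F ≃L[ℝ] F := (LinearEquiv.ofInjectiveEndo L.toLinearMap
    ((injective_iff_map_eq_zero L.toLinearMap).2 hinj)).toContinuousLinearEquiv with he
  have heL : (e : F →L[ℝ] F) = L := by ext v; rfl
  have hc : ContDiffAt ℝ ∞ f y₀ := hf.self_of_nhds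
  have hfd : fderiv ℝ f y₀ = e := by rw [heL]; exact hL.fderiv
  have hcont : ContinuousAt (fderiv ℝ f) y₀ :=
    (hc.fderiv_right (m := 0) (by simp)).continuousAt
  -- Invertibility of the derivative is an open condition; the source is shrunk accordingly, so that
  -- the inverse is smooth on its whole target and not only at one point.
  have hinv : ∀ᶠ y in 𝓝 y₀, ∃ e' : F ≃L[ℝ] F, (e' : F →L[ℝ] F) = fderiv ℝ f y := by
    have := ContinuousLinearEquiv.nhds e
    rw [← hfd] at this
    exact hcont this
  obtain ⟨O', hO', hO'o, hy₀⟩ := mem_nhds_iff.1 (inter_mem hO (hf.and hinv))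
  set Φ₀ := hc.toOpenPartialHomeomorph f (f' := e) (by rw [heL]; exact hL) (by simp) with hΦ₀
  have hcoe : ⇑Φ₀ = f := hc.toOpenPartialHomeomorph_coe (by rw [heL]; exact hL) (by simp)
  have hmem : y₀ ∈ Φ₀.source := hc.mem_toOpenPartialHomeomorph_source (by rw [heL]; exact hL) (by simp)
  refine ⟨Φ₀.restrOpen O' hO'o, hcoe, fun y hy ↦ (hO' hy.2).1, ⟨hmem, hy₀⟩, fun y hy ↦ ?_,
    fun y hy ↦ ?_⟩
  · change ContDiffWithinAt ℝ ∞ Φ₀ _ y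
    rw [hcoe]
    exact (hO' hy.2).2.1.contDiffWithinAt
  · have h1 := (Φ₀.restrOpen O' hO'o).map_target hy
    obtain ⟨-, h2, e', he'⟩ := hO' h1.2
    change ContDiffAt ℝ ∞ f (Φ₀.symm y) at h2
    change _ = fderiv ℝ f (Φ₀.symm y) at he'
    change ContDiffWithinAt ℝ ∞ Φ₀.symm _ y
    refine (Φ₀.contDiffAt_symm (f₀' := e') hy.1 ?_ (by rw [hcoe]; exact h2)).contDiffWithinAt
    rw [hcoe, he']
    exact (h2.differentiableAt (by simp)).hasFDerivAt

variable {Γ : Type*} [Group Γ] [Finite Γ]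

/-- Bochner's linearization, adapted to the reflection `R` and the height `η`. Averaging gives an
equivariant map `A` to the tangent representation, and `q = A + A ∘ R` is also invariant under `R`.
Replacing the `c`-component of `q` by `η` gives `f = q - ℓ(q) c + η c`, which carries the height to
`ℓ` and the reflection to `y ↦ y - 2 ℓ(y) c`. The group identities are assumed, and equivariance is
proved, only near `y₀`. -/
theorem exists_equivariant_normalForm {y₀ : F} {a : Γ → F → F} {R : F → F} {η : F → ℝ}
    (ha : ∀ g, ∀ᶠ y in 𝓝 y₀, ContDiffAt ℝ ∞ (a g) y) (hR : ∀ᶠ y in 𝓝 y₀, ContDiffAt ℝ ∞ R y)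
    (hη : ∀ᶠ y in 𝓝 y₀, ContDiffAt ℝ ∞ η y) (ha0 : ∀ g, a g y₀ = y₀) (hR0 : R y₀ = y₀)
    (hmul : ∀ g g', ∀ᶠ y in 𝓝 y₀, a (g * g') y = a g (a g' y)) (hone : ∀ᶠ y in 𝓝 y₀, a 1 y = y)
    (haR : ∀ g, ∀ᶠ y in 𝓝 y₀, a g (R y) = R (a g y)) (hRR : ∀ᶠ y in 𝓝 y₀, R (R y) = y)
    (hηa : ∀ g, ∀ᶠ y in 𝓝 y₀, η (a g y) = η y) (hηR : ∀ᶠ y in 𝓝 y₀, η (R y) = -η y)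
    (hℓ : fderiv ℝ η y₀ ≠ 0) (hRk : ∀ v, fderiv ℝ η y₀ v = 0 → fderiv ℝ R y₀ v = v)
    {O : Set F} (hO : O ∈ 𝓝 y₀) :
    ∃ (Φ : OpenPartialHomeomorph F F) (ρ : Γ → F →L[ℝ] F) (ℓ : F →L[ℝ] ℝ) (c : F),
      Φ.source ⊆ O ∧ y₀ ∈ Φ.source ∧
      ContDiffOn ℝ ∞ Φ Φ.source ∧ ContDiffOn ℝ ∞ Φ.symm Φ.target ∧ ℓ c = 1 ∧
      (∀ g, ρ g c = c) ∧ (∀ y, ℓ (Φ y) = η y) ∧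
      ∀ᶠ y in 𝓝 y₀, (∀ g, Φ (a g y) = ρ g (Φ y)) ∧ Φ (R y) = Φ y - (2 * η y) • c := by
  have := Fintype.ofFinite Γ
  set ℓ := fderiv ℝ η y₀ with hℓdef
  set R' := fderiv ℝ R y₀ with hR'
  set ρ : Γ → F →L[ℝ] F := fun g ↦ fderiv ℝ (a g) y₀ with hρ
  have hda : ∀ g, HasFDerivAt (a g) (ρ g) y₀ := fun g ↦
    ((ha g).self_of_nhds.differentiableAt (by simp)).hasFDerivAt
  have hdR : HasFDerivAt R R' y₀ := (hR.self_of_nhds.differentiableAt (by simp)).hasFDerivAt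
  have hdη : HasFDerivAt η ℓ y₀ := (hη.self_of_nhds.differentiableAt (by simp)).hasFDerivAt
  have hta : ∀ g, Tendsto (a g) (𝓝 y₀) (𝓝 y₀) := fun g ↦ by
    have := (hda g).continuousAt.tendsto
    rwa [ha0] at this
  have htR : Tendsto R (𝓝 y₀) (𝓝 y₀) := by
    have := hdR.continuousAt.tendsto
    rwa [hR0] at this
  have hρmul : ∀ g g', ρ (g * g') = (ρ g).comp (ρ g') := fun g g' ↦ by
    have h1 : HasFDerivAt (a g) (ρ g) (a g' y₀) := by rw [ha0]; exact hda g
    have h2 := (h1.comp y₀ (hda g')).congr_of_eventuallyEq (hmul g g')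
    exact (hda (g * g')).unique h2
  have hρone : ρ 1 = ContinuousLinearMap.id ℝ F :=
    (hda 1).unique ((hasFDerivAt_id y₀).congr_of_eventuallyEq hone)
  have hℓρ : ∀ g v, ℓ (ρ g v) = ℓ v := fun g v ↦ by
    have h1 : HasFDerivAt η ℓ (a g y₀) := by rw [ha0]; exact hdη
    have h2 := hdη.unique ((h1.comp y₀ (hda g)).congr_of_eventuallyEq
      ((hηa g).mono fun y hy ↦ hy.symm))
    exact (congrArg (fun A : F →L[ℝ] ℝ ↦ A v) h2).symm
  set N : ℝ := (Fintype.card Γ : ℝ) with hN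
  have hN0 : N ≠ 0 := by simp [hN]
  obtain ⟨c₀, hc₀⟩ : ∃ c₀, ℓ c₀ = 1 := by
    obtain ⟨v, hv⟩ : ∃ v, ℓ v ≠ 0 := by
      by_contra! h
      exact hℓ (ContinuousLinearMap.ext h)
    exact ⟨(ℓ v)⁻¹ • v, by simp [hv]⟩
  -- Averaging makes the vector invariant, and invariance of `ℓ` keeps its height equal to `1`.
  set c : F := N⁻¹ • ∑ g, ρ g c₀ with hc
  have hℓc : ℓ c = 1 := by
    simp only [hc, map_smul, map_sum, hℓρ, hc₀, Finset.sum_const, Finset.card_univ]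
    simp [hN]
  have hρc : ∀ g, ρ g c = c := fun g ↦ by
    simp only [hc, map_smul, map_sum]
    congr 1
    refine Fintype.sum_equiv (Equiv.mulLeft g) _ _ fun g' ↦ ?_
    rw [Equiv.coe_mulLeft, hρmul]
    rfl
  set A : F → F := fun y ↦ ∑ g, ρ g⁻¹ (a g y - y₀) with hA
  have hAa : ∀ h, ∀ᶠ y in 𝓝 y₀, A (a h y) = ρ h (A y) := fun h ↦ by
    filter_upwards [eventually_all.2 fun g ↦ hmul g h] with y hy
    simp only [hA, map_sum]
    refine Fintype.sum_equiv (Equiv.mulRight h) _ _ fun g ↦ ?_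
    rw [Equiv.coe_mulRight, hy g, mul_inv_rev, ← ContinuousLinearMap.comp_apply, ← hρmul,
      mul_inv_cancel_left]
  have hAc : ∀ᶠ y in 𝓝 y₀, ContDiffAt ℝ ∞ A y := by
    filter_upwards [eventually_all.2 ha] with y hy
    exact ContDiffAt.sum fun g _ ↦ (ρ g⁻¹).contDiff.contDiffAt.comp y ((hy g).sub contDiffAt_const)
  have hAd : HasFDerivAt A (N • ContinuousLinearMap.id ℝ F) y₀ := by
    have h1 : HasFDerivAt A (∑ g, (ρ g⁻¹).comp (ρ g)) y₀ :=
      HasFDerivAt.fun_sum fun g _ ↦ (ρ g⁻¹).hasFDerivAt.comp y₀ ((hda g).sub_const y₀)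
    convert h1 using 1
    simp only [← hρmul, inv_mul_cancel, hρone, Finset.sum_const, Finset.card_univ, hN]
    rw [Nat.cast_smul_eq_nsmul]
  set q : F → F := fun y ↦ A y + A (R y) with hq
  have hqc : ∀ᶠ y in 𝓝 y₀, ContDiffAt ℝ ∞ q y := by
    filter_upwards [hAc, hR, htR.eventually hAc] with y h1 h2 h3
    exact h1.add (h3.comp y h2)
  have hqd : HasFDerivAt q (N • (ContinuousLinearMap.id ℝ F + R')) y₀ := by
    have h1 : HasFDerivAt A (N • ContinuousLinearMap.id ℝ F) (R y₀) := by rw [hR0]; exact hAd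
    have h2 : N • (ContinuousLinearMap.id ℝ F + R') =
        N • ContinuousLinearMap.id ℝ F + (N • ContinuousLinearMap.id ℝ F).comp R' := by
      ext v; simp
    rw [h2]
    exact hAd.add (h1.comp y₀ hdR)
  have hqa : ∀ h, ∀ᶠ y in 𝓝 y₀, q (a h y) = ρ h (q y) := fun h ↦ by
    filter_upwards [hAa h, htR.eventually (hAa h), haR h] with y h1 h2 h3
    simp only [hq, map_add, h1, ← h3, h2]
  have hqR : ∀ᶠ y in 𝓝 y₀, q (R y) = q y := by
    filter_upwards [hRR] with y h1
    simp only [hq, h1, add_comm]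
  set f : F → F := fun y ↦ q y - ℓ (q y) • c + η y • c with hf
  have hfc : ∀ᶠ y in 𝓝 y₀, ContDiffAt ℝ ∞ f y := by
    filter_upwards [hqc, hη] with y h1 h2
    exact (h1.sub ((ℓ.contDiff.contDiffAt.comp y h1).smul contDiffAt_const)).add
      (h2.smul contDiffAt_const)
  have hfd : HasFDerivAt f (N • (ContinuousLinearMap.id ℝ F + R') -
      (ℓ.comp (N • (ContinuousLinearMap.id ℝ F + R'))).smulRight c + ℓ.smulRight c) y₀ :=
    (hqd.sub ((ℓ.hasFDerivAt.comp y₀ hqd).smul_const c)).add (hdη.smul_const c)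
  have hℓf : ∀ y, ℓ (f y) = η y := fun y ↦ by simp [hf, hℓc]
  -- If `f' v = 0`, applying `ℓ` gives `ℓ v = 0`. On `ker ℓ` the derivative of the reflection is the
  -- identity, so `f'` is multiplication by `2N` there.
  have hinj : ∀ v, (N • (ContinuousLinearMap.id ℝ F + R') -
      (ℓ.comp (N • (ContinuousLinearMap.id ℝ F + R'))).smulRight c + ℓ.smulRight c) v = 0 →
      v = 0 := by
    intro v hv
    have h1 : ℓ v = 0 := by
      have := congrArg ℓ hv
      simpa [hℓc] using this
    have h2 := hRk v h1
    simp only [add_apply, sub_apply, smul_apply, ContinuousLinearMap.id_apply,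
      ContinuousLinearMap.smulRight_apply, ContinuousLinearMap.comp_apply, h2, map_smul, map_add,
      h1, add_zero, smul_zero, zero_smul, sub_zero] at hv
    rw [smul_eq_zero, or_iff_right hN0, ← two_smul ℝ, smul_eq_zero] at hv
    exact hv.resolve_left two_ne_zero
  obtain ⟨Φ, hΦ, hΦO, hΦ0, hΦs, hΦt⟩ := exists_openPartialHomeomorph_of_injective hfc hfd
    hinj hO
  refine ⟨Φ, ρ, ℓ, c, hΦO, hΦ0, hΦs, hΦt, hℓc, hρc, by rw [hΦ]; exact hℓf, ?_⟩
  rw [hΦ]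
  filter_upwards [eventually_all.2 hqa, hqR, eventually_all.2 hηa, hηR] with y h1 h2 h3 h4
  constructor
  · intro g
    simp only [hf, h1, h3, map_add, map_sub, map_smul, hℓρ, hρc]
  · simp only [hf, h2, h4]
    module

end NormalForm

/-! ### Charts and derivatives on manifolds with corners -/

section Quadrant

variable {d : ℕ} {X : Type*} [TopologicalSpace X] [ChartedSpace (EuclideanQuadrant d) X]

theorem mem_range_corners {y : EuclideanSpace ℝ (Fin d)} : y ∈ range (corners d) ↔ ∀ i, 0 ≤ y i :=
  ⟨by rintro ⟨x, rfl⟩; exact x.2, fun h ↦ ⟨⟨y, h⟩, rfl⟩⟩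

/-- Where all coordinates are positive, a chart is a diffeomorphism to Euclidean space. -/
theorem exists_interior_chart [IsManifold (corners d) ∞ X] {p : X} (hp : ∀ j, 0 < (chartAt (EuclideanQuadrant d) p p).1 j) :
    ∃ Ψ : OpenPartialHomeomorph X (EuclideanSpace ℝ (Fin d)), p ∈ Ψ.source ∧
      ContMDiffOn (corners d) 𝓘(ℝ, EuclideanSpace ℝ (Fin d)) ∞ Ψ Ψ.source ∧
      ContMDiffOn 𝓘(ℝ, EuclideanSpace ℝ (Fin d)) (corners d) ∞ Ψ.symm Ψ.target := by
  have ho : IsOpen {y : EuclideanSpace ℝ (Fin d) | ∀ i, 0 < y i} := by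
    simp only [ofPred_forall]
    exact isOpen_iInter_of_finite fun i ↦ isOpen_lt continuous_const (by fun_prop)
  set c : OpenPartialHomeomorph (EuclideanQuadrant d) (EuclideanSpace ℝ (Fin d)) :=
    { toFun := corners d
      invFun := (corners d).symm
      source := {x | ∀ i, 0 < x.1 i}
      target := {y | ∀ i, 0 < y i}
      map_source' := fun x hx ↦ hx
      map_target' := fun y hy i ↦ by
        have : corners d ((corners d).symm y) = y :=
          (corners d).right_inv (mem_range_corners.2 fun i ↦ (hy i).le)
        rw [corners_apply] at this
        rw [this]
        exact hy i
      left_inv' := fun x _ ↦ (corners d).left_inv x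
      right_inv' := fun y hy ↦ (corners d).right_inv (mem_range_corners.2 fun i ↦ (hy i).le)
      open_source := ho.preimage continuous_subtype_val
      open_target := ho
      continuousOn_toFun := (corners d).continuous.continuousOn
      continuousOn_invFun := (corners d).continuous_symm.continuousOn } with hc
  refine ⟨chartAt _ p ≫ₕ c, ⟨mem_chart_source _ p, hp⟩, ?_, ?_⟩
  · exact (corners d).contMDiff.comp_contMDiffOn
      ((contMDiffOn_chart (x := p)).mono fun x hx ↦ hx.1)
  · exact (contMDiffOn_chart_symm (x := p)).comp ((corners d).contMDiffOn_symm.mono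
      fun y hy ↦ mem_range_corners.2 fun i ↦ (hy.1 i).le) fun y hy ↦ hy.2

theorem mem_boundary_of_chart_eq_zero [IsManifold (corners d) ∞ X] {x y : X}
    (hy : y ∈ (chartAt (EuclideanQuadrant d) x).source) {j : Fin d}
    (hj : (chartAt (EuclideanQuadrant d) x y).1 j = 0) : y ∈ (corners d).boundary X := by
  change (corners d).IsBoundaryPoint y
  rw [← not_not (a := (corners d).IsBoundaryPoint y),
    ← ModelWithCorners.isInteriorPoint_iff_not_isBoundaryPoint,
    (corners d).isInteriorPoint_iff_of_mem_atlas (n := ∞) (by simp) (chart_mem_atlas _ x) hy]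
  intro h
  have h1 : ((chartAt (EuclideanQuadrant d) x).extend (corners d)) y ∈
      interior {y : EuclideanSpace ℝ (Fin d) | ∀ i, 0 ≤ y i} := by
    refine interior_mono (fun z hz ↦ ?_) h
    rw [OpenPartialHomeomorph.extend_target_eq_image_source] at hz
    obtain ⟨w, -, rfl⟩ := hz
    exact fun i ↦ (chartAt (EuclideanQuadrant d) x w).2 i
  rw [interior_euclideanQuadrant] at h1
  exact absurd hj (h1 j).ne'

/-- At a point where only the `i`-th coordinate vanishes, the derivative of a nonnegative function
that vanishes at the point is a nonnegative multiple of the `i`-th coordinate. -/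
theorem exists_mfderiv_eq_of_nonneg {x : X} {i : Fin d}
    (hx0 : (chartAt (EuclideanQuadrant d) x x).1 i = 0)
    (hx : ∀ j ≠ i, 0 < (chartAt (EuclideanQuadrant d) x x).1 j) {u : X → ℝ}
    {L : EuclideanSpace ℝ (Fin d) →L[ℝ] ℝ} (hu : HasMFDerivAt (corners d) 𝓘(ℝ, ℝ) u x L)
    (hu0 : u x = 0) (hnn : ∀ y, 0 ≤ u y) : ∃ a, 0 ≤ a ∧ ∀ v, L v = a * v i := by
  have h1 : HasFDerivWithinAt (writtenInExtChartAt (corners d) 𝓘(ℝ, ℝ) x u) L (range (corners d))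
      (extChartAt (corners d) x x) := hu.2
  have hmin : IsLocalMinOn (writtenInExtChartAt (corners d) 𝓘(ℝ, ℝ) x u) (range (corners d))
      (extChartAt (corners d) x x) := by
    refine Eventually.of_forall fun y ↦ ?_
    simp only [writtenInExtChartAt, extChartAt_model_space_eq_id, PartialEquiv.refl_coe,
      Function.comp_apply, id_eq, extChartAt_to_inv, hu0]
    exact hnn _
  -- If `v i ≥ 0`, moving in the direction `v` stays in the quadrant for a short time, because the
  -- other coordinates are positive at `x`. The minimum at `x` then gives the sign of `L v`.
  have hpos : ∀ v : EuclideanSpace ℝ (Fin d), 0 ≤ v i → 0 ≤ L v := by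
    intro v hv
    refine hmin.hasFDerivWithinAt_nonneg h1 (mem_posTangentConeAt_of_frequently_mem ?_)
    refine Eventually.frequently ?_
    have h2 : ∀ j, ∀ᶠ t : ℝ in 𝓝[>] 0, 0 ≤ (extChartAt (corners d) x x + t • v) j := by
      intro j
      by_cases hj : j = i
      · subst hj
        filter_upwards [self_mem_nhdsWithin] with t ht
        have : (extChartAt (corners d) x x) j = 0 := hx0
        simp only [PiLp.add_apply, PiLp.smul_apply, this, zero_add, smul_eq_mul]
        exact mul_nonneg (le_of_lt ht) hv
      · have h3 : ContinuousAt (fun t : ℝ ↦ (extChartAt (corners d) x x + t • v) j) 0 := by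
          fun_prop
        have h4 : 0 < (extChartAt (corners d) x x + (0 : ℝ) • v) j := by
          rw [zero_smul, add_zero]; exact hx j hj
        filter_upwards [nhdsWithin_le_nhds (h3.eventually (lt_mem_nhds h4))] with t ht using ht.le
    filter_upwards [eventually_all.2 h2] with t ht using mem_range_corners.2 ht
  -- Positivity is applied to `±(v - v i eᵢ)`, whose `i`-th coordinate is `0`, so `L` depends on `v
  -- i` only.
  refine ⟨L (EuclideanSpace.single i 1), hpos _ (by simp), fun v ↦ ?_⟩
  have h2 := hpos (v - v i • EuclideanSpace.single i 1) (by simp)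
  have h3 := hpos (v i • EuclideanSpace.single i 1 - v) (by simp)
  rw [map_sub, map_smul, smul_eq_mul] at h2 h3
  linarith

end Quadrant

/-! ### Points of the top away from the sides -/

section Interior

variable {G : Type uG} [Group G] {m k : ℕ}
  {M : Type uM} [TopologicalSpace M] [ChartedSpace (EuclideanQuadrant m) M] [MulAction G M]
  {N : Type uN} [TopologicalSpace N] [ChartedSpace (EuclideanQuadrant m) N] [MulAction G N]
  {W : Type uW} [TopologicalSpace W] [ChartedSpace (EuclideanQuadrant (m + 1)) W] [MulAction G W]
  {E : Type uE} [TopologicalSpace E] [ChartedSpace (EuclideanQuadrant (m + k)) E] [MulAction G E]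
  (C : EncasedHCobordism G m M N W)

namespace EncasedHCobordism

/-- If a second coordinate vanished as well, there would be boundary points arbitrarily close that
lie neither in the top nor in the bottom. The point would then be in the closure of the sides, which
is the collar image of `∂M × [-1,0]` and hence in the collar region. -/
theorem exists_face_of_notMem_collarNhd [IsManifold (corners (m + 1)) ∞ W] {n : N} (hn : C.top n ∉ collarNhd C) :
    ∃ i, (chartAt (EuclideanQuadrant (m + 1)) (C.top n) (C.top n)).1 i = 0 ∧
      ∀ j ≠ i, 0 < (chartAt (EuclideanQuadrant (m + 1)) (C.top n) (C.top n)).1 j := by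
  set x := C.top n with hx
  set e := chartAt (EuclideanQuadrant (m + 1)) x with he
  obtain ⟨i, hi, hface⟩ := C.top_face.2 x (mem_range_self n)
  refine ⟨i, hi, fun j hj ↦ lt_of_le_of_ne ((e x).2 j) fun hj0 ↦ ?_⟩
  have h1 : x ∉ closure ((corners (m + 1)).boundary W \ (range C.bottom ∪ range C.top)) := by
    rw [← C.collar_sides]
    rintro ⟨q, hq, hqx⟩
    exact hn ⟨q, C.mem_core_of_bottom_or_side (Or.inr hq), hqx⟩
  have h2 : ∀ᶠ y in 𝓝 x, y ∉ (corners (m + 1)).boundary W \ (range C.bottom ∪ range C.top) := by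
    filter_upwards [isClosed_closure.isOpen_compl.mem_nhds h1] with y hy hy'
      using hy (subset_closure hy')
  have h3 : ∀ᶠ y in 𝓝 x, y ∉ range C.bottom :=
    C.isClosed_bottom.isOpen_compl.mem_nhds fun h ↦
      disjoint_left.1 C.disjoint h (mem_range_self n)
  -- A curve that leaves the face `i` while keeping the coordinate `j` equal to `0`; the absolute
  -- value keeps it in the quadrant for all parameters.
  set γ : ℝ → EuclideanQuadrant (m + 1) := fun s ↦
    ⟨(e x).1 + |s| • EuclideanSpace.single i 1, fun l ↦ by
      have h1 := (e x).2 l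
      have h2 : 0 ≤ (EuclideanSpace.single i (1 : ℝ)) l := by
        rw [PiLp.single_apply]; split_ifs <;> norm_num
      simp only [PiLp.add_apply, PiLp.smul_apply, smul_eq_mul]
      positivity⟩ with hγ
  have hγ0 : γ 0 = e x := Subtype.ext (by simp [hγ])
  have hγc : Continuous γ := Continuous.subtype_mk (by fun_prop) _
  have hγt : Tendsto γ (𝓝 0) (𝓝 (e x)) := by
    rw [← hγ0]; exact hγc.continuousAt
  have ht : Tendsto (fun s ↦ e.symm (γ s)) (𝓝 0) (𝓝 x) :=
    (e.tendsto_symm (mem_chart_source _ x)).comp hγt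
  have hmem : ∀ᶠ s in 𝓝 (0 : ℝ), γ s ∈ e.target :=
    hγt (e.open_target.mem_nhds (e.map_source (mem_chart_source _ x)))
  have hev : ∀ᶠ s in 𝓝[>] (0 : ℝ), γ s ∈ e.target ∧ _ :=
    (hmem.and ((ht.eventually h2).and ((ht.eventually h3).and
      (ht.eventually hface)))).filter_mono nhdsWithin_le_nhds
  obtain ⟨s, ⟨hs1, hs2, hs3, hs4⟩, hs0⟩ := (hev.and eventually_mem_nhdsWithin).exists
  have hes : e (e.symm (γ s)) = γ s := e.right_inv hs1
  have hbd : e.symm (γ s) ∈ (corners (m + 1)).boundary W := by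
    refine mem_boundary_of_chart_eq_zero (x := x) (j := j) (e.map_target hs1) ?_
    rw [← he, hes]
    simp [hγ, hj, ← hj0]
  have htop : e.symm (γ s) ∈ range C.top := by
    by_contra h
    exact hs2 ⟨hbd, fun h' ↦ h'.elim hs3 h⟩
  have := hs4.1 htop
  rw [← he, hes] at this
  simp only [hγ, PiLp.add_apply, show (e x).1 i = 0 from hi, zero_add, PiLp.smul_apply, PiLp.single_apply,
    if_true, smul_eq_mul, mul_one, abs_eq_zero] at this
  exact (mem_Ioi.1 hs0).ne' this

/-- The folding map is a left inverse that is smooth on the image, so the derivative is an injective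
endomorphism and therefore surjective. -/
theorem exists_hasMFDerivAt_half (a : Bool) (w : W) :
    ∃ T : EuclideanSpace ℝ (Fin (m + 1)) →L[ℝ] EuclideanSpace ℝ (Fin (m + 1)),
      HasMFDerivAt (corners (m + 1)) (corners (m + 1)) (C.half a) w T ∧
        Function.Surjective T := by
  obtain ⟨T, hT⟩ : ∃ T : EuclideanSpace ℝ (Fin (m + 1)) →L[ℝ] EuclideanSpace ℝ (Fin (m + 1)),
      HasMFDerivAt (corners (m + 1)) (corners (m + 1)) (C.half a) w T :=
    ⟨_, ((C.contMDiff_half a).mdifferentiable (by simp) w).hasMFDerivAt⟩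
  refine ⟨T, hT, ?_⟩
  have h2 := ((C.contMDiffOn_fold a).mdifferentiableOn (by simp) _
    (mem_range_self w)).hasMFDerivWithinAt
  have h3 := HasMFDerivWithinAt.comp w h2 hT.hasMFDerivWithinAt (s := univ)
    fun y _ ↦ mem_range_self y
  rw [hasMFDerivWithinAt_univ] at h3
  have h4 := hasMFDerivAt_unique h3 (hasMFDerivAt_id w)
  refine (LinearMap.injective_iff_surjective (f := T.toLinearMap)).1 fun v v' hv ↦ ?_
  have h5 := fun v ↦ congrArg (fun A : EuclideanSpace ℝ (Fin (m + 1)) →L[ℝ]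
    EuclideanSpace ℝ (Fin (m + 1)) ↦ A v) h4
  have h6 := h5 v
  have h7 := h5 v'
  exact h6.symm.trans ((congrArg _ hv).trans h7)

theorem mfderiv_hDbl_ne_zero (n : N) :
    mfderiv (corners (m + 1)) 𝓘(ℝ, ℝ) C.hDbl (C.half false (C.top n)) ≠ 0 := by
  intro h0
  have h1 : HasMFDerivAt (corners (m + 1)) 𝓘(ℝ, ℝ) C.hDbl (C.half false (C.top n)) _ :=
    (C.contMDiff_hDbl.mdifferentiable (by simp) _).hasMFDerivAt
  rw [h0] at h1
  obtain ⟨T, hT, -⟩ := C.exists_hasMFDerivAt_half false (C.top n)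
  have h2 := HasMFDerivAt.comp (C.top n) h1 hT
  have h3 : C.hDbl ∘ C.half false = C.h := funext C.hDbl_half_false
  rw [h3] at h2
  refine C.h_rank n (h2.mfderiv.trans ?_)
  exact ContinuousLinearMap.zero_comp _

/-- Away from the sides, the double has no boundary near the top. -/
theorem chart_pos_of_notMem_collarNhd [IsManifold (corners (m + 1)) ∞ W] {n : N}
    (hn : C.top n ∉ collarNhd C) (j : Fin (m + 1)) :
    0 < (chartAt (EuclideanQuadrant (m + 1)) (C.half false (C.top n))
      (C.half false (C.top n))).1 j := by
  set x := C.top n with hx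
  set p := C.half false x with hp
  set e := chartAt (EuclideanQuadrant (m + 1)) p with he
  obtain ⟨i, hi0, hi⟩ := C.exists_face_of_notMem_collarNhd hn
  refine lt_of_le_of_ne ((e p).2 j) fun hj0 ↦ ?_
  set f : C.Dbl → ℝ := fun y ↦ (e y).1 j with hf
  have hpt : C.half true x = p := C.half_top true false n
  -- derivatives on the double
  set P : EuclideanSpace ℝ (Fin (m + 1)) →L[ℝ] ℝ := EuclideanSpace.proj j with hP
  obtain ⟨D, hD, hDinv⟩ : ∃ D : EuclideanSpace ℝ (Fin (m + 1)) →L[ℝ] EuclideanSpace ℝ (Fin (m + 1)),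
      HasMFDerivAt (corners (m + 1)) 𝓘(ℝ, EuclideanSpace ℝ (Fin (m + 1)))
        (extChartAt (corners (m + 1)) p) p D ∧ D.IsInvertible :=
    ⟨_, (mdifferentiableAt_extChartAt (mem_chart_source _ p)).hasMFDerivAt,
      isInvertible_mfderiv_extChartAt (mem_extChartAt_source p)⟩
  have hfD : HasMFDerivAt (corners (m + 1)) 𝓘(ℝ, ℝ) f p (P.comp D) :=
    HasMFDerivAt.comp p (g := P) (P.hasMFDerivAt) hD
  obtain ⟨L, hL, hL0⟩ : ∃ L : EuclideanSpace ℝ (Fin (m + 1)) →L[ℝ] ℝ,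
      HasMFDerivAt (corners (m + 1)) 𝓘(ℝ, ℝ) C.hDbl p L ∧ L ≠ 0 :=
    ⟨_, (C.contMDiff_hDbl.mdifferentiable (by simp) _).hasMFDerivAt, C.mfderiv_hDbl_ne_zero n⟩
  -- On either half, the coordinate `f` and the height up to sign are nonnegative functions
  -- vanishing at `x`, where `W` has a single face. Both derivatives are therefore nonnegative
  -- multiples of the same coordinate.
  have key : ∀ (a : Bool), C.half a x = p → ∃ c : ℝ, 0 ≤ c ∧
      P.comp D = (if a then c else -c) • L := by
    intro a ha
    obtain ⟨T, hT, hTs⟩ := C.exists_hasMFDerivAt_half a x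
    have h1 : HasMFDerivAt (corners (m + 1)) 𝓘(ℝ, ℝ) (f ∘ C.half a) x ((P.comp D).comp T) :=
      HasMFDerivAt.comp x (by rw [ha]; exact hfD) hT
    have h2 : HasMFDerivAt (corners (m + 1)) 𝓘(ℝ, ℝ) (C.hDbl ∘ C.half a) x (L.comp T) :=
      HasMFDerivAt.comp x (by rw [ha]; exact hL) hT
    obtain ⟨c₁, hc₁, hc₁'⟩ := exists_mfderiv_eq_of_nonneg hi0 hi h1
      (by rw [Function.comp_apply, ha]; exact hj0.symm) fun y ↦ (e _).2 j
    obtain ⟨c₂, hc₂, hc₂'⟩ : ∃ c₂ : ℝ, 0 ≤ c₂ ∧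
        ∀ v, (if a then 1 else -1) * L (T v) = c₂ * v i := by
      cases a
      · have h3 : HasMFDerivAt (corners (m + 1)) 𝓘(ℝ, ℝ) (fun y ↦ -(C.hDbl ∘ C.half false) y) x
            (-(L.comp T)) := h2.neg
        obtain ⟨c, hc, hc'⟩ := exists_mfderiv_eq_of_nonneg hi0 hi h3
          (by rw [Function.comp_apply, C.hDbl_half_false, C.h_top, neg_zero]) fun y ↦ by
            rw [Function.comp_apply, C.hDbl_half_false]; linarith [(C.h_mem y).2]
        exact ⟨c, hc, fun v ↦ by rw [← hc' v]; simp⟩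
      · obtain ⟨c, hc, hc'⟩ := exists_mfderiv_eq_of_nonneg hi0 hi h2
          (by rw [Function.comp_apply, hDbl_half]; simp [C.h_top]) fun y ↦ by
            rw [Function.comp_apply, hDbl_half]; simp [(C.h_mem y).2]
        exact ⟨c, hc, fun v ↦ by rw [← hc' v, if_pos rfl, one_mul]; rfl⟩
    have hc₂0 : c₂ ≠ 0 := fun h0 ↦ hL0 (by
      ext w
      obtain ⟨v, rfl⟩ := hTs w
      have := hc₂' v
      rw [h0, zero_mul] at this
      cases a <;> simpa using this)
    refine ⟨c₁ / c₂, div_nonneg hc₁ hc₂, ?_⟩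
    ext w
    obtain ⟨v, rfl⟩ := hTs w
    have h3 : P (D (T v)) = c₁ * v i := hc₁' v
    have h4 := hc₂' v
    change P (D (T v)) = (if a then c₁ / c₂ else -(c₁ / c₂)) * L (T v)
    rw [h3]
    cases a
    · simp only [Bool.false_eq_true, ↓reduceIte] at h4 ⊢
      have : L (T v) = -(c₂ * v i) := by linarith
      rw [this]; field_simp
    · simp only [↓reduceIte] at h4 ⊢
      have : L (T v) = c₂ * v i := by linarith
      rw [this]; field_simp
  obtain ⟨c, hc, hc'⟩ := key false rfl
  obtain ⟨c₂, hc₂, hc₂'⟩ := key true hpt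
  simp only [Bool.false_eq_true, ↓reduceIte] at hc' hc₂'
  obtain ⟨v, hv⟩ : ∃ v, L v ≠ 0 := by
    by_contra! h
    exact hL0 (ContinuousLinearMap.ext h)
  -- The two halves give `df = -c dh` and `df = c₂ dh` with `c, c₂ ≥ 0`. Hence `df = 0`, which is
  -- impossible for a coordinate of a chart.
  have h1 : -c * L v = c₂ * L v :=
    congrArg (fun A : EuclideanSpace ℝ (Fin (m + 1)) →L[ℝ] ℝ ↦ A v) (hc'.symm.trans hc₂')
  have h2 := mul_right_cancel₀ hv h1
  have h3 : c = 0 := by linarith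
  rw [h3, neg_zero, zero_smul] at hc'
  obtain ⟨D', rfl⟩ := hDinv
  have h4 := congrArg (fun A : EuclideanSpace ℝ (Fin (m + 1)) →L[ℝ] ℝ ↦
    A (D'.symm (EuclideanSpace.single j 1))) hc'
  simp [hP] at h4

end EncasedHCobordism
end Interior

/-! ### Existence of equivariant choices -/

section Tubes

variable {G : Type uG} [Group G] {m k : ℕ}
  {M : Type uM} [TopologicalSpace M] [ChartedSpace (EuclideanQuadrant m) M] [MulAction G M]
  {N : Type uN} [TopologicalSpace N] [ChartedSpace (EuclideanQuadrant m) N] [MulAction G N]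
  {W : Type uW} [TopologicalSpace W] [ChartedSpace (EuclideanQuadrant (m + 1)) W] [MulAction G W]
  {E : Type uE} [TopologicalSpace E] [ChartedSpace (EuclideanQuadrant (m + k)) E] [MulAction G E]
  (C : EncasedHCobordism G m M N W)

namespace EncasedHCobordism

theorem half_top_topInv_fold {y : C.Dbl} (hy : C.hDbl y = 0) :
    C.half false (C.top (C.topInv (C.fold y))) = y := by
  obtain ⟨n', rfl⟩ := C.exists_top_of_hDbl hy
  rw [C.fold_half, C.topInv_top]

/-- The zero level is contained in the lower half, where the folding map is smooth. -/
theorem contMDiffOn_topInv_fold :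
    ContMDiffOn (corners (m + 1)) (corners m) ∞ (fun y ↦ C.topInv (C.fold y))
      {y | C.hDbl y = 0} := by
  refine C.contMDiffOn_topInv.comp ((C.contMDiffOn_fold false).mono fun y hy ↦ ?_)
    fun y hy ↦ C.fold_mem_top hy
  exact ⟨_, C.half_top_topInv_fold hy⟩

variable {F : Type*} [NormedAddCommGroup F] [NormedSpace ℝ F]

/-- An equivariant map to a linear representation, one of whose linear functionals is the height,
yields a product structure. -/
theorem exists_isTube_of_linear {n : N} {Ξ : OpenPartialHomeomorph C.Dbl F}
    (hn : C.half false (C.top n) ∈ Ξ.source)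
    (hΞ : ContMDiffOn (corners (m + 1)) 𝓘(ℝ, F) ∞ Ξ Ξ.source)
    (hΞ' : ContMDiffOn 𝓘(ℝ, F) (corners (m + 1)) ∞ Ξ.symm Ξ.target)
    {ℓ : F →L[ℝ] ℝ} {c : F} (hc : ℓ c = 1) (hℓ : ∀ x ∈ Ξ.source, ℓ (Ξ x) = C.hDbl x)
    {ρ : G → F →L[ℝ] F} (hρc : ∀ g : G, g • n = n → ρ g c = c)
    (hact : ∀ g : G, g • n = n → ∀ x ∈ Ξ.source,
      C.act g x ∈ Ξ.source ∧ Ξ (C.act g x) = ρ g (Ξ x))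
    (hflip : ∀ x ∈ Ξ.source, Ξ (C.flip x) = Ξ x - (2 * C.hDbl x) • c) :
    ∃ Θ, C.IsTube n Θ := by
  -- The vector `Ξ x - h x • c` is the projection of `Ξ x` along `c` to the level `ℓ = 0`, which
  -- represents the top. The sets `S` and `T` keep this shift and its inverse inside the domain of
  -- `Ξ.symm`.
  set S : Set C.Dbl := Ξ.source ∩ (fun x ↦ Ξ x - C.hDbl x • c) ⁻¹' Ξ.target with hS
  set T : Set (N × ℝ) := ((fun q : N × ℝ ↦ C.half false (C.top q.1)) ⁻¹' Ξ.source) ∩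
    (fun q : N × ℝ ↦ Ξ (C.half false (C.top q.1)) + q.2 • c) ⁻¹' Ξ.target with hT
  have hιs : ContMDiff ((corners m).prod 𝓘(ℝ, ℝ)) (corners (m + 1)) ∞
      (fun q : N × ℝ ↦ C.half false (C.top q.1)) :=
    (C.contMDiff_half false).comp (C.contMDiff_top.comp contMDiff_fst)
  have hf₁ : ContMDiffOn (corners (m + 1)) 𝓘(ℝ, F) ∞ (fun x ↦ Ξ x - C.hDbl x • c) Ξ.source :=
    hΞ.sub (C.contMDiff_hDbl.contMDiffOn.smul contMDiffOn_const)
  have hf₂ : ContMDiffOn ((corners m).prod 𝓘(ℝ, ℝ)) 𝓘(ℝ, F) ∞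
      (fun q : N × ℝ ↦ Ξ (C.half false (C.top q.1)) + q.2 • c)
      ((fun q : N × ℝ ↦ C.half false (C.top q.1)) ⁻¹' Ξ.source) :=
    (hΞ.comp hιs.contMDiffOn fun _ h ↦ h).add (contMDiffOn_snd.smul contMDiffOn_const)
  have hσ : ContMDiffOn (corners (m + 1)) (corners (m + 1)) ∞
      (fun x ↦ Ξ.symm (Ξ x - C.hDbl x • c)) S :=
    hΞ'.comp (hf₁.mono inter_subset_left) fun x hx ↦ hx.2
  have hσ0 : ∀ x ∈ S, C.hDbl (Ξ.symm (Ξ x - C.hDbl x • c)) = 0 := fun x hx ↦ by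
    rw [← hℓ _ (Ξ.map_target hx.2), Ξ.right_inv hx.2, map_sub, map_smul, hc, hℓ x hx.1]
    simp
  have hι : ∀ x ∈ S, C.half false (C.top (C.topInv (C.fold (Ξ.symm (Ξ x - C.hDbl x • c))))) =
      Ξ.symm (Ξ x - C.hDbl x • c) := fun x hx ↦ C.half_top_topInv_fold (hσ0 x hx)
  have hΘ : ContMDiffOn (corners (m + 1)) ((corners m).prod 𝓘(ℝ, ℝ)) ∞
      (fun x ↦ (C.topInv (C.fold (Ξ.symm (Ξ x - C.hDbl x • c))), C.hDbl x)) S :=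
    (C.contMDiffOn_topInv_fold.comp hσ hσ0).prodMk C.contMDiff_hDbl.contMDiffOn
  have hΘ' : ContMDiffOn ((corners m).prod 𝓘(ℝ, ℝ)) (corners (m + 1)) ∞
      (fun q : N × ℝ ↦ Ξ.symm (Ξ (C.half false (C.top q.1)) + q.2 • c)) T :=
    hΞ'.comp (hf₂.mono inter_subset_left) fun x hx ↦ hx.2
  have hh : ∀ q ∈ T, C.hDbl (Ξ.symm (Ξ (C.half false (C.top q.1)) + q.2 • c)) = q.2 :=
    fun q hq ↦ by
      rw [← hℓ _ (Ξ.map_target hq.2), Ξ.right_inv hq.2, map_add, map_smul, hc, hℓ _ hq.1,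
        C.hDbl_top]
      simp
  set Θ : OpenPartialHomeomorph C.Dbl (N × ℝ) :=
    { toFun := fun x ↦ (C.topInv (C.fold (Ξ.symm (Ξ x - C.hDbl x • c))), C.hDbl x)
      invFun := fun q ↦ Ξ.symm (Ξ (C.half false (C.top q.1)) + q.2 • c)
      source := S
      target := T
      map_source' := fun x hx ↦ by
        refine ⟨?_, ?_⟩
        · rw [mem_preimage, hι x hx]
          exact Ξ.map_target hx.2
        · rw [mem_preimage]
          dsimp only
          rw [hι x hx, Ξ.right_inv hx.2, sub_add_cancel]
          exact Ξ.map_source hx.1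
      map_target' := fun q hq ↦ by
        refine ⟨Ξ.map_target hq.2, ?_⟩
        rw [mem_preimage, hh q hq, Ξ.right_inv hq.2, add_sub_cancel_right]
        exact Ξ.map_source hq.1
      left_inv' := fun x hx ↦ by
        dsimp only
        rw [hι x hx, Ξ.right_inv hx.2, sub_add_cancel, Ξ.left_inv hx.1]
      right_inv' := fun q hq ↦ by
        refine Prod.ext ?_ (hh q hq)
        dsimp only
        rw [hh q hq, Ξ.right_inv hq.2, add_sub_cancel_right, Ξ.left_inv hq.1, C.fold_half,
          C.topInv_top]
      open_source := hf₁.continuousOn.isOpen_inter_preimage Ξ.open_source Ξ.open_target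
      open_target := hf₂.continuousOn.isOpen_inter_preimage
        (Ξ.open_source.preimage hιs.continuous) Ξ.open_target
      continuousOn_toFun := hΘ.continuousOn
      continuousOn_invFun := hΘ'.continuousOn } with hΘdef
  have hs0 : ∀ n', C.half false (C.top n') ∈ Ξ.source →
      Ξ.symm (Ξ (C.half false (C.top n')) - C.hDbl (C.half false (C.top n')) • c) =
        C.half false (C.top n') := fun n' hn' ↦ by
    rw [C.hDbl_top, zero_smul, sub_zero, Ξ.left_inv hn']
  refine ⟨Θ, ⟨⟨hn, ?_⟩, hΘ, hΘ', fun _ _ ↦ rfl, fun n' hn' ↦ ?_, fun x hx hx' ↦ ?_,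
    fun g hg x hx hx' ↦ ?_⟩⟩
  · rw [mem_preimage, C.hDbl_top, zero_smul, sub_zero]
    exact Ξ.map_source hn
  · change C.topInv (C.fold (Ξ.symm _)) = n'
    rw [hs0 n' hn'.1, C.fold_half, C.topInv_top]
  · change C.topInv (C.fold (Ξ.symm (Ξ (C.flip x) - C.hDbl (C.flip x) • c))) =
      C.topInv (C.fold (Ξ.symm (Ξ x - C.hDbl x • c)))
    -- The reflection changes `Ξ x` by `-2h c` and the correction `-h c` by `2h c`, so the
    -- projection to level `0` stays the same.
    rw [hflip x hx.1, C.hDbl_flip]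
    congr 3
    module
  · change C.topInv (C.fold (Ξ.symm (Ξ (C.act g x) - C.hDbl (C.act g x) • c))) =
      g • C.topInv (C.fold (Ξ.symm (Ξ x - C.hDbl x • c)))
    have h1 := hact g hg _ (Ξ.map_target hx.2)
    rw [Ξ.right_inv hx.2] at h1
    rw [(hact g hg x hx.1).2, C.hDbl_act]
    have h2 : ρ g (Ξ x) - C.hDbl x • c = ρ g (Ξ x - C.hDbl x • c) := by
      rw [map_sub, map_smul, hρc g hg]
    rw [h2, ← h1.2, Ξ.left_inv h1.1]
    conv_lhs => rw [← hι x hx, C.act_half_top, C.fold_half, C.topInv_top]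

variable [IsManifold (corners (m + 1)) ∞ W]

/-- Away from the sides the double has an interior chart `Ψ` at the point. The normal form applies
in it once the derivative of the reflection is known to be the identity on the kernel of `dh`; this
kernel is the tangent space of the top, which the reflection fixes. -/
theorem exists_isTube_of_notMem_collarNhd [Finite G] {n : N} (hn : C.top n ∉ collarNhd C) :
    ∃ Θ, C.IsTube n Θ := by
  set p := C.half false (C.top n) with hp
  obtain ⟨Ψ, hpΨ, hΨ, hΨ'⟩ := exists_interior_chart (C.chart_pos_of_notMem_collarNhd hn)
  set y₀ := Ψ p with hy₀
  have hy₀t : y₀ ∈ Ψ.target := Ψ.map_source hpΨ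
  have hy₀p : Ψ.symm y₀ = p := Ψ.left_inv hpΨ
  have hΨc : ContinuousAt Ψ.symm y₀ := Ψ.continuousAt_symm hy₀t
  have hnear : ∀ {f : C.Dbl → C.Dbl}, Continuous f → f p = p →
      ∀ᶠ y in 𝓝 y₀, y ∈ Ψ.target ∧ f (Ψ.symm y) ∈ Ψ.source := by
    intro f hf hfp
    have h1 : ContinuousAt (fun y ↦ f (Ψ.symm y)) y₀ := hf.continuousAt.comp hΨc
    refine Filter.Eventually.and (Ψ.open_target.mem_nhds hy₀t) (h1 (Ψ.open_source.mem_nhds ?_))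
    dsimp only
    rw [hy₀p, hfp]
    exact hpΨ
  have hsm : ∀ {f : C.Dbl → C.Dbl}, ContMDiff (corners (m + 1)) (corners (m + 1)) ∞ f → f p = p →
      ∀ᶠ y in 𝓝 y₀, ContDiffAt ℝ ∞ (fun y ↦ Ψ (f (Ψ.symm y))) y := by
    intro f hf hfp
    filter_upwards [hnear hf.continuous hfp] with y hy
    rw [← contMDiffAt_iff_contDiffAt]
    exact contMDiffAt_comp_of_isOpen _ _ _ hΨ Ψ.open_source hy.2
      (hf.contMDiffAt.comp y ((hΨ' y hy.1).contMDiffAt (Ψ.open_target.mem_nhds hy.1)))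
  have hcomp : ∀ {f f' : C.Dbl → C.Dbl}, Continuous f' → f' p = p →
      ∀ᶠ y in 𝓝 y₀, Ψ (f (Ψ.symm (Ψ (f' (Ψ.symm y))))) = Ψ (f (f' (Ψ.symm y))) := by
    intro f f' hf' hfp'
    filter_upwards [hnear hf' hfp'] with y hy
    rw [Ψ.left_inv hy.2]
  have hcompη : ∀ {f' : C.Dbl → C.Dbl}, Continuous f' → f' p = p →
      ∀ᶠ y in 𝓝 y₀, C.hDbl (Ψ.symm (Ψ (f' (Ψ.symm y)))) = C.hDbl (f' (Ψ.symm y)) := by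
    intro f' hf' hfp'
    filter_upwards [hnear hf' hfp'] with y hy
    rw [Ψ.left_inv hy.2]
  set Γ := MulAction.stabilizer G n with hΓ
  have hactp : ∀ g : Γ, C.act (g : G) p = p := fun g ↦ by
    rw [hp, C.act_half_top, show (g : G) • n = n from g.2]
  have hactc : ∀ g : G, Continuous (C.act g) := fun g ↦ (C.contMDiff_act g).continuous
  have hflipp : C.flip p = p := C.flip_half_top false n
  have hflipc : Continuous C.flip := C.contMDiff_flip.continuous
  set a : Γ → EuclideanSpace ℝ (Fin (m + 1)) → EuclideanSpace ℝ (Fin (m + 1)) :=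
    fun g y ↦ Ψ (C.act (g : G) (Ψ.symm y)) with ha
  set R : EuclideanSpace ℝ (Fin (m + 1)) → EuclideanSpace ℝ (Fin (m + 1)) :=
    fun y ↦ Ψ (C.flip (Ψ.symm y)) with hR
  set η : EuclideanSpace ℝ (Fin (m + 1)) → ℝ := fun y ↦ C.hDbl (Ψ.symm y) with hη
  have hηs : ∀ᶠ y in 𝓝 y₀, ContDiffAt ℝ ∞ η y := by
    filter_upwards [Ψ.open_target.mem_nhds hy₀t] with y hy
    rw [← contMDiffAt_iff_contDiffAt]
    exact C.contMDiff_hDbl.contMDiffAt.comp y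
      ((hΨ' y hy).contMDiffAt (Ψ.open_target.mem_nhds hy))
  obtain ⟨ℓ₀, hℓ₀⟩ : ∃ ℓ₀ : EuclideanSpace ℝ (Fin (m + 1)) →L[ℝ] ℝ, HasFDerivAt η ℓ₀ y₀ :=
    hηs.self_of_nhds.differentiableAt (by simp)
  have hη' : HasMFDerivAt 𝓘(ℝ, EuclideanSpace ℝ (Fin (m + 1))) 𝓘(ℝ, ℝ) η y₀ ℓ₀ :=
    hℓ₀.hasMFDerivAt
  have hRs : ∀ᶠ y in 𝓝 y₀, ContDiffAt ℝ ∞ R y := hsm C.contMDiff_flip hflipp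
  obtain ⟨R₀, hR₀⟩ : ∃ R₀ : EuclideanSpace ℝ (Fin (m + 1)) →L[ℝ] EuclideanSpace ℝ (Fin (m + 1)),
      HasFDerivAt R R₀ y₀ := hRs.self_of_nhds.differentiableAt (by simp)
  have hR' : HasMFDerivAt 𝓘(ℝ, EuclideanSpace ℝ (Fin (m + 1)))
      𝓘(ℝ, EuclideanSpace ℝ (Fin (m + 1))) R y₀ R₀ := hR₀.hasMFDerivAt
  have hℓ0 : ℓ₀ ≠ 0 := by
    intro h0
    rw [h0] at hη'
    refine C.mfderiv_hDbl_ne_zero n ?_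
    have h1 : HasMFDerivAt (corners (m + 1)) 𝓘(ℝ, EuclideanSpace ℝ (Fin (m + 1))) Ψ p _ :=
      ((hΨ.contMDiffAt (Ψ.open_source.mem_nhds hpΨ)).mdifferentiableAt (by simp)).hasMFDerivAt
    have h2 := HasMFDerivAt.comp p hη' h1
    have h3 : C.hDbl =ᶠ[𝓝 p] η ∘ Ψ := by
      filter_upwards [Ψ.open_source.mem_nhds hpΨ] with x hx
      rw [Function.comp_apply, hη]
      dsimp only
      rw [Ψ.left_inv hx]
    exact (h2.congr_of_eventuallyEq h3).mfderiv.trans (ContinuousLinearMap.zero_comp _)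
  -- the reflection is the identity on the tangent space of the top
  set J : N → EuclideanSpace ℝ (Fin (m + 1)) := fun n' ↦ Ψ (C.half false (C.top n')) with hJ
  set s : Set N := {n' | C.half false (C.top n') ∈ Ψ.source} with hs
  have hιc : ContMDiff (corners m) (corners (m + 1)) ∞ (fun n' : N ↦ C.half false (C.top n')) :=
    (C.contMDiff_half false).comp C.contMDiff_top
  have hsn : s ∈ 𝓝 n := (Ψ.open_source.preimage hιc.continuous).mem_nhds hpΨ
  obtain ⟨J', hJ'⟩ : ∃ J' : EuclideanSpace ℝ (Fin m) →L[ℝ] EuclideanSpace ℝ (Fin (m + 1)),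
      HasMFDerivAt (corners m) 𝓘(ℝ, EuclideanSpace ℝ (Fin (m + 1))) J n J' :=
    ⟨_, ((contMDiffAt_comp_of_isOpen (f := fun n' : N ↦ C.half false (C.top n')) _ _ _ hΨ
      Ψ.open_source hpΨ hιc.contMDiffAt).mdifferentiableAt (by simp)).hasMFDerivAt⟩
  have hRJ : R₀.comp J' = J' := by
    have h1 : HasMFDerivAt (corners m) 𝓘(ℝ, EuclideanSpace ℝ (Fin (m + 1))) (R ∘ J) n
        (R₀.comp J') := HasMFDerivAt.comp n hR' hJ'
    refine hasMFDerivAt_unique (h1.congr_of_eventuallyEq ?_) hJ'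
    filter_upwards [hsn] with n' hn'
    simp only [hR, hJ, Function.comp_apply]
    rw [Ψ.left_inv hn', C.flip_half_top]
  have hηJ : ℓ₀.comp J' = 0 := by
    have h1 : HasMFDerivAt (corners m) 𝓘(ℝ, ℝ) (η ∘ J) n
        (ℓ₀.comp J') := HasMFDerivAt.comp n hη' hJ'
    refine hasMFDerivAt_unique h1 ((hasMFDerivAt_const (0 : ℝ) n).congr_of_eventuallyEq ?_)
    filter_upwards [hsn] with n' hn'
    simp only [hη, hJ, Function.comp_apply]
    rw [Ψ.left_inv hn', C.hDbl_top]
  -- The map from the zero level back to `N` is a smooth left inverse of `J`, so `J'` is injective.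
  have hJinj : Function.Injective J' := by
    set Q : Set (EuclideanSpace ℝ (Fin (m + 1))) := {y ∈ Ψ.target | C.hDbl (Ψ.symm y) = 0} with hQ
    have h1 : ContMDiffOn 𝓘(ℝ, EuclideanSpace ℝ (Fin (m + 1))) (corners m) ∞
        (fun y ↦ C.topInv (C.fold (Ψ.symm y))) Q :=
      C.contMDiffOn_topInv_fold.comp (hΨ'.mono fun y hy ↦ hy.1) fun y hy ↦ hy.2
    have hmaps : MapsTo J s Q := fun n' hn' ↦ ⟨Ψ.map_source hn', by
      simp only [hJ]; rw [Ψ.left_inv hn', C.hDbl_top]⟩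
    have h2 := (h1.mdifferentiableOn (by simp) _ (hmaps (mem_of_mem_nhds hsn))).hasMFDerivWithinAt
    have h3 := HasMFDerivWithinAt.comp n h2 hJ'.hasMFDerivWithinAt hmaps
    have h4 := hasMFDerivAt_unique ((h3.hasMFDerivAt hsn).congr_of_eventuallyEq (f₁ := id) (by
      filter_upwards [hsn] with n' hn'
      simp only [hJ, Function.comp_apply, id]
      rw [Ψ.left_inv hn', C.fold_half, C.topInv_top])) (hasMFDerivAt_id n)
    intro v v' hv
    have h5 := fun v ↦ congrArg (fun A : EuclideanSpace ℝ (Fin m) →L[ℝ]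
      EuclideanSpace ℝ (Fin m) ↦ A v) h4
    have h6 := h5 v
    have h7 := h5 v'
    exact h6.symm.trans ((congrArg _ hv).trans h7)
  -- The image of `J'` lies in `ker ℓ₀` and has dimension `m`, as does the kernel of a nonzero
  -- functional on `ℝ^(m+1)`.
  have hker : LinearMap.range J'.toLinearMap = LinearMap.ker ℓ₀.toLinearMap := by
    refine Submodule.eq_of_le_of_finrank_eq ?_ ?_
    · rintro _ ⟨v, rfl⟩
      exact congrArg (fun A : EuclideanSpace ℝ (Fin m) →L[ℝ] ℝ ↦ A v) hηJ
    · rw [LinearMap.finrank_range_of_inj hJinj]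
      have := Module.Dual.finrank_ker_add_one_of_ne_zero (f := ℓ₀.toLinearMap)
        fun h ↦ hℓ0 (ContinuousLinearMap.coe_injective h)
      rw [finrank_euclideanSpace_fin] at this ⊢
      omega
  have hRk : ∀ v, ℓ₀ v = 0 → R₀ v = v := by
    intro v hv
    have h1 : v ∈ LinearMap.range J'.toLinearMap := by rw [hker]; exact hv
    obtain ⟨w, rfl⟩ := h1
    exact congrArg (fun A : EuclideanSpace ℝ (Fin m) →L[ℝ]
      EuclideanSpace ℝ (Fin (m + 1)) ↦ A w) hRJ
  obtain ⟨Ω, ρ, ℓ, c, hΩt, hΩ0, hΩ, hΩ', hℓc, hρc, hℓη, hev⟩ :=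
    exists_equivariant_normalForm (y₀ := y₀) (a := a) (R := R) (η := η)
    (fun g ↦ hsm (C.contMDiff_act g) (hactp g)) hRs hηs
    (fun g ↦ by simp only [ha]; rw [hy₀p, hactp])
    (by simp only [hR]; rw [hy₀p, hflipp])
    (fun g g' ↦ by
      filter_upwards [hcomp (f := C.act (g : G)) (hactc g') (hactp g')] with y hy
      simp only [ha]
      rw [hy, C.act_act]
      rfl)
    (by
      filter_upwards [Ψ.open_target.mem_nhds hy₀t] with y hy
      simp only [ha, OneMemClass.coe_one]
      rw [C.act_one, Ψ.right_inv hy])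
    (fun g ↦ by
      filter_upwards [hcomp (f := C.act (g : G)) hflipc hflipp,
        hcomp (f := C.flip) (hactc g) (hactp g)] with y hy hy'
      simp only [ha, hR]
      rw [hy, hy', C.act_flip])
    (by
      filter_upwards [hcomp (f := C.flip) hflipc hflipp, Ψ.open_target.mem_nhds hy₀t] with y hy hy'
      simp only [hR]
      rw [hy, show C.flip (C.flip (Ψ.symm y)) = _ from Double.flip_flip _ _, Ψ.right_inv hy'])
    (fun g ↦ by
      filter_upwards [hcompη (hactc g) (hactp g)] with y hy
      simp only [ha, hη]
      rw [hy, C.hDbl_act])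
    (by
      filter_upwards [hcompη hflipc hflipp] with y hy
      simp only [hR, hη]
      rw [hy, C.hDbl_flip])
    (by rw [hℓ₀.fderiv]; exact hℓ0) (by rw [hℓ₀.fderiv, hR₀.fderiv]; exact hRk) (Ψ.open_target.mem_nhds hy₀t)
  obtain ⟨O₁, hO₁, hO₁o, hy₀O₁⟩ := mem_nhds_iff.1 hev
  have hO₂ : IsOpen ((Ψ ≫ₕ Ω).source ∩ (Ψ.source ∩ Ψ ⁻¹' O₁)) := (Ψ ≫ₕ Ω).open_source.inter
    (Ψ.continuousOn.isOpen_inter_preimage Ψ.open_source hO₁o)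
  -- On an invariant neighbourhood where the identities of germs hold, they become identities on the
  -- whole source of `Ξ`.
  obtain ⟨O, hOs, hO, hpO, hOflip, hOact⟩ := C.exists_invariant_nhds n hO₂
    ⟨⟨hpΨ, hΩ0⟩, hpΨ, hy₀O₁⟩
  set Ξ := (Ψ ≫ₕ Ω).restrOpen O hO with hΞ
  have hΞs : Ξ.source = O := by
    rw [hΞ, OpenPartialHomeomorph.restrOpen_source]
    exact inter_eq_right.2 fun x hx ↦ (hOs hx).1
  have hev' : ∀ x ∈ O, (∀ g : Γ, Ω (Ψ (C.act (g : G) x)) = ρ g (Ω (Ψ x))) ∧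
      Ω (Ψ (C.flip x)) = Ω (Ψ x) - (2 * C.hDbl x) • c := by
    intro x hx
    have h1 := hO₁ (hOs hx).2.2
    simp only [ha, hR, hη, mem_ofPred_eq, Ψ.left_inv (hOs hx).2.1] at h1
    exact h1
  -- Only the isotropy group has a representation; the value `0` at other group elements plays no
  -- role.
  refine C.exists_isTube_of_linear (Ξ := Ξ) (ℓ := ℓ) (c := c)
    (ρ := fun g ↦ open Classical in if hg : g ∈ Γ then ρ ⟨g, hg⟩ else 0) ?_ ?_ ?_ hℓc ?_ ?_ ?_ ?_
  · rw [hΞs]; exact hpO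
  · rw [hΞs]
    exact (contMDiffOn_iff_contDiffOn.2 hΩ).comp (hΨ.mono fun x hx ↦ (hOs hx).1.1)
      fun x hx ↦ (hOs hx).1.2
  · exact (hΨ'.comp ((contMDiffOn_iff_contDiffOn.2 hΩ').mono fun y hy ↦ hy.1)
      fun y hy ↦ hy.2).mono (t := Ξ.target) fun y hy ↦ hy.1
  · intro x hx
    rw [hΞs] at hx
    change ℓ (Ω (Ψ x)) = _
    rw [hℓη, hη]
    dsimp only
    rw [Ψ.left_inv (hOs hx).2.1]
  · intro g hg
    rw [dif_pos (show g ∈ Γ from hg), hρc]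
  · intro g hg x hx
    rw [hΞs] at hx ⊢
    refine ⟨hOact g hg x hx, ?_⟩
    rw [dif_pos (show g ∈ Γ from hg)]
    exact (hev' x hx).1 ⟨g, hg⟩
  · intro x hx
    rw [hΞs] at hx
    exact (hev' x hx).2

end EncasedHCobordism

/-- The collar handles the points near the sides, where the double may have corners; the remaining
points are interior and are handled by the normal form. -/
theorem exists_isEquivariant_coneChoice {E : Type uE} [TopologicalSpace E]
    [ChartedSpace (EuclideanQuadrant (m + k)) E] [MulAction G E] [Finite G]
    [IsManifold (corners (m + 1)) ∞ W] [IsManifold (corners m) ∞ N]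
    (hM : IsGManifold G m M) (hN : IsGManifold G m N) (ν : RoundBundle G m k M E) (n : N) :
    ∃ κ : ConeChoice C ν n, κ.IsEquivariant := by
  by_cases hn : C.top n ∈ collarNhd C
  · exact (C.isTube_sideHomeo hn).exists_isEquivariant hM hN
  · obtain ⟨Θ, hΘ⟩ := C.exists_isTube_of_notMem_collarNhd hn
    exact hΘ.exists_isEquivariant hM hN

end Tubes

/-! ### Polar coordinates on Euclidean space -/

section Sphere

variable {k : ℕ}

/-- The unit sphere of `ℝ^k × ℝ` with the Euclidean norm. -/
abbrev PolarSphere (k : ℕ) : Type :=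
  Metric.sphere (0 : WithLp 2 (EuclideanSpace ℝ (Fin k) × ℝ)) 1

instance : Fact (Module.finrank ℝ (WithLp 2 (EuclideanSpace ℝ (Fin k) × ℝ)) = k + 1) :=
  ⟨by rw [(WithLp.prodContinuousLinearEquiv 2 ℝ (EuclideanSpace ℝ (Fin k)) ℝ).toLinearEquiv.finrank_eq]
      simp⟩

theorem norm_toLp_eq_euclNorm (u : EuclideanSpace ℝ (Fin k) × ℝ) :
    ‖WithLp.toLp 2 u‖ = euclNorm u := by
  rw [WithLp.prod_norm_eq_of_L2, euclNorm, Real.norm_eq_abs, sq_abs]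
  rfl

theorem euclNorm_smul (c : ℝ) (u : EuclideanSpace ℝ (Fin k) × ℝ) :
    euclNorm (c • u) = |c| * euclNorm u := by
  rw [← norm_toLp_eq_euclNorm, ← norm_toLp_eq_euclNorm, WithLp.toLp_smul, norm_smul,
    Real.norm_eq_abs]

/-- A point of the sphere as a pair. -/
def sphereVec (θ : PolarSphere k) : EuclideanSpace ℝ (Fin k) × ℝ := WithLp.ofLp θ.1

theorem euclNorm_sphereVec (θ : PolarSphere k) : euclNorm (sphereVec θ) = 1 := by
  rw [← norm_toLp_eq_euclNorm]
  exact mem_sphere_zero_iff_norm.1 θ.2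

theorem contMDiff_sphereVec : ContMDiff (𝓡 k) 𝓘(ℝ, EuclideanSpace ℝ (Fin k) × ℝ) ∞
    (sphereVec : PolarSphere k → _) :=
  (WithLp.prodContinuousLinearEquiv 2 ℝ (EuclideanSpace ℝ (Fin k)) ℝ).contDiff.contMDiff.comp
    contMDiff_coe_sphere

theorem exists_normalize (u : EuclideanSpace ℝ (Fin k) × ℝ) :
    ∃ θ : PolarSphere k, u ≠ 0 → u = euclNorm u • sphereVec θ := by
  by_cases hu : u = 0
  -- An arbitrary point of the sphere serves as the default value at `u = 0`.
  · refine ⟨⟨WithLp.toLp 2 (0, 1), ?_⟩, fun h ↦ absurd hu h⟩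
    rw [mem_sphere_zero_iff_norm, norm_toLp_eq_euclNorm]
    simp [euclNorm]
  · have h0 : euclNorm u ≠ 0 := mt euclNorm_eq_zero.1 hu
    refine ⟨⟨WithLp.toLp 2 ((euclNorm u)⁻¹ • u), ?_⟩, fun _ ↦ ?_⟩
    · rw [mem_sphere_zero_iff_norm, norm_toLp_eq_euclNorm, euclNorm_smul,
        abs_of_nonneg (inv_nonneg.2 (euclNorm_nonneg u)), inv_mul_cancel₀ h0]
    · simp only [sphereVec]
      rw [smul_inv_smul₀ h0]

/-- The radial projection to the sphere. -/
def normalize (u : EuclideanSpace ℝ (Fin k) × ℝ) : PolarSphere k := (exists_normalize u).choose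

theorem smul_sphereVec_normalize {u : EuclideanSpace ℝ (Fin k) × ℝ} (hu : u ≠ 0) :
    euclNorm u • sphereVec (normalize u) = u := ((exists_normalize u).choose_spec hu).symm

theorem sphereVec_injective : Function.Injective (sphereVec : PolarSphere k → _) :=
  fun _ _ h ↦ Subtype.ext (WithLp.ofLp_injective 2 h)

theorem normalize_smul {c : ℝ} (hc : 0 < c) (θ : PolarSphere k) :
    normalize (c • sphereVec θ) = θ := by
  have h1 : euclNorm (c • sphereVec θ) = c := by
    rw [euclNorm_smul, euclNorm_sphereVec, abs_of_pos hc, mul_one]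
  have h2 : c • sphereVec θ ≠ 0 := fun h ↦ hc.ne' (by rw [← h1, h, euclNorm_eq_zero])
  have h3 := smul_sphereVec_normalize h2
  rw [h1] at h3
  exact sphereVec_injective (smul_right_injective _ hc.ne' h3)

/-- `ContMDiff.codRestrict_sphere` concerns globally smooth maps, so `normalize` is restricted to
the open submanifold `u ≠ 0`, where it is division by the norm. -/
theorem contMDiffAt_normalize {u : EuclideanSpace ℝ (Fin k) × ℝ} (hu : u ≠ 0) :
    ContMDiffAt 𝓘(ℝ, EuclideanSpace ℝ (Fin k) × ℝ) (𝓡 k) ∞ normalize u := by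
  let U : TopologicalSpace.Opens (EuclideanSpace ℝ (Fin k) × ℝ) := ⟨{0}ᶜ, isOpen_compl_singleton⟩
  have hU : ∀ x : U, x.1 ≠ 0 := fun x ↦ x.2
  let f : U → WithLp 2 (EuclideanSpace ℝ (Fin k) × ℝ) := fun x ↦ (normalize x.1).1
  have hf : ∀ x : U, f x = WithLp.toLp 2 ((euclNorm x.1)⁻¹ • x.1) := fun x ↦ by
    have h0 : euclNorm x.1 ≠ 0 := mt euclNorm_eq_zero.1 (hU x)
    conv_rhs => rw [← smul_sphereVec_normalize (hU x)]
    rw [euclNorm_smul, euclNorm_sphereVec, mul_one, abs_of_nonneg (euclNorm_nonneg _),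
      inv_smul_smul₀ h0]
    rfl
  have hfs : ContMDiff 𝓘(ℝ, EuclideanSpace ℝ (Fin k) × ℝ)
      𝓘(ℝ, WithLp 2 (EuclideanSpace ℝ (Fin k) × ℝ)) ∞ f := by
    intro x
    rw [show f = fun x : U ↦ WithLp.toLp 2 ((euclNorm x.1)⁻¹ • x.1) from funext hf]
    refine (contMDiffAt_subtype_iff (f := fun y : EuclideanSpace ℝ (Fin k) × ℝ ↦
      WithLp.toLp 2 ((euclNorm y)⁻¹ • y))).2 ?_
    have h1 : ContDiffAt ℝ ∞ (fun y : EuclideanSpace ℝ (Fin k) × ℝ ↦ (euclNorm y)⁻¹ • y) x.1 :=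
      ((contDiffAt_euclNorm (hU x)).inv (mt euclNorm_eq_zero.1 (hU x))).smul contDiffAt_id
    exact ((WithLp.prodContinuousLinearEquiv 2 ℝ (EuclideanSpace ℝ (Fin k))
      ℝ).symm.contDiff.contDiffAt.comp x.1 h1).contMDiffAt
  have h1 := hfs.codRestrict_sphere (n := k) fun x ↦ (normalize x.1).2
  have h2 : ContMDiffAt 𝓘(ℝ, EuclideanSpace ℝ (Fin k) × ℝ) (𝓡 k) ∞
    (fun x : U ↦ normalize x.1) ⟨u, hu⟩ := h1 ⟨u, hu⟩
  exact (contMDiffAt_subtype_iff (f := normalize)).1 h2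

end Sphere

/-! ### Comparison of pieces with the fibre product -/

section Pieces

variable {G : Type uG} [Group G] {m k : ℕ}
  {M : Type uM} [TopologicalSpace M] [ChartedSpace (EuclideanQuadrant m) M] [MulAction G M]
  {N : Type uN} [TopologicalSpace N] [ChartedSpace (EuclideanQuadrant m) N] [MulAction G N]
  {W : Type uW} [TopologicalSpace W] [ChartedSpace (EuclideanQuadrant (m + 1)) W] [MulAction G W]
  {E : Type uE} [TopologicalSpace E] [ChartedSpace (EuclideanQuadrant (m + k)) E] [MulAction G E]
  {C : EncasedHCobordism G m M N W} {ν : RoundBundle G m k M E}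

/-- The model with corners of `W × (E × ℝ)`. -/
abbrev pairModel (m k : ℕ) := (corners (m + 1)).prod ((corners (m + k)).prod 𝓘(ℝ, ℝ))

/-- A local homeomorphism of the stabilized double to a manifold is compatible with the smooth
structure of the fibre product. -/
structure IsCompatibleOnMiddle {F H Y : Type*} [NormedAddCommGroup F] [NormedSpace ℝ F]
    [TopologicalSpace H] [TopologicalSpace Y] [ChartedSpace H Y] (I : ModelWithCorners ℝ F H)
    (f : OpenPartialHomeomorph (St C ν) Y) : Prop where
  exists_factorization : ∃ (Φ : W × (E × ℝ) → Y) (O : Set (W × (E × ℝ))),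
    ContMDiffOn (pairModel m k) I ∞ Φ O ∧
      ∀ z ∈ f.source ∩ middleRegion C ν, St.pair z ∈ O ∧ f z = Φ (St.pair z)
  contMDiffOn_pair_symm : ContMDiffOn I (pairModel m k) ∞ (fun y ↦ St.pair (f.symm y))
    (f.target ∩ f.symm ⁻¹' middleRegion C ν)

/-- The transition map is `Φ ∘ (pair ∘ f.symm)`, with `Φ` belonging to `f'`. So each kind of chart
is compared once with the fibre product instead of with every other kind. -/
theorem IsCompatibleOnMiddle.contMDiffOn_trans {F H Y F' H' Y' : Type*} [NormedAddCommGroup F]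
    [NormedSpace ℝ F] [TopologicalSpace H] [TopologicalSpace Y] [ChartedSpace H Y]
    [NormedAddCommGroup F'] [NormedSpace ℝ F'] [TopologicalSpace H'] [TopologicalSpace Y']
    [ChartedSpace H' Y'] {I : ModelWithCorners ℝ F H} {I' : ModelWithCorners ℝ F' H'}
    {f : OpenPartialHomeomorph (St C ν) Y} {f' : OpenPartialHomeomorph (St C ν) Y'}
    (hf : IsCompatibleOnMiddle I f) (hf' : IsCompatibleOnMiddle I' f')
    (h : f.source ∩ f'.source ⊆ middleRegion C ν) :
    ContMDiffOn I I' ∞ (f.symm ≫ₕ f') (f.symm ≫ₕ f').source := by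
  obtain ⟨Φ, O, hΦ, hO⟩ := hf'.exists_factorization
  have hmid : ∀ y ∈ (f.symm ≫ₕ f').source, f.symm y ∈ middleRegion C ν := fun y hy ↦
    h ⟨f.map_target hy.1, hy.2⟩
  have h1 := hΦ.comp (hf.contMDiffOn_pair_symm.mono (t := (f.symm ≫ₕ f').source)
    fun y hy ↦ ⟨hy.1, hmid y hy⟩) fun y hy ↦ (hO _ ⟨hy.2, hmid y hy⟩).1
  exact h1.congr fun y hy ↦ (hO _ ⟨hy.2, hmid y hy⟩).2

variable (C ν) in
theorem isOpen_middleRegion : IsOpen (middleRegion C ν) :=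
  (C.isClosed_bottom.union C.isClosed_top).isOpen_compl.preimage (St.continuous_toW C ν)

theorem h_toW_neg {z : St C ν} (hz : z ∈ middleRegion C ν) : 0 < -C.h (St.toW z) :=
  neg_pos.2 (lt_of_le_of_ne (C.h_mem _).2 fun h ↦ hz (Or.inr ((C.h_eq_zero_iff _).1 h)))

section Cone

variable {n : N} (κ : ConeChoice C ν n) [IsManifold (corners m) ∞ M] [IsManifold (corners m) ∞ N]
  [Nonempty (St C ν)]

/-- Off the cone locus `u ≠ 0`, so `|u|` itself is smooth. The point of `W` can thus be computed on
the lower half, where the folding map is smooth, although it is not an even function of the radius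
on the double. -/
theorem ConeChoice.isCompatibleOnMiddle : IsCompatibleOnMiddle (coneModel m k) κ.chartHomeo where
  exists_factorization := ⟨κ.pairChart, κ.pairDomain, κ.contMDiffOn_pairChart, fun _ hz ↦
    ⟨κ.pair_mem_pairDomain hz.1, rfl⟩⟩
  contMDiffOn_pair_symm := by
    have hne : ∀ p ∈ κ.chartHomeo.target ∩ κ.chartHomeo.symm ⁻¹' middleRegion C ν,
        p ∈ κ.codomain ∧ p.2 ≠ 0 := by
      rintro p ⟨hp1, hp2⟩
      refine ⟨hp1, fun h0 ↦ ?_⟩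
      have h1 := h_toW_neg hp2
      change 0 < -C.h (St.toW (St.ofNontrivial C ν (κ.pairInv p))) at h1
      rw [St.toW_ofNontrivial (κ.pairInv_mem hp1), pairInv, κ.h_fold_pt hp1, h0,
        euclNorm_eq_zero.2 rfl] at h1
      simp at h1
    have h1 : ContMDiffOn (coneModel m k) (pairModel m k) ∞ κ.pairInv
        (κ.chartHomeo.target ∩ κ.chartHomeo.symm ⁻¹' middleRegion C ν) := by
      refine ContMDiffOn.prodMk ?_ (ContMDiffOn.prodMk
        (κ.contMDiffOn_param_pt.mono fun p hp ↦ hp.1)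
        (contDiff_snd.contMDiff.comp contMDiff_snd).contMDiffOn)
      have h2 : ContMDiffOn (coneModel m k) (corners (m + 1)) ∞ (fun p ↦ C.flip (κ.pt p))
          (κ.chartHomeo.target ∩ κ.chartHomeo.symm ⁻¹' middleRegion C ν) := by
        refine C.contMDiff_flip.contMDiffOn.comp (t := univ) (κ.contMDiffOn_bicollar.comp
          (f := fun p : N × (EuclideanSpace ℝ (Fin k) × ℝ) ↦ (p.1, euclNorm p.2)) ?_
          fun p hp ↦ κ.mem_codomain.1 hp.1) fun _ _ ↦ mem_univ _
        refine contMDiffOn_fst.prodMk fun p hp ↦ ?_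
        exact (ContMDiffAt.comp (g := euclNorm) (f := Prod.snd) p
          (contDiffAt_euclNorm (hne p hp).2).contMDiffAt contMDiffAt_snd).contMDiffWithinAt
      refine ((C.contMDiffOn_fold false).comp h2 fun p hp ↦ ?_).congr fun p hp ↦ ?_
      · exact ⟨_, κ.half_fold_pt hp.1⟩
      · exact (Double.fold_flip _ _).symm
    exact h1.congr fun p hp ↦ St.pair_ofNontrivial (κ.pairInv_mem hp.1)

end Cone

/-! ### Polar coordinates on the fibre product -/

section Middle

variable (φ : RoundTriv (m := m) (k := k) ν.proj ν.nrm)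

/-- Polar coordinates on the fibre product, as a function of pairs of points. -/
def polarFun (q : W × (E × ℝ)) : W × PolarSphere k := (q.1, normalize (φ.coord q.2.1, q.2.2))

theorem contMDiffOn_polarFun :
    ContMDiffOn (pairModel m k) ((corners (m + 1)).prod (𝓡 k)) ∞ (polarFun φ : W × (E × ℝ) → _)
      {q | ν.proj q.2.1 ∈ φ.base ∧ ν.nrmR q.2 ≠ 0} := by
  refine contMDiffOn_fst.prodMk fun q hq ↦ ?_
  have h1 := (((ν.contMDiffOn_coord_prod φ).contMDiffAt
    ((ν.isOpen_setOf_proj_fst_mem φ).mem_nhds hq.1)).comp q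
    (contMDiffAt_snd (I := corners (m + 1)) (M := W)))
  refine (contMDiffAt_normalize ?_ |>.comp q h1).contMDiffWithinAt
  intro h0
  apply hq.2
  rw [ν.nrmR_eq_euclNorm φ hq.1]
  exact euclNorm_eq_zero.2 h0

variable (C) in
/-- The pair of points with given polar coordinates. -/
def polarInv (q : W × PolarSphere k) : W × (E × ℝ) :=
  (q.1, (φ.param (C.r q.1) (-C.h q.1 • sphereVec q.2).1, (-C.h q.1 • sphereVec q.2).2))

theorem euclNorm_neg_h_smul (q : W × PolarSphere k) :
    euclNorm (-C.h q.1 • sphereVec q.2) = -C.h q.1 := by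
  rw [euclNorm_smul, euclNorm_sphereVec, mul_one, abs_of_nonneg]
  linarith [(C.h_mem q.1).2]

theorem neg_h_smul_mem_closedBall (q : W × PolarSphere k) :
    (-C.h q.1 • sphereVec q.2).1 ∈ Metric.closedBall (0 : EuclideanSpace ℝ (Fin k)) 1 := by
  rw [mem_closedBall_zero_iff]
  refine (norm_fst_le_euclNorm _).trans ?_
  rw [euclNorm_neg_h_smul]
  linarith [(C.h_mem q.1).1]

theorem polarInv_mem {q : W × PolarSphere k} (hq : C.r q.1 ∈ φ.base) :
    polarInv C φ q ∈ Nontrivial C ν :=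
  nontrivial_param hq (euclNorm_neg_h_smul q)

theorem contMDiffOn_polarInv :
    ContMDiffOn ((corners (m + 1)).prod (𝓡 k)) (pairModel m k) ∞ (polarInv C φ)
      {q | C.r q.1 ∈ φ.base} := by
  have h1 : ContMDiff ((corners (m + 1)).prod (𝓡 k)) 𝓘(ℝ, EuclideanSpace ℝ (Fin k) × ℝ) ∞
      (fun q : W × PolarSphere k ↦ -C.h q.1 • sphereVec q.2) :=
    (C.h_smooth.neg.comp contMDiff_fst).smul (contMDiff_sphereVec.comp contMDiff_snd)
  refine contMDiffOn_fst.prodMk (ContMDiffOn.prodMk ?_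
    (contDiff_snd.contMDiff.comp h1).contMDiffOn)
  exact φ.smooth_param.comp (((C.r_smooth.comp contMDiff_fst).prodMk
    (contDiff_fst.contMDiff.comp h1)).contMDiffOn) fun q hq ↦ ⟨hq, neg_h_smul_mem_closedBall q⟩

variable (C) in
/-- The region of the fibre product where polar coordinates are defined. -/
def polarSource : Set (St C ν) := {z | z ∈ middleRegion C ν ∧ C.r (St.toW z) ∈ φ.base}

theorem pair_mem_of_mem_polarSource {z : St C ν} (hz : z ∈ polarSource C φ) :
    ν.proj (St.pair z).2.1 ∈ φ.base ∧ ν.nrmR (St.pair z).2 ≠ 0 := by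
  refine ⟨?_, ?_⟩
  · rw [St.pair, St.proj_encase]
    exact hz.2
  · rw [St.pair, ← St.neg_h_toW z fun h ↦ hz.1 (Or.inl h)]
    exact (h_toW_neg hz.1).ne'

variable [Nonempty (St C ν)]

variable (C) in
/-- Polar coordinates on the fibre product. -/
def polarHomeo : OpenPartialHomeomorph (St C ν) (W × PolarSphere k) where
  toFun z := polarFun φ (St.pair z)
  invFun q := St.ofNontrivial C ν (polarInv C φ q)
  source := polarSource C φ
  target := {q | q.1 ∈ (range C.bottom ∪ range C.top)ᶜ ∧ C.r q.1 ∈ φ.base}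
  map_source' z hz := hz
  map_target' q hq := by
    have h1 : St.toW (St.ofNontrivial C ν (polarInv C φ q)) = q.1 :=
      St.toW_ofNontrivial (polarInv_mem φ hq.2)
    refine ⟨?_, ?_⟩
    · change St.toW (St.ofNontrivial C ν (polarInv C φ q)) ∈ (range C.bottom ∪ range C.top)ᶜ
      rw [h1]; exact hq.1
    · rw [h1]; exact hq.2
  left_inv' z hz := by
    obtain ⟨h1, h2⟩ := pair_mem_of_mem_polarSource φ hz
    have hb : St.toW z ∉ range C.bottom := fun h ↦ hz.1 (Or.inl h)
    -- The radius is determined by `w`, so `w` and the direction of `u` determine the point; the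
    -- radius is nonzero in the middle region, so the direction is meaningful.
    have h3 : euclNorm (φ.coord (St.pair z).2.1, (St.pair z).2.2) = -C.h (St.toW z) := by
      rw [← ν.nrmR_eq_euclNorm φ h1, St.neg_h_toW z hb]; rfl
    have h4 : polarInv C φ (polarFun φ (St.pair z)) = St.pair z := by
      rw [polarInv, polarFun]
      dsimp only
      rw [show C.h (St.pair z).1 = C.h (St.toW z) from rfl, ← h3, smul_sphereVec_normalize (by
        rw [Ne, ← euclNorm_eq_zero, h3]; exact (h_toW_neg hz.1).ne')]
      refine Prod.ext rfl (Prod.ext ?_ rfl)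
      dsimp only
      rw [show C.r (St.pair z).1 = C.r (St.toW z) from rfl, ← St.proj_encase]
      exact φ.param_coord _ h1
    rw [h4]
    exact (St.pair_mem hb).2
  right_inv' q hq := by
    rw [St.pair_ofNontrivial (polarInv_mem φ hq.2), polarFun, polarInv]
    dsimp only
    rw [φ.coord_param _ hq.2 _ (neg_h_smul_mem_closedBall q), Prod.mk.eta, normalize_smul]
    exact neg_pos.2 (lt_of_le_of_ne (C.h_mem _).2 fun h ↦
      hq.1 (Or.inr ((C.h_eq_zero_iff _).1 h)))
  open_source := (isOpen_middleRegion C ν).inter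
    (φ.isOpen_base.preimage (C.r_smooth.continuous.comp (St.continuous_toW C ν)))
  open_target := ((C.isClosed_bottom.union C.isClosed_top).isOpen_compl.preimage
    continuous_fst).inter (φ.isOpen_base.preimage (C.r_smooth.continuous.comp continuous_fst))
  continuousOn_toFun := (contMDiffOn_polarFun φ).continuousOn.comp
    ((St.continuous_toW C ν).prodMk (St.continuous_encase C ν)).continuousOn
    fun z hz ↦ pair_mem_of_mem_polarSource φ hz
  continuousOn_invFun := St.continuousOn_ofNontrivial.comp
    ((contMDiffOn_polarInv φ).continuousOn.mono fun q hq ↦ hq.2) fun q hq ↦ polarInv_mem φ hq.2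

theorem isCompatibleOnMiddle_polarHomeo :
    IsCompatibleOnMiddle ((corners (m + 1)).prod (𝓡 k)) (polarHomeo C φ) where
  exists_factorization := ⟨polarFun φ, _, contMDiffOn_polarFun φ, fun _ hz ↦
    ⟨pair_mem_of_mem_polarSource φ hz.1, rfl⟩⟩
  contMDiffOn_pair_symm := ((contMDiffOn_polarInv φ).mono fun _ hq ↦ hq.1.2).congr
    fun _ hq ↦ St.pair_ofNontrivial (polarInv_mem φ hq.1.2)

end Middle

end Pieces

/-! ### The trivial region and the lower collar -/

section Outer

variable {G : Type uG} [Group G] {m k : ℕ}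
  {M : Type uM} [TopologicalSpace M] [ChartedSpace (EuclideanQuadrant m) M] [MulAction G M]
  {N : Type uN} [TopologicalSpace N] [ChartedSpace (EuclideanQuadrant m) N] [MulAction G N]
  {W : Type uW} [TopologicalSpace W] [ChartedSpace (EuclideanQuadrant (m + 1)) W] [MulAction G W]
  {E : Type uE} [TopologicalSpace E] [ChartedSpace (EuclideanQuadrant (m + k)) E] [MulAction G E]
  {C : EncasedHCobordism G m M N W} {ν : RoundBundle G m k M E}

instance : Fact ((-1 : ℝ) < 1) := ⟨by norm_num⟩

/-- The product of `D(ν)` and `[-1,1]` as a subset of the product of `D(ν)` and the line. -/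
def inclIcc (y : E × Icc (-1 : ℝ) 1) : E × ℝ := (y.1, y.2)

/-- The retraction inverse to `inclIcc`. -/
def projIccSnd (u : E × ℝ) : E × Icc (-1 : ℝ) 1 := (u.1, projIcc (-1) 1 (neg_le_self zero_le_one) u.2)

theorem inclIcc_projIccSnd {E : Type*} {u : E × ℝ} (hu : u.2 ∈ Icc (-1 : ℝ) 1) :
    inclIcc (projIccSnd u) = u :=
  Prod.ext rfl (congrArg Subtype.val
    (projIcc_of_mem (neg_le_self zero_le_one) hu : _ = (⟨u.2, hu⟩ : Icc (-1 : ℝ) 1)))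

theorem projIccSnd_inclIcc {E : Type*} (y : E × Icc (-1 : ℝ) 1) : projIccSnd (inclIcc y) = y :=
  Prod.ext rfl (projIcc_val (neg_le_self zero_le_one) y.2)

theorem contMDiff_inclIcc : ContMDiff ((corners (m + k)).prod (𝓡∂ 1))
    ((corners (m + k)).prod 𝓘(ℝ, ℝ)) ∞ (inclIcc : E × Icc (-1 : ℝ) 1 → E × ℝ) :=
  contMDiff_fst.prodMk (contMDiff_subtypeVal_Icc.comp contMDiff_snd)

theorem contMDiffOn_projIccSnd : ContMDiffOn ((corners (m + k)).prod 𝓘(ℝ, ℝ))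
    ((corners (m + k)).prod (𝓡∂ 1)) ∞ (projIccSnd : E × ℝ → E × Icc (-1 : ℝ) 1)
    {u | u.2 ∈ Icc (-1 : ℝ) 1} :=
  contMDiffOn_fst.prodMk (contMDiffOn_projIcc.comp contMDiffOn_snd fun _ hu ↦ hu)

theorem continuous_projIccSnd : Continuous (projIccSnd : E × ℝ → E × Icc (-1 : ℝ) 1) :=
  continuous_fst.prodMk (continuous_projIcc.comp continuous_snd)

variable (ν) in
/-- The point of `M × [-1,0]` below a point of `D(ν) × ℝ`, where the region outside `D(ν × ℝ)` is
projected to the bottom. -/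
def base (u : E × ℝ) : M × Icc (-1 : ℝ) 0 := (ν.proj u.1, negAbs (ν.nrmR u))

theorem continuous_base : Continuous (base ν) :=
  (ν.continuous_proj.comp continuous_fst).prodMk (continuous_negAbs.comp ν.continuous_nrmR)

theorem coe_base_snd {u : E × ℝ} (hu : ν.nrmR u ≤ 1) : ((base ν u).2 : ℝ) = -ν.nrmR u := by
  have h0 := ν.nrmR_nonneg u
  rw [base]
  dsimp only
  rw [coe_negAbs (by rwa [abs_of_nonneg h0]), abs_of_nonneg h0]

theorem coe_base_snd_of_one_le {u : E × ℝ} (hu : 1 ≤ ν.nrmR u) : ((base ν u).2 : ℝ) = -1 := by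
  have h0 := ν.nrmR_nonneg u
  rw [base, negAbs, abs_of_nonneg h0]
  dsimp only
  rw [projIcc_of_le_left _ (by linarith)]

theorem collar_base_of_one_le {u : E × ℝ} (hu : 1 ≤ ν.nrmR u) :
    C.collar (base ν u) = C.bottom (ν.proj u.1) := C.collar_bottom _ (coe_base_snd_of_one_le hu)

theorem base_mem_core_of_one_le {u : E × ℝ} (hu : 1 ≤ ν.nrmR u) : base ν u ∈ C.core :=
  C.mem_core_of_bottom_or_side (Or.inl (coe_base_snd_of_one_le hu))

theorem collar_base_mem {u : E × ℝ} (hu : base ν u ∈ C.core) (h1 : ν.nrmR u ≤ 1) :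
    (C.collar (base ν u), u) ∈ Nontrivial C ν := by
  obtain ⟨-, h2, h3⟩ := mem_core hu
  refine ⟨h2, ?_⟩
  dsimp only
  rw [h3, coe_base_snd h1, neg_neg]

theorem nrmR_le_one {q : W × (E × ℝ)} (hq : q ∈ Nontrivial C ν) : ν.nrmR q.2 ≤ 1 := by
  rw [← hq.2]; linarith [(C.h_mem q.1).1]

/-- The point of `W` can be read off from `u` in both regions: outside the disc bundle it is in the
bottom, and inside it has height `-|u|` and is recovered by the collar. -/
theorem base_encase_mem {z : St C ν} (hz : St.toW z ∈ collarNhd C) :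
    base ν (St.encase z) ∈ C.core ∧ C.collar (base ν (St.encase z)) = St.toW z := by
  have : Nonempty (St C ν) := ⟨z⟩
  rcases St.cases z with ⟨u, hu, rfl⟩ | ⟨q, hq, rfl⟩
  · rw [St.encase_ofTrivial hu, St.toW_ofTrivial hu]
    exact ⟨base_mem_core_of_one_le hu.2, collar_base_of_one_le hu.2⟩
  · rw [St.toW_ofNontrivial hq] at hz
    rw [St.encase_ofNontrivial hq, St.toW_ofNontrivial hq]
    have h1 := collar_eq_of_mem_collarNhd hz (s := (base ν q.2).2)
      (by rw [coe_base_snd (nrmR_le_one hq), ← hq.2, neg_neg])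
    rw [hq.1] at h1
    exact h1

variable (C ν) in
theorem isOpen_outerRegion : IsOpen (outerRegion C ν) :=
  (C.isOpen_collarNhd.sdiff C.isClosed_top).preimage (St.continuous_toW C ν)

theorem nrmR_encase_ne_zero {z : St C ν} (hz : St.toW z ∉ range C.top) :
    ν.nrmR (St.encase z) ≠ 0 := by
  have : Nonempty (St C ν) := ⟨z⟩
  rcases St.cases z with ⟨u, hu, rfl⟩ | ⟨q, hq, rfl⟩
  · rw [St.encase_ofTrivial hu]
    exact (zero_lt_one.trans_le hu.2).ne'
  · rw [St.toW_ofNontrivial hq] at hz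
    rw [St.encase_ofNontrivial hq, ← hq.2]
    exact fun h ↦ hz ((C.h_eq_zero_iff _).1 (neg_eq_zero.1 h))

variable [Nonempty (St C ν)]

open Classical in
variable (C ν) in
/-- The inverse of the encasing on the outer region. -/
def outerInv (u : E × ℝ) : St C ν :=
  if 1 ≤ ν.nrmR u then St.ofTrivial C ν u else St.ofNontrivial C ν (C.collar (base ν u), u)

variable (C ν) in
/-- The image of the encasing of the outer region, without the bounds on the last coordinate. -/
def outerImage : Set (E × ℝ) := {u | base ν u ∈ C.core ∧ ν.nrmR u ≠ 0}

theorem outerInv_of_le {u : E × ℝ} (h1 : ν.nrmR u ≤ 1)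
    (h2 : u.2 ∈ Icc (-1 : ℝ) 1) :
    outerInv C ν u = St.ofNontrivial C ν (C.collar (base ν u), u) := by
  rw [outerInv]
  split_ifs with h3
  · rw [St.ofTrivial_eq_ofNontrivial ⟨h2, h3⟩ (le_antisymm h1 h3), collar_base_of_one_le h3]
  · rfl

theorem outerInv_of_one_le {u : E × ℝ} (h1 : 1 ≤ ν.nrmR u) :
    outerInv C ν u = St.ofTrivial C ν u := if_pos h1

theorem encase_outerInv {u : E × ℝ} (hu : u ∈ outerImage C ν) (h2 : u.2 ∈ Icc (-1 : ℝ) 1) :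
    St.encase (outerInv C ν u) = u ∧ St.toW (outerInv C ν u) = C.collar (base ν u) := by
  rcases le_total 1 (ν.nrmR u) with h1 | h1
  · rw [outerInv_of_one_le h1, St.encase_ofTrivial ⟨h2, h1⟩, St.toW_ofTrivial ⟨h2, h1⟩,
      collar_base_of_one_le h1]
    exact ⟨rfl, rfl⟩
  · rw [outerInv_of_le h1 h2, St.encase_ofNontrivial (collar_base_mem hu.1 h1),
      St.toW_ofNontrivial (collar_base_mem hu.1 h1)]
    exact ⟨rfl, rfl⟩

theorem outerInv_mem {u : E × ℝ} (hu : u ∈ outerImage C ν) (h2 : u.2 ∈ Icc (-1 : ℝ) 1) :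
    outerInv C ν u ∈ outerRegion C ν := by
  have h3 := (encase_outerInv hu h2).2
  have h4 : St.toW (outerInv C ν u) ∈ collarNhd C := by
    rw [h3]; exact mem_image_of_mem _ hu.1
  refine ⟨h4, fun h5 ↦ ?_⟩
  rw [h3] at h5
  rcases le_total 1 (ν.nrmR u) with h1 | h1
  · rw [collar_base_of_one_le h1] at h5
    exact C.bottom_notMem_top _ h5
  · have h6 := (mem_core hu.1).2.2
    rw [(C.h_eq_zero_iff _).2 h5, coe_base_snd h1] at h6
    exact hu.2 (by linarith)

theorem outerInv_encase {z : St C ν} (hz : z ∈ outerRegion C ν) :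
    outerInv C ν (St.encase z) = z := by
  have h1 := base_encase_mem hz.1
  rcases St.cases z with ⟨u, hu, rfl⟩ | ⟨q, hq, rfl⟩
  · rw [St.encase_ofTrivial hu, outerInv_of_one_le hu.2]
  · have h3 := St.encase_snd_mem (St.ofNontrivial C ν q)
    rw [St.encase_ofNontrivial hq] at h1 h3 ⊢
    rw [outerInv_of_le (nrmR_le_one hq) h3, h1.2, St.toW_ofNontrivial hq]

/-- The two formulas are continuous on closed sets that meet where `|u| = 1`, and the gluing
relation makes them agree there. -/
theorem continuousOn_outerInv :
    ContinuousOn (outerInv C ν) (outerImage C ν ∩ {u | u.2 ∈ Icc (-1 : ℝ) 1}) := by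
  refine continuousOn_of_closed_cover (T := {u | 1 ≤ ν.nrmR u}) (T' := {u | ν.nrmR u ≤ 1})
    (fun u _ ↦ le_total 1 (ν.nrmR u)) (isClosed_le continuous_const ν.continuous_nrmR)
    (isClosed_le ν.continuous_nrmR continuous_const) ?_ ?_
  · exact (St.continuousOn_ofTrivial.mono fun u hu ↦ ⟨hu.1.2, hu.2⟩).congr
      fun u hu ↦ outerInv_of_one_le hu.2
  · refine (St.continuousOn_ofNontrivial.comp (f := fun u ↦ (C.collar (base ν u), u))
      (ContinuousOn.prodMk ?_ continuousOn_id)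
      fun u hu ↦ collar_base_mem hu.1.1.1 hu.2).congr fun u hu ↦ outerInv_of_le hu.2 hu.1.2
    exact C.collar.continuousOn.comp continuous_base.continuousOn fun u hu ↦ (mem_core hu.1.1.1).1

variable (C ν) in
/-- The identification of the outer region with an open subset of `D(ν) × [-1,1]`. -/
def outerHomeo : OpenPartialHomeomorph (St C ν) (E × Icc (-1 : ℝ) 1) where
  toFun z := projIccSnd (St.encase z)
  invFun y := outerInv C ν (inclIcc y)
  source := outerRegion C ν
  target := inclIcc ⁻¹' outerImage C ν
  map_source' z hz := by
    change inclIcc (projIccSnd (St.encase z)) ∈ outerImage C ν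
    rw [inclIcc_projIccSnd (St.encase_snd_mem z)]
    exact ⟨(base_encase_mem hz.1).1, nrmR_encase_ne_zero hz.2⟩
  map_target' y hy := outerInv_mem hy y.2.2
  left_inv' z hz := by rw [inclIcc_projIccSnd (St.encase_snd_mem z), outerInv_encase hz]
  right_inv' y hy := by rw [(encase_outerInv hy y.2.2).1, projIccSnd_inclIcc]
  open_source := isOpen_outerRegion C ν
  open_target := ((C.isOpen_core.preimage continuous_base).inter
    (isOpen_ne_fun ν.continuous_nrmR continuous_const)).preimage
      (continuous_fst.prodMk (continuous_subtype_val.comp continuous_snd))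
  continuousOn_toFun := (continuous_projIccSnd.comp (St.continuous_encase C ν)).continuousOn
  continuousOn_invFun := continuousOn_outerInv.comp
    (continuous_fst.prodMk (continuous_subtype_val.comp continuous_snd)).continuousOn
    fun y hy ↦ ⟨hy, y.2.2⟩

/-- In the middle region `0 < |u| ≤ 1`, so `-|u|` is smooth with values in `[-1,0]`, and the point
of `W` is `c (p u, -|u|)`. -/
theorem isCompatibleOnMiddle_outerHomeo :
    IsCompatibleOnMiddle ((corners (m + k)).prod (𝓡∂ 1)) (outerHomeo C ν) where
  exists_factorization := ⟨fun q ↦ projIccSnd q.2, {q | q.2.2 ∈ Icc (-1 : ℝ) 1},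
    contMDiffOn_projIccSnd.comp contMDiffOn_snd fun _ hq ↦ hq,
    fun z _ ↦ ⟨St.encase_snd_mem z, rfl⟩⟩
  contMDiffOn_pair_symm := by
    set T := (outerHomeo C ν).target ∩ (outerHomeo C ν).symm ⁻¹' middleRegion C ν with hT
    have hpair : ∀ y ∈ T, St.pair (outerInv C ν (inclIcc y)) =
        (C.collar (base ν (inclIcc y)), inclIcc y) := fun y hy ↦
      Prod.ext (encase_outerInv hy.1 y.2.2).2 (encase_outerInv hy.1 y.2.2).1
    -- Points with `|u| > 1` lie over the bottom, which the middle region excludes.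
    have hle : ∀ y ∈ T, ν.nrmR (inclIcc y) ≤ 1 := fun y hy ↦ by
      by_contra! h
      have h1 : St.toW (outerInv C ν (inclIcc y)) ∈ (range C.bottom ∪ range C.top)ᶜ := hy.2
      rw [(encase_outerInv hy.1 y.2.2).2, collar_base_of_one_le h.le] at h1
      exact h1 (Or.inl (mem_range_self _))
    have hbase : ContMDiffOn ((corners (m + k)).prod (𝓡∂ 1)) ((corners m).prod (𝓡∂ 1)) ∞
        (fun y ↦ base ν (inclIcc y)) T := by
      have h1 : ContMDiffOn ((corners (m + k)).prod (𝓡∂ 1)) 𝓘(ℝ, ℝ) ∞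
          (fun y ↦ -ν.nrmR (inclIcc y)) T := fun y hy ↦
        ((ν.contMDiffAt_nrmR hy.1.2).comp y contMDiff_inclIcc.contMDiffAt).neg.contMDiffWithinAt
      refine (ContMDiffOn.prodMk (ν.proj_smooth.comp contMDiff_fst).contMDiffOn
        (contMDiffOn_projIcc.comp h1 fun y hy ↦ ?_)).congr fun y hy ↦ ?_
      · exact ⟨neg_le_neg (hle y hy), neg_nonpos.2 (ν.nrmR_nonneg _)⟩
      · rw [base, negAbs, abs_of_nonneg (ν.nrmR_nonneg _)]
        rfl
    refine ContMDiffOn.congr ?_ hpair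
    exact ContMDiffOn.prodMk (C.collar_smooth.comp hbase fun y hy ↦ (mem_core hy.1.1).1)
      contMDiff_inclIcc.contMDiffOn

end Outer

/-! ### Diffeomorphisms between subsets -/

section Diffeos

variable {F H X F' H' Y F'' H'' Z : Type*}
  [NormedAddCommGroup F] [NormedSpace ℝ F] [TopologicalSpace H] {I : ModelWithCorners ℝ F H}
  [TopologicalSpace X] [ChartedSpace H X]
  [NormedAddCommGroup F'] [NormedSpace ℝ F'] [TopologicalSpace H'] {I' : ModelWithCorners ℝ F' H'}
  [TopologicalSpace Y] [ChartedSpace H' Y]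
  [NormedAddCommGroup F''] [NormedSpace ℝ F''] [TopologicalSpace H'']
  {I'' : ModelWithCorners ℝ F'' H''} [TopologicalSpace Z] [ChartedSpace H'' Z]

theorem IsDiffeoOnto.of_isEmpty [IsEmpty X] [IsEmpty Y] (f : X → Y) (A : Set X) (B : Set Y) :
    IsDiffeoOnto I I' f A B :=
  ⟨fun x ↦ isEmptyElim x, fun x ↦ isEmptyElim x, fun y ↦ isEmptyElim y, fun y ↦ isEmptyElim y,
    fun y ↦ isEmptyElim y, fun x ↦ isEmptyElim x, fun y ↦ isEmptyElim y⟩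

theorem IsDiffeoOnto.contMDiffOn_symm {f : OpenPartialHomeomorph X Y}
    (h : IsDiffeoOnto I I' f f.source f.target) : ContMDiffOn I' I ∞ f.symm f.target := by
  obtain ⟨-, -, f', h1, -, h2, -⟩ := h
  refine h1.congr fun y hy ↦ ?_
  conv_rhs => rw [← f.right_inv hy]
  exact (h2 (f.map_target hy)).symm

/-- This passes from `D(ν) × [-1,1]`, where the outer chart takes its values, to subsets of `D(ν) ×
ℝ`, in terms of which the prescribed form is stated. -/
theorem IsDiffeoOnto.onto_image {f : X → Y} {f₁ : X → Z} {A : Set X} {B : Set Y}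
    (h : IsDiffeoOnto I I' f A B) {g : Y → Z} {g' : Z → Y} (hg : ContMDiffOn I' I'' ∞ g B)
    (hg' : ContMDiffOn I'' I' ∞ g' (f₁ '' A)) (h₁ : ∀ x ∈ A, f₁ x = g (f x))
    (h₂ : ∀ x ∈ A, g' (f₁ x) = f x) : IsDiffeoOnto I I'' f₁ A (f₁ '' A) := by
  obtain ⟨hf, hm, f', hf', -, hl, -⟩ := h
  have hinv : ∀ x ∈ A, f' (g' (f₁ x)) = x := fun x hx ↦ by rw [h₂ x hx, hl hx]
  refine ⟨(hg.comp hf hm).congr h₁, mapsTo_image _ _, f' ∘ g', hf'.comp hg' ?_, ?_, hinv, ?_⟩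
  · rintro _ ⟨x, hx, rfl⟩
    rw [mem_preimage, h₂ x hx]
    exact hm hx
  · rintro _ ⟨x, hx, rfl⟩
    rw [Function.comp_apply, hinv x hx]
    exact hx
  · rintro _ ⟨x, hx, rfl⟩
    rw [Function.comp_apply, hinv x hx]

end Diffeos

/-! ### Existence and uniqueness of the smooth structure -/

section Structure

variable {G : Type uG} [Group G] {m k : ℕ}
  {M : Type uM} [TopologicalSpace M] [ChartedSpace (EuclideanQuadrant m) M] [MulAction G M]
  {N : Type uN} [TopologicalSpace N] [ChartedSpace (EuclideanQuadrant m) N] [MulAction G N]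
  {W : Type uW} [TopologicalSpace W] [ChartedSpace (EuclideanQuadrant (m + 1)) W] [MulAction G W]
  {E : Type uE} [TopologicalSpace E] [ChartedSpace (EuclideanQuadrant (m + k)) E] [MulAction G E]
  {C : EncasedHCobordism G m M N W} {ν : RoundBundle G m k M E}

theorem St.mem_region (z : St C ν) : z ∈ outerRegion C ν ∨ z ∈ middleRegion C ν ∨
    ∃ n, C.top n = St.toW z := by
  by_cases h1 : St.toW z ∈ range C.bottom
  · obtain ⟨x, hx⟩ := h1
    refine Or.inl ?_
    change St.toW z ∈ collarNhd C \ range C.top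
    rw [← hx]
    exact ⟨C.bottom_mem_collarNhd x, C.bottom_notMem_top x⟩
  · by_cases h2 : St.toW z ∈ range C.top
    · exact Or.inr (Or.inr h2)
    · exact Or.inr (Or.inl fun h ↦ h.elim h1 h2)

theorem ConeChoice.mem_domain_of_top {n : N} (κ : ConeChoice C ν n) {z : St C ν}
    (hz : C.top n = St.toW z) : z ∈ κ.domain := by
  change Double.half (range C.top) false (St.toW z) ∈ κ.bicollar.target
  rw [← hz, ← κ.bicollar_zero n κ.mem_U]
  refine κ.bicollar.map_source ?_
  rw [κ.bicollar_source]
  exact ⟨κ.mem_U, neg_lt_zero.2 κ.ε_pos, κ.ε_pos⟩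

/-- The outer region, the middle region and the domains of cone charts cover the space, and on each
of these open sets the same map is a diffeomorphism for both structures. -/
theorem smoothAt_id_of_isStandardOffCone {S S' : SmoothStructure (m + k + 1) (St C ν)}
    (hS : IsStandardOffCone C ν S) (hS' : IsStandardOffCone C ν S')
    (hc : ∀ n : N, ∃ κ : ConeChoice C ν n, κ.IsChartOf S ∧ κ.IsChartOf S') (z : St C ν) :
    SmoothAt S S' id z := by
  rcases St.mem_region z with hz | hz | ⟨n, hn⟩
  · exact smoothAt_of_isDiffeoOnto hS.1.1 hS.1.2 hS'.1.2 (mapsTo_id _) contMDiffOn_id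
      (fun _ _ ↦ rfl) hz
  · exact smoothAt_of_isDiffeoOnto hS.2.1 hS.2.2 hS'.2.2 (mapsTo_id _) contMDiffOn_id
      (fun _ _ ↦ rfl) hz
  · obtain ⟨κ, h, h'⟩ := hc n
    exact smoothAt_of_isDiffeoOnto h.1 h.2 h'.2 (mapsTo_id _) contMDiffOn_id
      (fun _ _ ↦ rfl) (κ.mem_domain_of_top hn)

theorem eq_of_isStandardOffCone {S S' : SmoothStructure (m + k + 1) (St C ν)}
    (hS : IsStandardOffCone C ν S) (hS' : IsStandardOffCone C ν S')
    (hc : ∀ n : N, ∃ κ : ConeChoice C ν n, κ.IsChartOf S ∧ κ.IsChartOf S') : S = S' :=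
  SmoothStructure.eq_of_smoothAt (smoothAt_id_of_isStandardOffCone hS hS' hc)
    (smoothAt_id_of_isStandardOffCone hS' hS fun n ↦ (hc n).imp fun _ h ↦ h.symm)

/-- The inverse charts use an arbitrary point as a default value, so the empty case is separate.
Then `D(ν)` is empty too, because `(e, 1)` lies in the trivial region for every `e`. -/
theorem exists_structure_of_isEmpty [IsEmpty (St C ν)] :
    ∃ S : SmoothStructure (m + k + 1) (St C ν), IsStandardOffCone C ν S := by
  have hE : IsEmpty E := ⟨fun e ↦ isEmptyElim (α := St C ν) (Quot.mk _ (Sum.inl ⟨(e, 1),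
    by norm_num, (le_abs_self 1).trans (ν.abs_snd_le_nrmR (e, 1))⟩))⟩
  let S : SmoothStructure (m + k + 1) (St C ν) :=
    SmoothStructure.ofCharts ∅ (fun z ↦ isEmptyElim z) fun e he ↦ absurd he id
  let _ := S.chartedSpace
  exact ⟨S, ⟨isOpen_outerRegion C ν, IsDiffeoOnto.of_isEmpty _ _ _⟩, isOpen_middleRegion C ν,
    IsDiffeoOnto.of_isEmpty _ _ _⟩

theorem nonempty_prod_equiv_euclideanSpace :
    Nonempty ((EuclideanSpace ℝ (Fin k) × ℝ) ≃L[ℝ] EuclideanSpace ℝ (Fin (k + 1))) := by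
  have h : Module.finrank ℝ (EuclideanSpace ℝ (Fin k) × ℝ) =
      Module.finrank ℝ (EuclideanSpace ℝ (Fin (k + 1))) := by simp
  exact ⟨(LinearEquiv.ofFinrankEq _ _ h).toContinuousLinearEquiv⟩

theorem outerHomeo_inter_subset {n : N} (κ : ConeChoice C ν n) :
    outerRegion C ν ∩ κ.domain ⊆ middleRegion C ν := fun _ hz h ↦
  h.elim (κ.toW_notMem_bottom hz.2) hz.1.2

theorem isDiffeoOnto_encase [Nonempty (St C ν)] {S : SmoothStructure (m + k + 1) (St C ν)}
    (h : S.IsDiffeoOnto ((corners (m + k)).prod (𝓡∂ 1)) (outerHomeo C ν) (outerHomeo C ν).source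
      (outerHomeo C ν).target) :
    S.IsDiffeoOnto ((corners (m + k)).prod 𝓘(ℝ, ℝ)) St.encase (outerRegion C ν)
      (St.encase '' outerRegion C ν) := by
  let _ := S.chartedSpace
  refine IsDiffeoOnto.onto_image h contMDiff_inclIcc.contMDiffOn
    (contMDiffOn_projIccSnd.mono ?_) (fun z _ ↦ ?_) fun z _ ↦ rfl
  · rintro _ ⟨z, -, rfl⟩
    exact St.encase_snd_mem z
  · exact (inclIcc_projIccSnd (St.encase_snd_mem z)).symm

/-- Smoothness on a subset is local, so near each point both directions are read in polar
coordinates over a trivialization. -/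
theorem isDiffeoOnto_pair [Nonempty (St C ν)] {S : SmoothStructure (m + k + 1) (St C ν)}
    (h : ∀ φ : RoundTriv (m := m) (k := k) ν.proj ν.nrm,
      S.IsDiffeoOnto ((corners (m + 1)).prod (𝓡 k)) (polarHomeo C φ) (polarHomeo C φ).source
        (polarHomeo C φ).target) :
    S.IsDiffeoOnto (pairModel m k) St.pair (middleRegion C ν) (St.pair '' middleRegion C ν) := by
  let _ := S.chartedSpace
  have hinv : ∀ z ∈ middleRegion C ν, St.ofNontrivial C ν (St.pair z) = z := fun z hz ↦
    (St.pair_mem fun h ↦ hz (Or.inl h)).2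
  refine ⟨fun z hz ↦ ?_, mapsTo_image _ _, St.ofNontrivial C ν, ?_, ?_, hinv, ?_⟩
  · obtain ⟨φ, hφ⟩ := ν.locally_trivial (C.r (St.toW z))
    have hz' : z ∈ (polarHomeo C φ).source := ⟨hz, hφ⟩
    have h1 : ContMDiffOn (corners (m + k + 1)) (pairModel m k) ∞
        (fun z ↦ polarInv C φ (polarHomeo C φ z)) (polarHomeo C φ).source :=
      (contMDiffOn_polarInv φ).comp (h φ).1 fun y hy ↦ hy.2
    refine ((h1.congr fun y hy ↦ ?_).contMDiffAt
      ((polarHomeo C φ).open_source.mem_nhds hz')).contMDiffWithinAt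
    have h2 := St.pair_ofNontrivial (polarInv_mem φ ((polarHomeo C φ).map_source hy).2)
    rw [← h2]
    exact congrArg St.pair ((polarHomeo C φ).left_inv hy).symm
  · rintro _ ⟨z, hz, rfl⟩
    obtain ⟨φ, hφ⟩ := ν.locally_trivial (C.r (St.toW z))
    have hO : IsOpen {q : W × (E × ℝ) | C.r q.1 ∈ φ.base} :=
      φ.isOpen_base.preimage (C.r_smooth.continuous.comp continuous_fst)
    have h1 : ContMDiffOn (pairModel m k) (corners (m + k + 1)) ∞
        (fun q ↦ (polarHomeo C φ).symm (polarFun φ q))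
        (St.pair '' middleRegion C ν ∩ {q | C.r q.1 ∈ φ.base}) := by
      refine (h φ).contMDiffOn_symm.comp ((contMDiffOn_polarFun φ).mono ?_) ?_
      · rintro _ ⟨⟨y, hy, rfl⟩, hy'⟩
        exact pair_mem_of_mem_polarSource φ ⟨hy, hy'⟩
      · rintro _ ⟨⟨y, hy, rfl⟩, hy'⟩
        exact (polarHomeo C φ).map_source ⟨hy, hy'⟩
    have h2 : ContMDiffWithinAt (pairModel m k) (corners (m + k + 1)) ∞ (St.ofNontrivial C ν)
        (St.pair '' middleRegion C ν ∩ {q | C.r q.1 ∈ φ.base}) (St.pair z) := by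
      refine (h1.congr ?_) _ ⟨mem_image_of_mem _ hz, hφ⟩
      rintro _ ⟨⟨y, hy, rfl⟩, hy'⟩
      rw [hinv y hy]
      exact ((polarHomeo C φ).left_inv ⟨hy, hy'⟩).symm
    exact (contMDiffWithinAt_inter (hO.mem_nhds hφ)).1 h2
  · rintro _ ⟨z, hz, rfl⟩
    rw [hinv z hz]
    exact hz
  · rintro _ ⟨z, hz, rfl⟩
    rw [hinv z hz]

variable [IsManifold (corners m) ∞ M] [IsManifold (corners m) ∞ N]
  [IsManifold (corners (m + 1)) ∞ W] [IsManifold (corners (m + k)) ∞ E]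

theorem exists_structure_of_nonempty [Nonempty (St C ν)] (hN : ∀ n : N, Nonempty (ConeChoice C ν n)) :
    ∃ S : SmoothStructure (m + k + 1) (St C ν),
      S.IsDiffeoOnto ((corners (m + k)).prod (𝓡∂ 1)) (outerHomeo C ν) (outerHomeo C ν).source
        (outerHomeo C ν).target ∧
      (∀ φ : RoundTriv (m := m) (k := k) ν.proj ν.nrm,
        S.IsDiffeoOnto ((corners (m + 1)).prod (𝓡 k)) (polarHomeo C φ) (polarHomeo C φ).source
        (polarHomeo C φ).target) ∧
      ∀ (n : N) (κ : ConeChoice C ν n), κ.IsChartOf S := by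
  -- The models of `D(ν) × [-1,1]`, `W × S^k` and `N × (ℝ^k × ℝ)` are all embedded in a quadrant of
  -- dimension `m + k + 1`.
  obtain ⟨c₁, hc₁⟩ := exists_isModelEmbedding_halfSpace (a := m + k) (d := m + k + 1) rfl
  obtain ⟨c₂, hc₂⟩ := exists_isModelEmbedding_prod (a := m + 1) (d := m + k + 1) (by omega)
    (ContinuousLinearEquiv.refl ℝ (EuclideanSpace ℝ (Fin k)))
  obtain ⟨c₃, hc₃⟩ := exists_isModelEmbedding_prod (a := m) (d := m + k + 1) (by omega)
    (nonempty_prod_equiv_euclideanSpace (k := k)).some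
  set A : Set (OpenPartialHomeomorph (St C ν) (EuclideanQuadrant (m + k + 1))) :=
    pieceCharts (outerHomeo C ν) c₁ ∪
      ((⋃ φ : RoundTriv (m := m) (k := k) ν.proj ν.nrm, pieceCharts (polarHomeo C φ) c₂) ∪
        ⋃ (n : N) (κ : ConeChoice C ν n), pieceCharts κ.chartHomeo c₃) with hA
  have h₁ : pieceCharts (outerHomeo C ν) c₁ ⊆ A := subset_union_left
  have h₂ : ∀ φ, pieceCharts (polarHomeo C φ) c₂ ⊆ A := fun φ ↦
    (subset_iUnion (fun φ ↦ pieceCharts (polarHomeo C φ) c₂) φ).trans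
      (subset_union_left.trans subset_union_right)
  have h₃ : ∀ {n : N} (κ : ConeChoice C ν n), pieceCharts κ.chartHomeo c₃ ⊆ A := fun {n} κ ↦
    (subset_iUnion₂ (s := fun n (κ : ConeChoice C ν n) ↦ pieceCharts κ.chartHomeo c₃) n κ).trans
      (subset_union_right.trans subset_union_right)
  have hcover : ∀ z, ∃ e ∈ A, z ∈ e.source := by
    intro z
    rcases St.mem_region z with hz | hz | ⟨n, hn⟩
    · obtain ⟨e, he, hz⟩ := exists_mem_pieceCharts hc₁ (outerHomeo C ν) hz
      exact ⟨e, h₁ he, hz⟩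
    · obtain ⟨φ, hφ⟩ := ν.locally_trivial (C.r (St.toW z))
      obtain ⟨e, he, hz⟩ := exists_mem_pieceCharts hc₂ (polarHomeo C φ) ⟨hz, hφ⟩
      exact ⟨e, h₂ φ he, hz⟩
    · obtain ⟨κ⟩ := hN n
      obtain ⟨e, he, hz⟩ := exists_mem_pieceCharts hc₃ κ.chartHomeo (κ.mem_domain_of_top hn)
      exact ⟨e, h₃ κ he, hz⟩
  have hcompat : ∀ e ∈ A, ∀ e' ∈ A, ContMDiffOn (corners (m + k + 1)) (corners (m + k + 1)) ∞
      (e.symm ≫ₕ e') (e.symm ≫ₕ e').source := by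
    have o := isCompatibleOnMiddle_outerHomeo (C := C) (ν := ν)
    have p := fun φ ↦ isCompatibleOnMiddle_polarHomeo (C := C) (ν := ν) φ
    intro e he e' he'
    simp only [hA, mem_union, mem_iUnion] at he he'
    -- All but two kinds of overlaps lie in the middle region. The exceptions are the outer piece
    -- with itself, where the transition is the identity, and pairs of cone charts, where Whitney's
    -- theorem is needed.
    rcases he with he | ⟨φ, he⟩ | ⟨n, κ, he⟩ <;> rcases he' with he' | ⟨φ', he'⟩ | ⟨n', κ', he'⟩
    · refine contMDiffOn_pieceCharts hc₁ hc₁ ?_ e he e' he'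
      exact contMDiffOn_id.congr fun y hy ↦ (outerHomeo C ν).right_inv hy.1
    · exact contMDiffOn_pieceCharts hc₁ hc₂ (o.contMDiffOn_trans (p φ') fun _ hz ↦ hz.2.1)
        e he e' he'
    · exact contMDiffOn_pieceCharts hc₁ hc₃ (o.contMDiffOn_trans κ'.isCompatibleOnMiddle
        (outerHomeo_inter_subset κ')) e he e' he'
    · exact contMDiffOn_pieceCharts hc₂ hc₁ ((p φ).contMDiffOn_trans o fun _ hz ↦ hz.1.1)
        e he e' he'
    · exact contMDiffOn_pieceCharts hc₂ hc₂ ((p φ).contMDiffOn_trans (p φ') fun _ hz ↦ hz.1.1)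
        e he e' he'
    · exact contMDiffOn_pieceCharts hc₂ hc₃ ((p φ).contMDiffOn_trans κ'.isCompatibleOnMiddle
        fun _ hz ↦ hz.1.1) e he e' he'
    · exact contMDiffOn_pieceCharts hc₃ hc₁ (κ.isCompatibleOnMiddle.contMDiffOn_trans o
        fun _ hz ↦ outerHomeo_inter_subset κ hz.symm) e he e' he'
    · exact contMDiffOn_pieceCharts hc₃ hc₂ (κ.isCompatibleOnMiddle.contMDiffOn_trans (p φ')
        fun _ hz ↦ hz.2.1) e he e' he'
    · exact contMDiffOn_pieceCharts hc₃ hc₃ (κ.contMDiffOn_chartHomeo_symm_trans κ') e he e' he'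
  have hsub := SmoothStructure.subset_ofCharts hcover hcompat
  exact ⟨SmoothStructure.ofCharts A hcover hcompat,
    SmoothStructure.isDiffeoOnto_of_pieceCharts hc₁ (h₁.trans hsub), fun φ ↦
    SmoothStructure.isDiffeoOnto_of_pieceCharts hc₂ ((h₂ φ).trans hsub), fun n κ ↦
    ⟨κ.isOpen_domain, SmoothStructure.isDiffeoOnto_of_pieceCharts hc₃ ((h₃ κ).trans hsub)⟩⟩

theorem exists_structure (hN : ∀ n : N, Nonempty (ConeChoice C ν n)) :
    ∃ S : SmoothStructure (m + k + 1) (St C ν), IsStandardOffCone C ν S ∧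
      ∀ (n : N) (κ : ConeChoice C ν n), κ.IsChartOf S := by
  rcases isEmpty_or_nonempty (St C ν) with hSt | hSt
  · obtain ⟨S, hS⟩ := exists_structure_of_isEmpty (C := C) (ν := ν)
    exact ⟨S, hS, fun n κ ↦ absurd κ.nonempty_st (not_nonempty_iff.2 hSt)⟩
  · obtain ⟨S, h1, h2, h3⟩ := exists_structure_of_nonempty hN
    exact ⟨S, ⟨⟨isOpen_outerRegion C ν, isDiffeoOnto_encase h1⟩, isOpen_middleRegion C ν,
      isDiffeoOnto_pair h2⟩, h3⟩

end Structure

/-! ### Smoothness of the actions -/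

section Actions

variable {G : Type uG} [Group G] {m k : ℕ}
  {M : Type uM} [TopologicalSpace M] [ChartedSpace (EuclideanQuadrant m) M] [MulAction G M]
  {N : Type uN} [TopologicalSpace N] [ChartedSpace (EuclideanQuadrant m) N] [MulAction G N]
  {W : Type uW} [TopologicalSpace W] [ChartedSpace (EuclideanQuadrant (m + 1)) W] [MulAction G W]
  {E : Type uE} [TopologicalSpace E] [ChartedSpace (EuclideanQuadrant (m + k)) E] [MulAction G E]
  {C : EncasedHCobordism G m M N W} {ν : RoundBundle G m k M E}

/-- The translate of a trivialization by a group element. -/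
def RoundTriv.translate (φ : RoundTriv (m := m) (k := k) ν.proj ν.nrm) (g : G)
    (hM : IsGManifold G m M) (hE : IsGManifold G (m + k) E) :
    RoundTriv (m := m) (k := k) ν.proj ν.nrm where
  base := (fun x ↦ g⁻¹ • x) ⁻¹' φ.base
  isOpen_base := φ.isOpen_base.preimage (hM.smooth_smul g⁻¹).continuous
  param x v := g • φ.param (g⁻¹ • x) v
  coord e := φ.coord (g⁻¹ • e)
  proj_param x hx v hv := by rw [ν.proj_smul, φ.proj_param _ hx v hv, smul_inv_smul]
  coord_param x hx v hv := by rw [inv_smul_smul, φ.coord_param _ hx v hv]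
  coord_mem e he := φ.coord_mem _ (by rw [ν.proj_smul]; exact he)
  param_coord e he := by
    rw [← ν.proj_smul, φ.param_coord _ (by rw [ν.proj_smul]; exact he), smul_inv_smul]
  smooth_param := (hE.smooth_smul g).comp_contMDiffOn (φ.smooth_param.comp
    (((hM.smooth_smul g⁻¹).comp contMDiff_fst).prodMk contMDiff_snd).contMDiffOn
    fun _ hq ↦ ⟨hq.1, hq.2⟩)
  smooth_coord := φ.smooth_coord.comp (hE.smooth_smul g⁻¹).contMDiffOn fun e he ↦ by
    rw [mem_preimage, mem_preimage, ν.proj_smul]; exact he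
  round e he := by rw [φ.round _ (by rw [ν.proj_smul]; exact he), ν.nrm_smul]

theorem EncasedHCobordism.act_inv_act (g : G) (x : C.Dbl) : C.act g⁻¹ (C.act g x) = x := by
  rw [C.act_act, inv_mul_cancel, C.act_one]

theorem EncasedHCobordism.act_act_inv (g : G) (x : C.Dbl) : C.act g (C.act g⁻¹ x) = x := by
  rw [C.act_act, mul_inv_cancel, C.act_one]

/-- The translate of the choices at a point of the cone locus by a group element. -/
def ConeChoice.translate {n : N} (κ : ConeChoice C ν n) (g : G) (hM : IsGManifold G m M)
    (hN : IsGManifold G m N) (hE : IsGManifold G (m + k) E) : ConeChoice C ν (g • n) where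
  U := (fun n' ↦ g⁻¹ • n') ⁻¹' κ.U
  isOpen_U := κ.isOpen_U.preimage (hN.smooth_smul g⁻¹).continuous
  mem_U := by rw [mem_preimage, inv_smul_smul]; exact κ.mem_U
  ε := κ.ε
  ε_pos := κ.ε_pos
  bicollar :=
    { toFun q := C.act g (κ.bicollar (g⁻¹ • q.1, q.2))
      invFun x := (g • (κ.bicollar.symm (C.act g⁻¹ x)).1, (κ.bicollar.symm (C.act g⁻¹ x)).2)
      source := (fun q ↦ (g⁻¹ • q.1, q.2)) ⁻¹' κ.bicollar.source
      target := C.act g⁻¹ ⁻¹' κ.bicollar.target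
      map_source' q hq := by
        rw [mem_preimage, C.act_inv_act]
        exact κ.bicollar.map_source hq
      map_target' x hx := by
        rw [mem_preimage, inv_smul_smul]
        exact κ.bicollar.map_target hx
      left_inv' q hq := by
        rw [C.act_inv_act, κ.bicollar.left_inv hq, smul_inv_smul]
      right_inv' x hx := by
        rw [inv_smul_smul, Prod.mk.eta, κ.bicollar.right_inv hx, C.act_act_inv]
      open_source := κ.bicollar.open_source.preimage
        (((hN.smooth_smul g⁻¹).continuous.comp continuous_fst).prodMk continuous_snd)
      open_target := κ.bicollar.open_target.preimage (C.contMDiff_act g⁻¹).continuous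
      continuousOn_toFun := (C.contMDiff_act g).continuous.comp_continuousOn
        (κ.bicollar.continuousOn.comp (((hN.smooth_smul g⁻¹).continuous.comp
          continuous_fst).prodMk continuous_snd).continuousOn fun _ hq ↦ hq)
      continuousOn_invFun := (((hN.smooth_smul g).continuous.comp continuous_fst).prodMk
        continuous_snd).comp_continuousOn (κ.bicollar.symm.continuousOn.comp
          (C.contMDiff_act g⁻¹).continuous.continuousOn fun _ hx ↦ hx) }
  bicollar_source := by
    dsimp only
    rw [κ.bicollar_source]
    rfl
  smooth_bicollar := (C.contMDiff_act g).comp_contMDiffOn (κ.contMDiffOn_bicollar.comp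
    (((hN.smooth_smul g⁻¹).comp contMDiff_fst).prodMk contMDiff_snd).contMDiffOn fun _ hq ↦ hq)
  smooth_bicollar_symm := (((hN.smooth_smul g).comp contMDiff_fst).prodMk
    contMDiff_snd).comp_contMDiffOn (κ.contMDiffOn_bicollar_symm.comp
      (C.contMDiff_act g⁻¹).contMDiffOn fun _ hx ↦ hx)
  bicollar_zero n' hn' := by
    change C.act g (κ.bicollar (g⁻¹ • n', 0)) = C.half false (C.top n')
    rw [κ.bicollar_zero _ hn', C.act_half_top, smul_inv_smul]
  bicollar_neg q hq := by
    change C.act g (κ.bicollar (g⁻¹ • q.1, -q.2)) = C.flip (C.act g (κ.bicollar (g⁻¹ • q.1, q.2)))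
    rw [← C.act_flip]
    exact congrArg _ (κ.bicollar_neg _ hq)
  h_bicollar q hq := (C.hDbl_act g _).trans (κ.h_bicollar _ hq)
  triv := κ.triv.translate g hM hE
  mem_base := by
    change g⁻¹ • C.r (C.top (g • n)) ∈ κ.triv.base
    rw [← C.r_smul, ← C.top_smul, inv_smul_smul]
    exact κ.mem_base
  r_bicollar q hq := by
    change g⁻¹ • C.rDbl (C.act g (κ.bicollar (g⁻¹ • q.1, q.2))) ∈ κ.triv.base
    rw [C.rDbl_act, inv_smul_smul]
    exact κ.r_bicollar _ hq

theorem ConeChoice.half_smul_toW (g : G) (z : St C ν) :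
    C.act g⁻¹ (C.half false (St.toW (St.smul g z))) = C.half false (St.toW z) := by
  rw [St.toW_smul, C.act_half, inv_smul_smul]

theorem ConeChoice.smul_mem_domain_translate {n : N} (κ : ConeChoice C ν n) (g : G)
    (hM : IsGManifold G m M) (hN : IsGManifold G m N) (hE : IsGManifold G (m + k) E) {z : St C ν}
    (hz : z ∈ κ.domain) : St.smul g z ∈ (κ.translate g hM hN hE).domain := by
  change C.act g⁻¹ (C.half false (St.toW (St.smul g z))) ∈ κ.bicollar.target
  rw [ConeChoice.half_smul_toW]
  exact hz

theorem ConeChoice.chart_translate_smul {n : N} (κ : ConeChoice C ν n) (g : G)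
    (hM : IsGManifold G m M) (hN : IsGManifold G m N) (hE : IsGManifold G (m + k) E) (z : St C ν) :
    (κ.translate g hM hN hE).chart (St.smul g z) = (g • (κ.chart z).1, (κ.chart z).2) := by
  change (g • (κ.bicollar.symm (C.act g⁻¹ (C.half false (St.toW (St.smul g z))))).1,
    (κ.triv.coord (g⁻¹ • (St.encase (St.smul g z)).1), (St.encase (St.smul g z)).2)) = _
  rw [ConeChoice.half_smul_toW, St.encase_smul, inv_smul_smul]
  rfl

theorem ConeChoice.flip_mem_domain {n : N} (κ : ConeChoice C ν n) {z : St C ν}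
    (hz : z ∈ κ.domain) : St.flip z ∈ κ.domain := by
  change C.half false (St.toW (St.flip z)) ∈ κ.bicollar.target
  rw [St.toW_flip]
  exact hz

theorem ConeChoice.chart_flip {n : N} (κ : ConeChoice C ν n) (z : St C ν) :
    κ.chart (St.flip z) = ((κ.chart z).1, ((κ.chart z).2.1, -(κ.chart z).2.2)) := by
  rw [ConeChoice.chart, St.toW_flip, St.encase_flip]
  rfl

/-- The set where the encasing function inverts the collar is invariant, because the collar, `r` and
`h` are equivariant. A translate of its interior is an open subset of it, hence contained in the
interior. -/
theorem EncasedHCobordism.smul_mem_core (hM : IsGManifold G m M) (g : G) {q : M × Icc (-1 : ℝ) 0}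
    (hq : q ∈ C.core) : (g • q.1, q.2) ∈ C.core := by
  have ho : IsOpen ((fun q : M × Icc (-1 : ℝ) 0 ↦ (g⁻¹ • q.1, q.2)) ⁻¹' C.core) :=
    C.isOpen_core.preimage
      (((hM.smooth_smul g⁻¹).continuous.comp continuous_fst).prodMk continuous_snd)
  refine interior_maximal (fun q' hq' ↦ ?_) ho (show (g⁻¹ • g • q.1, q.2) ∈ C.core by
    rw [inv_smul_smul]; exact hq)
  obtain ⟨h1, h2, h3⟩ := mem_core hq'
  have h4 := C.collar_source_smul g _ h1
  have h5 := C.collar_smul g _ h1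
  dsimp only at h2 h3 h4 h5
  rw [smul_inv_smul, Prod.mk.eta] at h4 h5
  refine ⟨h4, ?_, ?_⟩
  · rw [h5, C.r_smul, h2, smul_inv_smul]
  · rw [h5, C.h_smul, h3]

theorem EncasedHCobordism.smul_mem_collarNhd (hM : IsGManifold G m M) (g : G) {w : W}
    (hw : w ∈ collarNhd C) : g • w ∈ collarNhd C := by
  obtain ⟨q, hq, rfl⟩ := hw
  rw [← C.collar_smul g q (mem_core hq).1]
  exact mem_image_of_mem _ (C.smul_mem_core hM g hq)

theorem EncasedHCobordism.smul_mem_top_iff (g : G) (w : W) :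
    g • w ∈ range C.top ↔ w ∈ range C.top := by
  refine ⟨fun h ↦ ?_, C.smul_mem_top g w⟩
  have := C.smul_mem_top g⁻¹ _ h
  rwa [inv_smul_smul] at this

theorem EncasedHCobordism.smul_mem_bottom_iff (g : G) (w : W) :
    g • w ∈ range C.bottom ↔ w ∈ range C.bottom := by
  have key : ∀ (g : G) (w : W), w ∈ range C.bottom → g • w ∈ range C.bottom := by
    rintro g _ ⟨x, rfl⟩
    exact ⟨g • x, C.bottom_smul g x⟩
  refine ⟨fun h ↦ ?_, key g w⟩
  have := key g⁻¹ _ h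
  rwa [inv_smul_smul] at this

theorem St.smul_mem_outerRegion (hM : IsGManifold G m M) (g : G) {z : St C ν}
    (hz : z ∈ outerRegion C ν) : St.smul g z ∈ outerRegion C ν := by
  change St.toW (St.smul g z) ∈ collarNhd C \ range C.top
  rw [St.toW_smul]
  exact ⟨C.smul_mem_collarNhd hM g hz.1, fun h ↦ hz.2 ((C.smul_mem_top_iff g _).1 h)⟩

theorem St.smul_mem_middleRegion (g : G) {z : St C ν} (hz : z ∈ middleRegion C ν) :
    St.smul g z ∈ middleRegion C ν := by
  change St.toW (St.smul g z) ∈ (range C.bottom ∪ range C.top)ᶜ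
  rw [St.toW_smul]
  exact fun h ↦ hz (h.imp (C.smul_mem_bottom_iff g _).1 (C.smul_mem_top_iff g _).1)

theorem St.flip_mem_outerRegion {z : St C ν} (hz : z ∈ outerRegion C ν) :
    St.flip z ∈ outerRegion C ν := by
  change St.toW (St.flip z) ∈ collarNhd C \ range C.top
  rw [St.toW_flip]
  exact hz

theorem St.flip_mem_middleRegion {z : St C ν} (hz : z ∈ middleRegion C ν) :
    St.flip z ∈ middleRegion C ν := by
  change St.toW (St.flip z) ∈ (range C.bottom ∪ range C.top)ᶜ
  rw [St.toW_flip]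
  exact hz

variable {S : SmoothStructure (m + k + 1) (St C ν)}

/-- Off the cone locus, `g` acts through its smooth actions on `W` and `D(ν)`. At the cone locus the
translated choice is used at the image point; between these two charts only the factor `N` is moved,
whatever the trivialization. -/
theorem smoothAt_smul (hM : IsGManifold G m M) (hN : IsGManifold G m N)
    (hW : IsGManifold G (m + 1) W) (hE : IsGManifold G (m + k) E) (hS : IsStandardOffCone C ν S)
    (hκ : ∀ (n : N) (κ : ConeChoice C ν n), κ.IsChartOf S)
    (hn : ∀ n : N, Nonempty (ConeChoice C ν n)) (g : G) (z : St C ν) :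
    SmoothAt S S (St.smul g) z := by
  rcases St.mem_region z with hz | hz | ⟨n, hz⟩
  · exact smoothAt_of_isDiffeoOnto (ψ := fun u ↦ (g • u.1, u.2)) hS.1.1 hS.1.2 hS.1.2
      (fun _ hz ↦ St.smul_mem_outerRegion hM g hz)
      (((hE.smooth_smul g).comp contMDiff_fst).prodMk contMDiff_snd).contMDiffOn
      (fun z _ ↦ St.encase_smul g z) hz
  · refine smoothAt_of_isDiffeoOnto (ψ := fun q ↦ (g • q.1, (g • q.2.1, q.2.2))) hS.2.1 hS.2.2
      hS.2.2 (fun _ hz ↦ St.smul_mem_middleRegion g hz) (ContMDiff.contMDiffOn ?_)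
      (fun z _ ↦ Prod.ext (St.toW_smul g z) (St.encase_smul g z)) hz
    exact ((hW.smooth_smul g).comp contMDiff_fst).prodMk
      (((hE.smooth_smul g).comp (contMDiff_fst.comp contMDiff_snd)).prodMk
        (contMDiff_snd.comp contMDiff_snd))
  · obtain ⟨κ⟩ := hn n
    exact smoothAt_of_isDiffeoOnto (ψ := fun p ↦ (g • p.1, p.2)) (hκ n κ).1 (hκ n κ).2
      (hκ _ (κ.translate g hM hN hE)).2
      (fun _ hz ↦ κ.smul_mem_domain_translate g hM hN hE hz)
      (((hN.smooth_smul g).comp contMDiff_fst).prodMk contMDiff_snd).contMDiffOn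
      (fun z _ ↦ κ.chart_translate_smul g hM hN hE z) (κ.mem_domain_of_top hz)

/-- In all three kinds of charts the reflection becomes `t ↦ -t`. It preserves their domains because
it does not move the point of `W`. -/
theorem smoothAt_flip (hS : IsStandardOffCone C ν S)
    (hκ : ∀ (n : N) (κ : ConeChoice C ν n), κ.IsChartOf S)
    (hn : ∀ n : N, Nonempty (ConeChoice C ν n)) (z : St C ν) : SmoothAt S S St.flip z := by
  rcases St.mem_region z with hz | hz | ⟨n, hz⟩
  · exact smoothAt_of_isDiffeoOnto (ψ := fun u ↦ (u.1, -u.2)) hS.1.1 hS.1.2 hS.1.2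
      (fun _ hz ↦ St.flip_mem_outerRegion hz)
      (contMDiff_fst.prodMk (contDiff_neg.contMDiff.comp contMDiff_snd)).contMDiffOn
      (fun z _ ↦ St.encase_flip z) hz
  · refine smoothAt_of_isDiffeoOnto (ψ := fun q ↦ (q.1, (q.2.1, -q.2.2))) hS.2.1 hS.2.2
      hS.2.2 (fun _ hz ↦ St.flip_mem_middleRegion hz) (ContMDiff.contMDiffOn ?_)
      (fun z _ ↦ Prod.ext (St.toW_flip z) (St.encase_flip z)) hz
    exact contMDiff_fst.prodMk ((contMDiff_fst.comp contMDiff_snd).prodMk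
      (contDiff_neg.contMDiff.comp (contMDiff_snd.comp contMDiff_snd)))
  · obtain ⟨κ⟩ := hn n
    refine smoothAt_of_isDiffeoOnto (ψ := fun p ↦ (p.1, (p.2.1, -p.2.2))) (hκ n κ).1 (hκ n κ).2
      (hκ n κ).2 (fun _ hz ↦ κ.flip_mem_domain hz) (ContMDiff.contMDiffOn ?_)
      (fun z _ ↦ κ.chart_flip z) (κ.mem_domain_of_top hz)
    exact contMDiff_fst.prodMk ((contDiff_fst.prodMk contDiff_snd.neg).contMDiff.comp contMDiff_snd)

theorem actsSmoothly (hM : IsGManifold G m M) (hN : IsGManifold G m N)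
    (hW : IsGManifold G (m + 1) W) (hE : IsGManifold G (m + k) E) (hS : IsStandardOffCone C ν S)
    (hκ : ∀ (n : N) (κ : ConeChoice C ν n), κ.IsChartOf S)
    (hn : ∀ n : N, Nonempty (ConeChoice C ν n)) : ActsSmoothly S :=
  ⟨fun g z ↦ smoothAt_smul hM hN hW hE hS hκ hn g z, fun z ↦ smoothAt_flip hS hκ hn z⟩

end Actions

end PolarStab

end

theorem mainTheorem5
    {G : Type*} [Group G] [Finite G] {m k : ℕ}
    {M : Type*} [TopologicalSpace M] [T2Space M] [SecondCountableTopology M] [CompactSpace M]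
    [ChartedSpace (EuclideanQuadrant m) M] [IsManifold (PolarStab.corners m) ∞ M] [MulAction G M]
    {N : Type*} [TopologicalSpace N] [T2Space N] [SecondCountableTopology N]
    [ChartedSpace (EuclideanQuadrant m) N] [IsManifold (PolarStab.corners m) ∞ N] [MulAction G N]
    {W : Type*} [TopologicalSpace W] [T2Space W] [SecondCountableTopology W] [CompactSpace W]
    [ChartedSpace (EuclideanQuadrant (m + 1)) W] [IsManifold (PolarStab.corners (m + 1)) ∞ W]
    [MulAction G W]
    {E : Type*} [TopologicalSpace E] [T2Space E] [SecondCountableTopology E]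
    [ChartedSpace (EuclideanQuadrant (m + k)) E] [IsManifold (PolarStab.corners (m + k)) ∞ E]
    [MulAction G E]
    (hM : PolarStab.IsGManifold G m M) (hN : PolarStab.IsGManifold G m N)
    (hW : PolarStab.IsGManifold G (m + 1) W) (hE : PolarStab.IsGManifold G (m + k) E)
    (C : PolarStab.EncasedHCobordism G m M N W) (ν : PolarStab.RoundBundle G m k M E) :
    (∀ (n n' : N) (κ : PolarStab.ConeChoice C ν n) (κ' : PolarStab.ConeChoice C ν n'),
      κ.Compatible κ') ∧
    (∀ n : N, ∃ κ : PolarStab.ConeChoice C ν n, κ.IsEquivariant) ∧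
    ∃ S : PolarStab.SmoothStructure (m + k + 1) (PolarStab.St C ν),
      PolarStab.IsStandardOffCone C ν S ∧
      (∀ (n : N) (κ : PolarStab.ConeChoice C ν n), κ.IsChartOf S) ∧
      (∀ S' : PolarStab.SmoothStructure (m + k + 1) (PolarStab.St C ν),
        PolarStab.IsStandardOffCone C ν S' →
        (∀ n : N, ∃ κ : PolarStab.ConeChoice C ν n, κ.IsChartOf S') → S' = S) ∧
      PolarStab.ActsSmoothly S := by
  have hκ (n : N) : ∃ κ : PolarStab.ConeChoice C ν n, κ.IsEquivariant :=
    PolarStab.exists_isEquivariant_coneChoice C hM hN ν n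
  have hn (n : N) : Nonempty (PolarStab.ConeChoice C ν n) := ⟨(hκ n).choose⟩
  obtain ⟨S, hS, hc⟩ := PolarStab.exists_structure (C := C) (ν := ν) hn
  refine ⟨fun n n' κ κ' ↦ κ.compatible κ', hκ, S, hS, hc, fun S' hS' hc' ↦ ?_,
    PolarStab.actsSmoothly hM hN hW hE hS hc hn⟩
  -- Since `S` admits every cone chart, the ones supplied for `S'` are common to both structures.
  exact PolarStab.eq_of_isStandardOffCone hS' hS fun n ↦ (hc' n).imp fun κ h ↦ ⟨h, hc n κ⟩
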